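/- Let $h\ge 0$, $p_0(x,\xi;h)=\tfrac12x(x^2+\xi^2)-\tfrac32hx$ on $\mathbb{R}^2$, and consider Hamilton's equations $\dot x=\partial_\xi p_0$, $\dot\xi=-\partial_xp_0$. A trajectory is a solution on an open interval $I\subseteq\mathbb{R}$; $C_0$ denotes its (conserved) energy $p_0(x(t),\xi(t);h)$. (0) The stationary points are exactly $(0,\pm\sqrt{3h})$ and $(\pm\sqrt h,0)$. (1) Let $C_0\neq0$ and $C_0^2\ne h^3$. There is a period lattice whose Weierstrass function $\wp$ has invariants $g_2=\tfrac34h^2$ and $g_3=\tfrac14C_0^2-\tfrac18h^3$, and which has a purely imaginary period; let $\omega_1$ be the purely imaginary period with the smallest positive imaginary part. For every $t_0\in\mathbb{R}\cup(\mathbb{R}+\tfrac12\omega_1)$ the formulas $$x(t)=\tfrac12C_0\left(\wp(t+t_0)-\tfrac h4\right)^{-1},\qquad \xi(t)=\frac{\dot x(t)}{x(t)}=\frac{-\wp'(t+t_0)}{\wp(t+t_0)-\tfrac h4}$$ have nonvanishing denominators, are real, and solve Hamilton's equations with energy $C_0$ at all real $t$ for which $t+t_0$ is not a pole of $\wp$;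 at each pole $\xi\to-\infty$ from the left and $\xi\to+\infty$ from the right. Conversely, every trajectory of energy $C_0$ is given on its whole interval by these formulas (and that interval contains no pole) for some such $t_0$, and through every point of $\{p_0=C_0\}$ there passes one of these trajectories at time $0$. (2) Let $C_0\ne0$. Call a trajectory defined on all of $\mathbb{R}$ a loop if it is periodic, bounded and not constant. Loops of energy $C_0$ exist if and only if $C_0^2<h^3$. If $C_0^2<h^3$, the loops of energy $C_0$ are exactly the trajectories in (1) with $t_0\in\mathbb{R}+\tfrac12\omega_1$. In this case $4s^3-g_2s-g_3$ has three real roots $e_1<e_3<e_2$, the period lattice is $\mathbb{Z}\omega_1+\mathbb{Z}\omega_2$, and $$\tfrac12\omega_1=i\int_{-\infty}^{e_1}\frac{ds}{\sqrt{g_3+g_2s-4s^3}},\qquad \tfrac12\omega_2=\int_{e_2}^\infty\frac{ds}{\sqrt{4s^3-g_2s-g_3}}>0.$$ If $C_0^2>h^3$, every line $\mathbb{R}+t_0$ with $t_0$ as in (1) contains a pole of $\wp$. (3) Let $C_0\ne0$ and $C_0^2=h^3$. The loop reduces to the stationary point $(-C_0/h,0)$, whose energy is $C_0$. The function with the invariants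 $g_2,g_3$ above is now the degenerate Weierstrass function $\wp(z)=-\tfrac h4+\tfrac{3h}4\sin^{-2}\!\left(\tfrac{\sqrt{3h}}2z\right)$, which satisfies $\wp'^2=4\wp^3-g_2\wp-g_3$ and $z^2\wp(z)\to1$ as $z\to0$. The formulas in (1) with this $\wp$ and $t_0\in\mathbb{R}$ give trajectories of energy $C_0$ which blow up at the poles as in (1), and every trajectory of energy $C_0$ is one of these or rests at $(-C_0/h,0)$. (4) Let $C_0=0$ and $h>0$. Every trajectory of energy $0$ is of one of the following forms, with $t_0\in\mathbb{R}$, and all of these are trajectories of energy $0$: - $x=0$, $\xi(t)=\sqrt{3h}\coth\left(\tfrac{\sqrt{3h}}2(t+t_0)\right)$, for $t\neq-t_0$; - $x=0$, $\xi(t)=\sqrt{3h}\tanh\left(\tfrac{\sqrt{3h}}2(t+t_0)\right)$; - $x(t)=\pm\sqrt{3h}\,\operatorname{sech}\left(\sqrt{3h}(t+t_0)\right)$, $\xi(t)=-\sqrt{3h}\tanh\left(\sqrt{3h}(t+t_0)\right)$; - the stationary points $(0,\pm\sqrt{3h})$. -/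

import Mathlib

open Filter Topology

noncomputable section

/-- `(x, ξ)` solves Hamilton's equations `ẋ = ∂p/∂ξ`, `ξ̇ = -∂p/∂x` at every time of `I`. -/
def IsHamiltonTrajectory (p : ℝ → ℝ → ℝ) (I : Set ℝ) (x ξ : ℝ → ℝ) : Prop :=
  ∀ t ∈ I,
    HasDerivAt x (deriv (fun η => p (x t) η) (ξ t)) t ∧
    HasDerivAt ξ (-deriv (fun y => p y (ξ t)) (x t)) t

/-- `(a, b)` is a zero of the Hamilton vector field of `p`. -/
def IsStationaryPoint (p : ℝ → ℝ → ℝ) (a b : ℝ) : Prop :=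
  deriv (fun η => p a η) b = 0 ∧ deriv (fun y => p y b) a = 0

/-- The Hamiltonian `p₀(x, ξ; h) = ½ x (x² + ξ²) - (3/2) h x`. -/
def p0 (h x ξ : ℝ) : ℝ := 1 / 2 * x * (x ^ 2 + ξ ^ 2) - 3 / 2 * h * x

/-- A trajectory of `p₀` on `I` along which the energy is `C₀`. -/
def IsEnergyTrajectory (h C₀ : ℝ) (I : Set ℝ) (x ξ : ℝ → ℝ) : Prop :=
  IsHamiltonTrajectory (p0 h) I x ξ ∧ ∀ t ∈ I, p0 h (x t) (ξ t) = C₀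

/-- A nondegenerate bounded flow loop of energy `C₀`: a trajectory defined for all times which is
periodic, not constant, and stays in a bounded part of the phase plane. -/
def IsFlowLoop (h C₀ : ℝ) (x ξ : ℝ → ℝ) : Prop :=
  IsEnergyTrajectory h C₀ Set.univ x ξ ∧
  (∃ T : ℝ, 0 < T ∧ ∀ t, x (t + T) = x t ∧ ξ (t + T) = ξ t) ∧
  (∃ t t' : ℝ, (x t, ξ t) ≠ (x t', ξ t')) ∧
  Bornology.IsBounded (Set.range fun t => (x t, ξ t))

/-- The invariant `g₂ = ¾ h²`. -/
def flowG2 (h : ℝ) : ℝ := 3 / 4 * h ^ 2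

/-- The invariant `g₃ = ¼ C₀² - ⅛ h³`. -/
def flowG3 (h C₀ : ℝ) : ℝ := 1 / 4 * C₀ ^ 2 - 1 / 8 * h ^ 3

/-- `ω` is the purely imaginary period of the lattice of `L`: the one that generates, and points
upwards. -/
def IsImaginaryPeriod (L : PeriodPair) (ω : ℂ) : Prop :=
  ω ∈ L.lattice ∧ ω.re = 0 ∧ 0 < ω.im ∧
    ∀ ω' ∈ L.lattice, ω'.re = 0 → 0 < ω'.im → ω.im ≤ ω'.im

/-- `L` has the invariants `g₂`, `g₃` belonging to `h` and `C₀`, and `ω₁` is its purely imaginary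
period. -/
def IsFlowLattice (h C₀ : ℝ) (L : PeriodPair) (ω₁ : ℂ) : Prop :=
  L.g₂ = (flowG2 h : ℂ) ∧ L.g₃ = (flowG3 h C₀ : ℂ) ∧ IsImaginaryPeriod L ω₁

/-- `t₀` is a real constant, or a real constant plus `ω₁ / 2`. -/
def IsAdmissibleShift (ω₁ t₀ : ℂ) : Prop :=
  (∃ s : ℝ, t₀ = s) ∨ (∃ s : ℝ, t₀ = s + ω₁ / 2)

/-- On `I` the line `t + t₀` avoids the set `S` of poles of `P`, the denominators do not vanish,
`x(t) = ½ C₀ (P(t + t₀) - h/4)⁻¹` and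
`ξ(t) = ẋ(t) / x(t) = -P'(t + t₀) / (P(t + t₀) - h/4)`. -/
def FollowsFormula (P : ℂ → ℂ) (S : Set ℂ) (h C₀ : ℝ) (t₀ : ℂ) (I : Set ℝ) (x ξ : ℝ → ℝ) : Prop :=
  ∀ t ∈ I,
    (t : ℂ) + t₀ ∉ S ∧ P (t + t₀) - h / 4 ≠ 0 ∧
    (x t : ℂ) = 1 / 2 * C₀ * (P (t + t₀) - h / 4)⁻¹ ∧
    (ξ t : ℂ) = -deriv P (t + t₀) / (P (t + t₀) - h / 4) ∧
    x t ≠ 0 ∧ ξ t = deriv x t / x t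

/-- The times at which `t + t₀` is not in the pole set `S`. -/
def regularTimes (S : Set ℂ) (t₀ : ℂ) : Set ℝ := {t | (t : ℂ) + t₀ ∉ S}

/-- `ξ` tends to `+∞` to the right, and to `-∞` to the left, of each time where `t + t₀` is in `S`. -/
def BlowsUpAtPoles (S : Set ℂ) (t₀ : ℂ) (ξ : ℝ → ℝ) : Prop :=
  ∀ a : ℝ, (a : ℂ) + t₀ ∈ S → Tendsto ξ (𝓝[>] a) atTop ∧ Tendsto ξ (𝓝[<] a) atBot

/-- The `℘`-function with invariants `g₂ = ¾ h²`, `g₃ = ⅛ h³` (the case `C₀² = h³`), where the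
discriminant vanishes and the imaginary period is infinite. -/
def degenerateP (h : ℝ) (z : ℂ) : ℂ :=
  -(h : ℂ) / 4 + (3 * h / 4) / Complex.sin ((Real.sqrt (3 * h) / 2 : ℝ) * z) ^ 2

/-- The poles of `degenerateP h`, for `h > 0`. -/
def degeneratePoles (h : ℝ) : Set ℂ :=
  {z | Complex.sin ((Real.sqrt (3 * h) / 2 : ℝ) * z) = 0}

/-- `x = 0` and `ξ(t) = √(3h) coth(½ √(3h) (t + t₀))`. -/
def IsCothOrbit (h t₀ : ℝ) (I : Set ℝ) (x ξ : ℝ → ℝ) : Prop :=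
  ∀ t ∈ I, t + t₀ ≠ 0 ∧ x t = 0 ∧
    ξ t = √(3 * h) *
      (Real.cosh (√(3 * h) / 2 * (t + t₀)) / Real.sinh (√(3 * h) / 2 * (t + t₀)))

/-- `x = 0` and `ξ(t) = √(3h) tanh(½ √(3h) (t + t₀))`. -/
def IsTanhOrbit (h t₀ : ℝ) (I : Set ℝ) (x ξ : ℝ → ℝ) : Prop :=
  ∀ t ∈ I, x t = 0 ∧ ξ t = √(3 * h) * Real.tanh (√(3 * h) / 2 * (t + t₀))

/-- `x(t) = ε √(3h) sech(√(3h) (t + t₀))` and `ξ(t) = -√(3h) tanh(√(3h) (t + t₀))`. -/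
def IsSechOrbit (h ε t₀ : ℝ) (I : Set ℝ) (x ξ : ℝ → ℝ) : Prop :=
  ∀ t ∈ I, x t = ε * √(3 * h) * (1 / Real.cosh (√(3 * h) * (t + t₀))) ∧
    ξ t = -√(3 * h) * Real.tanh (√(3 * h) * (t + t₀))

/-- The trajectory rests at `(a, b)`. -/
def IsConstOrbit (a b : ℝ) (I : Set ℝ) (x ξ : ℝ → ℝ) : Prop :=
  ∀ t ∈ I, x t = a ∧ ξ t = b

end

/-! For C₀ ≠ 0 the position never vanishes, and P = C₀/(2x) + h/4, Q = -ξ(P - h/4) carries the level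
set {p₀ = C₀} to real points of the cubic Q² = 4P³ - g₂P - g₃ and Hamilton's equations to Ṗ = Q. So
the flow is translation on the curve, and (P, Q) = (℘, ℘')(t + t₀). The cubic equals -C₀²/4 < 0 at P
= h/4, so the denominators do not vanish on the real curve; the only singularities are the poles of
℘, where ξ has a simple pole of residue 2. `IsRealWeierstrassLine.isEnergyTrajectory` is this
computation. Conversely, `IsFlowLattice.exists_shift` finds a shift for each real point of the
curve, and `IsHamiltonTrajectory.eqOn_of_blowup` extends agreement at one time to the whole
interval: local uniqueness propagates, and a trajectory cannot run through a time where the explicit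
solution is infinite.

The discriminant g₂³ - 27g₃² is (27/16) C₀² (h³ - C₀²). Below the critical energy the cubic has
three real roots, the lattice is rectangular, and the line through ω₁/2 misses the lattice and
parametrizes the compact oval: these are the loops. Above it there is one real root, so ω₁/2 agrees
with the real half period modulo the lattice and every admissible line meets a pole. At C₀² = h³ the
curve acquires a node, which is the stationary point, and the other points are parametrized by
1/sin². For C₀ = 0 the level set splits into the axis x = 0 and the circle x² + ξ² = 3h, where the
orbits are hyperbolic functions.

Three facts on ℘ carry this. The equation ℘'' = 6℘² - g₂/2 has unique analytic solutions, so (℘, ℘')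
is injective modulo the lattice and the invariants determine the lattice; hence real invariants give
a lattice stable under conjugation. Every real pair with g₂ ≥ 0 and nonzero discriminant does occur
(`PeriodPair.exists_of_invariants`), by the intermediate value theorem along rectangular or rhombic
lattices followed by rescaling. Finally, ℘ is monotone along each axis up to the half period,
because a critical point is itself a half period (`PeriodPair.ConjStable.exists_profile`); this
gives surjectivity onto the real curve and the period integrals. -/

/-- A solution of a second order linear equation with analytic coefficient and vanishing initial
data vanishes. -/
lemma AnalyticAt.eventuallyEq_zero_of_deriv_deriv_eq_mul {D k : ℂ → ℂ} {z₀ : ℂ}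
    (hD : AnalyticAt ℂ D z₀) (hk : AnalyticAt ℂ k z₀) (h0 : D z₀ = 0) (h1 : deriv D z₀ = 0)
    (h2 : deriv (deriv D) =ᶠ[𝓝 z₀] fun z => D z * k z) : D =ᶠ[𝓝 z₀] 0 := by
  -- Since D and D' vanish at z₀, two differentiations lower the order of D by exactly 2, while D''
  -- = D k has order at least that of D. Only infinite order allows both.
  have e1 := hD.analyticOrderAt_deriv_add_one
  have e2 := hD.deriv.analyticOrderAt_deriv_add_one
  simp only [h0, h1, sub_zero] at e1 e2
  have e3 : analyticOrderAt (deriv (deriv D)) z₀ = analyticOrderAt D z₀ + analyticOrderAt k z₀ := by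
    rw [analyticOrderAt_congr h2]
    exact analyticOrderAt_mul hD hk
  rw [e3] at e2
  have e4 : analyticOrderAt D z₀ = ⊤ := by
    by_contra hne
    obtain ⟨n, hn⟩ := ENat.ne_top_iff_exists.mp hne
    change analyticOrderAt (deriv D) z₀ + 1 = analyticOrderAt D z₀ at e1
    change _ = analyticOrderAt (deriv D) z₀ at e2
    rw [← e2, ← hn] at e1
    cases hkk : analyticOrderAt k z₀ with
    | top => simp [hkk] at e1
    | coe m =>
      rw [hkk] at e1
      norm_cast at e1
      omega
  exact analyticOrderAt_eq_top.mp e4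

/-! ### The Weierstrass function: poles, differential equation, determination by the invariants -/

namespace PeriodPair

variable (L : PeriodPair)

lemma countable_lattice : (L.lattice : Set ℂ).Countable :=
  Set.countable_coe_iff.mp L.latticeEquivProd.injective.countable

/-- A countable set does not disconnect the plane. This lets the identity theorem act on the whole
domain of ℘. -/
lemma isPreconnected_compl_lattice : IsPreconnected (L.lattice : Set ℂ)ᶜ :=
  (L.countable_lattice.isPathConnected_compl_of_one_lt_rank
    (by simp [Complex.rank_real_complex])).isConnected.isPreconnected

variable {L} in
lemma eventually_notMem_lattice (x : ℂ) : ∀ᶠ z in 𝓝[≠] x, z ∉ L.lattice := by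
  filter_upwards [mem_nhdsWithin_of_mem_nhds (L.compl_lattice_sdiff_singleton_mem_nhds x),
    self_mem_nhdsWithin] with z hz hne
  intro h
  exact hz ⟨h, hne⟩

variable {L} in
lemma hasDerivAt_weierstrassP {z : ℂ} (hz : z ∉ L.lattice) :
    HasDerivAt L.weierstrassP (L.derivWeierstrassP z) z := by
  rw [← L.deriv_weierstrassP]
  exact (L.analyticOnNhd_weierstrassP z hz).differentiableAt.hasDerivAt

lemma tendsto_weierstrassP_mul_sq :
    Tendsto (fun z => L.weierstrassP z * z ^ 2) (𝓝[≠] 0) (𝓝 1) := by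
  have h : Tendsto (fun z : ℂ => L.weierstrassPExcept 0 z * z ^ 2 + 1) (𝓝[≠] 0) (𝓝 1) := by
    have hc : ContinuousAt (fun z : ℂ => L.weierstrassPExcept 0 z * z ^ 2 + 1) 0 :=
      ((L.analyticAt_weierstrassPExcept 0).continuousAt.mul (by fun_prop)).add (by fun_prop)
    simpa using hc.tendsto.mono_left nhdsWithin_le_nhds
  refine h.congr' ?_
  filter_upwards [self_mem_nhdsWithin] with z hz
  have hz0 : z ≠ 0 := hz
  have := L.weierstrassPExcept_def 0 z
  simp only [ZeroMemClass.coe_zero, sub_zero] at this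
  rw [this]
  field_simp
  simp

lemma tendsto_derivWeierstrassP_mul_cube :
    Tendsto (fun z => L.derivWeierstrassP z * z ^ 3) (𝓝[≠] 0) (𝓝 (-2)) := by
  have h : Tendsto (fun z : ℂ => L.derivWeierstrassPExcept 0 z * z ^ 3 - 2) (𝓝[≠] 0)
      (𝓝 (-2)) := by
    have hc : ContinuousAt (fun z : ℂ => L.derivWeierstrassPExcept 0 z * z ^ 3 - 2) 0 :=
      ((L.analyticAt_derivWeierstrassPExcept 0).continuousAt.mul (by fun_prop)).sub (by fun_prop)
    simpa using hc.tendsto.mono_left nhdsWithin_le_nhds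
  refine h.congr' ?_
  filter_upwards [self_mem_nhdsWithin] with z hz
  have hz0 : z ≠ 0 := hz
  have := L.derivWeierstrassPExcept_def 0 z
  simp only [ZeroMemClass.coe_zero, sub_zero] at this
  rw [this]
  field_simp
  ring

variable {L} in
lemma weierstrassP_sub_mem {l : ℂ} (hl : l ∈ L.lattice) (z : ℂ) :
    L.weierstrassP (z - l) = L.weierstrassP z := L.weierstrassP_sub_coe z ⟨l, hl⟩

variable {L} in
lemma derivWeierstrassP_sub_mem {l : ℂ} (hl : l ∈ L.lattice) (z : ℂ) :
    L.derivWeierstrassP (z - l) = L.derivWeierstrassP z := L.derivWeierstrassP_sub_coe z ⟨l, hl⟩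

lemma tendsto_sub_punctured (l : ℂ) : Tendsto (fun z : ℂ => z - l) (𝓝[≠] l) (𝓝[≠] 0) := by
  refine tendsto_nhdsWithin_iff.mpr ⟨?_, ?_⟩
  · have : Tendsto (fun z : ℂ => z - l) (𝓝 l) (𝓝 (l - l)) := by
      exact Continuous.tendsto (by fun_prop) _
    rw [sub_self] at this
    exact this.mono_left nhdsWithin_le_nhds
  · filter_upwards [self_mem_nhdsWithin] with z hz
    simpa [sub_eq_zero] using hz

variable {L} in
lemma tendsto_norm_weierstrassP_atTop {l : ℂ} (hl : l ∈ L.lattice) :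
    Tendsto (fun z => ‖L.weierstrassP z‖) (𝓝[≠] l) atTop := by
  have h0 : Tendsto (fun z => ‖L.weierstrassP z‖) (𝓝[≠] 0) atTop := by
    have h1 : Tendsto (fun z : ℂ => ‖z ^ 2‖) (𝓝[≠] 0) (𝓝[>] 0) := by
      refine tendsto_nhdsWithin_iff.mpr ⟨?_, ?_⟩
      · have : Tendsto (fun z : ℂ => ‖z ^ 2‖) (𝓝 0) (𝓝 ‖(0 : ℂ) ^ 2‖) :=
          Continuous.tendsto (by fun_prop) _
        simp only [ne_eq, OfNat.ofNat_ne_zero, not_false_eq_true, zero_pow, norm_zero] at this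
        exact this.mono_left nhdsWithin_le_nhds
      · filter_upwards [self_mem_nhdsWithin] with z hz
        have : z ≠ 0 := hz
        exact norm_pos_iff.mpr (pow_ne_zero 2 this)
    have h2 := (tendsto_inv_nhdsGT_zero.comp h1).atTop_mul_pos
      (by norm_num : (0 : ℝ) < ‖(1 : ℂ)‖) L.tendsto_weierstrassP_mul_sq.norm
    refine h2.congr' ?_
    filter_upwards [self_mem_nhdsWithin] with z hz
    have : ‖z‖ ≠ 0 := by simpa using hz
    simp only [Function.comp, norm_mul, norm_pow]
    field_simp
  have := h0.comp (tendsto_sub_punctured l)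
  refine this.congr fun z => ?_
  simp [weierstrassP_sub_mem hl]

/-- The second order equation satisfied by `℘`. -/
lemma deriv_derivWeierstrassP {z : ℂ} (hz : z ∉ L.lattice) :
    deriv L.derivWeierstrassP z = 6 * L.weierstrassP z ^ 2 - L.g₂ / 2 := by
  have hP := L.analyticOnNhd_weierstrassP
  have hP' := L.analyticOnNhd_derivWeierstrassP
  -- Differentiating the cubic equation gives the claim multiplied by ℘'. The identity theorem
  -- removes this factor, as ℘' is not identically zero: z³℘'(z) tends to -2.
  have hmul : ∀ z ∈ (L.lattice : Set ℂ)ᶜ, L.derivWeierstrassP z *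
      (2 * deriv L.derivWeierstrassP z - (12 * L.weierstrassP z ^ 2 - L.g₂)) = 0 := by
    intro w hw
    have hev : (fun z => L.derivWeierstrassP z ^ 2) =ᶠ[𝓝 w]
        fun z => 4 * L.weierstrassP z ^ 3 - L.g₂ * L.weierstrassP z - L.g₃ := by
      filter_upwards [L.isClosed_lattice.isOpen_compl.mem_nhds hw] with z hz
      exact L.derivWeierstrassP_sq z hz
    have d1 := ((hP' w hw).differentiableAt.hasDerivAt.pow 2)
    have d2 := (((hasDerivAt_weierstrassP hw).pow 3).const_mul 4).sub
      ((hasDerivAt_weierstrassP hw).const_mul L.g₂) |>.sub_const L.g₃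
    have := (d1.congr_of_eventuallyEq hev.symm).unique d2
    simp only [Nat.cast_ofNat, Nat.add_one_sub_one, pow_one] at this
    linear_combination this
  have hana : AnalyticOnNhd ℂ (fun z => 2 * deriv L.derivWeierstrassP z -
      (12 * L.weierstrassP z ^ 2 - L.g₂)) (L.lattice : Set ℂ)ᶜ := by
    intro w hw
    have := hP w hw
    have := (hP' w hw).deriv
    fun_prop
  rcases hP'.eq_zero_or_eq_zero_of_mul_eq_zero hana hmul L.isPreconnected_compl_lattice with h | h
  · exfalso
    have : Tendsto (fun z => L.derivWeierstrassP z * z ^ 3) (𝓝[≠] 0) (𝓝 0) := by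
      refine tendsto_const_nhds.congr' ?_
      filter_upwards [eventually_notMem_lattice (L := L) 0] with z hz
      simp [h z hz]
    have := tendsto_nhds_unique this L.tendsto_derivWeierstrassP_mul_cube
    norm_num at this
  · linear_combination (h z hz) / 2

variable {L} in
lemma hasDerivAt_derivWeierstrassP {z : ℂ} (hz : z ∉ L.lattice) :
    HasDerivAt L.derivWeierstrassP (6 * L.weierstrassP z ^ 2 - L.g₂ / 2) z := by
  rw [← L.deriv_derivWeierstrassP hz]
  exact (L.analyticOnNhd_derivWeierstrassP z hz).differentiableAt.hasDerivAt

/-- `℘` takes every value. -/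
lemma exists_weierstrassP_eq (v : ℂ) : ∃ z ∉ L.lattice, L.weierstrassP z = v := by
  classical
  by_contra! hv
  -- If v were omitted, 1/(℘ - v), extended by zero over the poles, would be entire and periodic,
  -- hence bounded and constant. It vanishes on the lattice and not at a half period.
  let g : ℂ → ℂ := fun z => if z ∈ L.lattice then 0 else (L.weierstrassP z - v)⁻¹
  have hgd : ∀ z ∉ L.lattice, DifferentiableAt ℂ g z := by
    intro z hz
    have h1 : DifferentiableAt ℂ (fun z => (L.weierstrassP z - v)⁻¹) z :=
      ((hasDerivAt_weierstrassP hz).differentiableAt.sub_const v).inv (sub_ne_zero.mpr (hv z hz))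
    refine h1.congr_of_eventuallyEq ?_
    filter_upwards [L.isClosed_lattice.isOpen_compl.mem_nhds hz] with w hw
    exact if_neg hw
  have hg : Differentiable ℂ g := by
    intro z
    by_cases hz : z ∈ L.lattice
    · refine (Complex.analyticAt_of_differentiable_on_punctured_nhds_of_continuousAt ?_
        ?_).differentiableAt
      · filter_upwards [eventually_notMem_lattice (L := L) z] with w hw using hgd w hw
      · rw [continuousAt_iff_punctured_nhds]
        have h1 : Tendsto (fun w => (L.weierstrassP w - v)⁻¹) (𝓝[≠] z) (𝓝 0) := by
          rw [tendsto_zero_iff_norm_tendsto_zero]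
          simp only [norm_inv]
          refine tendsto_inv_atTop_zero.comp ?_
          refine tendsto_atTop_mono (fun w => norm_sub_norm_le (L.weierstrassP w) v) ?_
          exact tendsto_atTop_add_const_right _ _ (tendsto_norm_weierstrassP_atTop hz)
        have h2 : g z = 0 := if_pos hz
        rw [h2]
        refine h1.congr' ?_
        filter_upwards [eventually_notMem_lattice (L := L) z] with w hw
        exact (if_neg hw).symm
    · exact hgd z hz
  have hb := (IsZLattice.isCompact_range_of_periodic L.lattice g hg.continuous (by
    intro z w hw
    have h1 : z + w ∈ L.lattice ↔ z ∈ L.lattice := L.lattice.add_mem_iff_left hw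
    have h2 : L.weierstrassP (z + w) = L.weierstrassP z := L.weierstrassP_add_coe z ⟨w, hw⟩
    simp only [g, h1, h2])).isBounded
  have h0 := hg.apply_eq_apply_of_bounded hb (L.ω₁ / 2) 0
  have h3 : g 0 = 0 := if_pos (zero_mem _)
  have h4 : g (L.ω₁ / 2) = (L.weierstrassP (L.ω₁ / 2) - v)⁻¹ :=
    if_neg L.ω₁_div_two_notMem_lattice
  rw [h3, h4, inv_eq_zero] at h0
  exact hv _ L.ω₁_div_two_notMem_lattice (sub_eq_zero.mp h0)

variable {L}

/-- Two `℘`-functions with the same invariants and the same values of `℘` and `℘'` at two points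
agree up to translation. -/
lemma eqOn_translates {L' : PeriodPair} (h2 : L.g₂ = L'.g₂) {a b : ℂ}
    (ha : a ∉ L.lattice) (hb : b ∉ L'.lattice) (hP : L.weierstrassP a = L'.weierstrassP b)
    (hP' : L.derivWeierstrassP a = L'.derivWeierstrassP b) {z : ℂ} (hza : z + a ∉ L.lattice)
    (hzb : z + b ∉ L'.lattice) : L.weierstrassP (z + a) = L'.weierstrassP (z + b) := by
  set U : Set ℂ := {z | z + a ∈ L.lattice}ᶜ ∩ {z | z + b ∈ L'.lattice}ᶜ with hU
  have hUc : IsPreconnected U := by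
    rw [hU, ← Set.compl_union]
    refine (Set.Countable.isPathConnected_compl_of_one_lt_rank
      (by simp [Complex.rank_real_complex]) (Set.Countable.union ?_ ?_)).isConnected.isPreconnected
    · exact L.countable_lattice.preimage (add_left_injective a)
    · exact L'.countable_lattice.preimage (add_left_injective b)
  have hA : AnalyticOnNhd ℂ (fun z => L.weierstrassP (z + a)) U := fun w hw =>
    (L.analyticOnNhd_weierstrassP (w + a) hw.1).comp_of_eq (by fun_prop) rfl
  have hB : AnalyticOnNhd ℂ (fun z => L'.weierstrassP (z + b)) U := fun w hw =>
    (L'.analyticOnNhd_weierstrassP (w + b) hw.2).comp_of_eq (by fun_prop) rfl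
  have hUo : IsOpen U :=
    (L.isClosed_lattice.isOpen_compl.preimage (continuous_add_const a)).inter
      (L'.isClosed_lattice.isOpen_compl.preimage (continuous_add_const b))
  have h0U : (0 : ℂ) ∈ U := ⟨by simpa using ha, by simpa using hb⟩
  have hd1 : ∀ w ∈ U, HasDerivAt (fun z => L.weierstrassP (z + a) - L'.weierstrassP (z + b))
      (L.derivWeierstrassP (w + a) - L'.derivWeierstrassP (w + b)) w := fun w hw =>
    ((hasDerivAt_weierstrassP hw.1).comp_add_const w a).sub
      ((hasDerivAt_weierstrassP hw.2).comp_add_const w b)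
  have hd2 : ∀ w ∈ U, HasDerivAt
      (fun z => L.derivWeierstrassP (z + a) - L'.derivWeierstrassP (z + b))
      ((6 * L.weierstrassP (w + a) ^ 2 - L.g₂ / 2) -
        (6 * L'.weierstrassP (w + b) ^ 2 - L'.g₂ / 2)) w := fun w hw =>
    ((hasDerivAt_derivWeierstrassP hw.1).comp_add_const w a).sub
      ((hasDerivAt_derivWeierstrassP hw.2).comp_add_const w b)
  -- The difference D of the two functions satisfies D'' = 6(℘ + ℘̃)D with zero initial data. Only
  -- g₂ enters the second order equation; the initial data take the place of g₃.
  have hloc : (fun z => L.weierstrassP (z + a) - L'.weierstrassP (z + b)) =ᶠ[𝓝 0] 0 := by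
    refine AnalyticAt.eventuallyEq_zero_of_deriv_deriv_eq_mul
      (k := fun z => 6 * (L.weierstrassP (z + a) + L'.weierstrassP (z + b)))
      ((hA 0 h0U).sub (hB 0 h0U)) (analyticAt_const.mul ((hA 0 h0U).add (hB 0 h0U))) (by simp [hP]) ?_ ?_
    · rw [(hd1 0 h0U).deriv]; simp [hP']
    · filter_upwards [hUo.mem_nhds h0U] with w hw
      have : deriv (fun z => L.weierstrassP (z + a) - L'.weierstrassP (z + b)) =ᶠ[𝓝 w]
          fun z => L.derivWeierstrassP (z + a) - L'.derivWeierstrassP (z + b) := by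
        filter_upwards [hUo.mem_nhds hw] with y hy using (hd1 y hy).deriv
      rw [this.deriv_eq, (hd2 w hw).deriv, h2]
      ring
  exact hA.eqOn_of_preconnected_of_eventuallyEq hB hUc h0U
    (by filter_upwards [hloc] with w hw using sub_eq_zero.mp hw) ⟨hza, hzb⟩

/-- Near a pole of one function the other agrees with it on a punctured neighbourhood, so it cannot
have a finite limit there. -/
lemma mem_of_translates {L' : PeriodPair} (h2 : L.g₂ = L'.g₂) {a b : ℂ}
    (ha : a ∉ L.lattice) (hb : b ∉ L'.lattice) (hP : L.weierstrassP a = L'.weierstrassP b)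
    (hP' : L.derivWeierstrassP a = L'.derivWeierstrassP b) {z : ℂ} (hz : z + a ∈ L.lattice) :
    z + b ∈ L'.lattice := by
  by_contra hzb
  have hta : Tendsto (fun w => w + a) (𝓝[≠] z) (𝓝[≠] (z + a)) :=
    (continuous_add_const a).continuousAt.continuousWithinAt.tendsto_nhdsWithin
      fun w hw => by simpa using hw
  have htb : Tendsto (fun w => w + b) (𝓝[≠] z) (𝓝[≠] (z + b)) :=
    (continuous_add_const b).continuousAt.continuousWithinAt.tendsto_nhdsWithin
      fun w hw => by simpa using hw
  have h1 := (tendsto_norm_weierstrassP_atTop hz).comp hta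
  have h2' : Tendsto (fun w => ‖L'.weierstrassP (w + b)‖) (𝓝[≠] z)
      (𝓝 ‖L'.weierstrassP (z + b)‖) := by
    have hc := (hasDerivAt_weierstrassP hzb).continuousAt.tendsto.norm
    exact hc.comp (htb.mono_right nhdsWithin_le_nhds)
  refine not_tendsto_nhds_of_tendsto_atTop h1 _ (h2'.congr' ?_)
  filter_upwards [hta (eventually_notMem_lattice (L := L) (z + a)),
    htb (eventually_notMem_lattice (L := L') (z + b))] with w hw1 hw2
  simp only [Function.comp]
  rw [eqOn_translates h2 ha hb hP hP' hw1 hw2]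

lemma add_mem_lattice_iff_of_translates {L' : PeriodPair} (h2 : L.g₂ = L'.g₂) {a b : ℂ}
    (ha : a ∉ L.lattice) (hb : b ∉ L'.lattice) (hP : L.weierstrassP a = L'.weierstrassP b)
    (hP' : L.derivWeierstrassP a = L'.derivWeierstrassP b) (z : ℂ) :
    z + a ∈ L.lattice ↔ z + b ∈ L'.lattice :=
  ⟨mem_of_translates h2 ha hb hP hP', mem_of_translates h2.symm hb ha hP.symm hP'.symm⟩

/-- The pair `(℘, ℘')` is injective modulo the lattice. -/
lemma sub_mem_lattice_of_eq {a b : ℂ} (ha : a ∉ L.lattice) (hb : b ∉ L.lattice)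
    (hP : L.weierstrassP a = L.weierstrassP b)
    (hP' : L.derivWeierstrassP a = L.derivWeierstrassP b) : a - b ∈ L.lattice := by
  have := (add_mem_lattice_iff_of_translates rfl ha hb hP hP' (-b)).mpr (by simp)
  rwa [neg_add_eq_sub] at this

/-- Since ℘ is even and ℘' odd, the points a and -a have the same values of (℘, ℘') when ℘'(a) = 0.
-/
lemma two_mul_mem_lattice_of_derivWeierstrassP_eq_zero {a : ℂ} (ha : a ∉ L.lattice)
    (h : L.derivWeierstrassP a = 0) : 2 * a ∈ L.lattice := by
  have := sub_mem_lattice_of_eq ha (b := -a) (by simpa using ha) (by simp) (by simp [h])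
  rwa [sub_neg_eq_add, ← two_mul] at this

lemma derivWeierstrassP_eq_zero_of_two_mul_mem {a : ℂ} (h : 2 * a ∈ L.lattice) :
    L.derivWeierstrassP a = 0 := by
  have h1 := derivWeierstrassP_sub_mem h a
  rw [show a - 2 * a = -a by ring, L.derivWeierstrassP_neg] at h1
  exact CharZero.neg_eq_self_iff.mp h1

lemma sub_mem_lattice_of_half_periods {a b : ℂ} (ha : a ∉ L.lattice) (hb : b ∉ L.lattice)
    (ha2 : 2 * a ∈ L.lattice) (hb2 : 2 * b ∈ L.lattice)
    (hP : L.weierstrassP a = L.weierstrassP b) : a - b ∈ L.lattice :=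
  sub_mem_lattice_of_eq ha hb hP (by
    rw [derivWeierstrassP_eq_zero_of_two_mul_mem ha2,
      derivWeierstrassP_eq_zero_of_two_mul_mem hb2])

/-- The invariants determine the lattice. -/
lemma lattice_eq_of_invariants_eq {L' : PeriodPair} (h2 : L.g₂ = L'.g₂) (h3 : L.g₃ = L'.g₃) :
    L.lattice = L'.lattice := by
  have hb := L'.ω₁_div_two_notMem_lattice
  -- The base point for `L'` is a half period: ℘' is zero there, so the common cubic forces ℘'(a) =
  -- 0 as well and no choice of sign arises.
  obtain ⟨a, ha, hP⟩ := L.exists_weierstrassP_eq (L'.weierstrassP (L'.ω₁ / 2))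
  have hb0 : L'.derivWeierstrassP (L'.ω₁ / 2) = 0 :=
    derivWeierstrassP_eq_zero_of_two_mul_mem (by
      rw [mul_div_cancel₀ _ two_ne_zero]; exact L'.ω₁_mem_lattice)
  have hP' : L.derivWeierstrassP a = L'.derivWeierstrassP (L'.ω₁ / 2) := by
    rw [hb0, ← sq_eq_zero_iff, L.derivWeierstrassP_sq a ha, hP, h2, h3,
      ← L'.derivWeierstrassP_sq _ hb, hb0]
    simp
  have key := add_mem_lattice_iff_of_translates h2 ha hb hP hP'
  -- The value z = -a, for which z + a = 0 is a lattice point, shows that the two base points differ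
  -- by an element of `L'`.
  have h0 : L'.ω₁ / 2 - a ∈ L'.lattice := by
    have := (key (-a)).mp (by simp)
    rwa [neg_add_eq_sub] at this
  ext z
  rw [← sub_add_cancel z a, key, sub_add_cancel, ← L'.lattice.add_mem_iff_left h0 (x := z),
    show z - a + L'.ω₁ / 2 = z + (L'.ω₁ / 2 - a) by ring]

end PeriodPair

/-! ### Scaling, conjugation and Eisenstein sums of lattices -/

namespace PeriodPair

variable (L : PeriodPair)

/-- The periods multiplied by a nonzero number. -/
def scale (c : ℂ) (hc : c ≠ 0) : PeriodPair where
  ω₁ := c * L.ω₁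
  ω₂ := c * L.ω₂
  indep := by
    rw [LinearIndependent.pair_iff]
    intro s t h
    refine LinearIndependent.pair_iff.mp L.indep s t (mul_left_cancel₀ hc ?_)
    rw [mul_zero, ← h]
    simp only [Complex.real_smul]
    ring

/-- The complex conjugate periods. -/
def conjugate : PeriodPair where
  ω₁ := (starRingEnd ℂ) L.ω₁
  ω₂ := (starRingEnd ℂ) L.ω₂
  indep := by
    rw [LinearIndependent.pair_iff]
    intro s t h
    refine LinearIndependent.pair_iff.mp L.indep s t ?_
    have := congrArg (starRingEnd ℂ) h
    simpa using this

lemma mem_lattice_scale {c : ℂ} (hc : c ≠ 0) {z : ℂ} :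
    c * z ∈ (L.scale c hc).lattice ↔ z ∈ L.lattice := by
  simp only [mem_lattice, scale]
  constructor
  · rintro ⟨m, n, h⟩
    exact ⟨m, n, mul_left_cancel₀ hc (by rw [← h]; ring)⟩
  · rintro ⟨m, n, rfl⟩
    exact ⟨m, n, by ring⟩

lemma mem_lattice_conjugate {z : ℂ} :
    (starRingEnd ℂ) z ∈ L.conjugate.lattice ↔ z ∈ L.lattice := by
  simp only [mem_lattice, conjugate]
  constructor
  · rintro ⟨m, n, h⟩
    refine ⟨m, n, ?_⟩
    have := congrArg (starRingEnd ℂ) h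
    simpa using this
  · rintro ⟨m, n, rfl⟩
    exact ⟨m, n, by simp⟩

lemma G_scale {c : ℂ} (hc : c ≠ 0) (n : ℕ) : (L.scale c hc).G n = (c ^ n)⁻¹ * L.G n := by
  let e : L.lattice ≃ (L.scale c hc).lattice :=
    { toFun := fun l => ⟨c * l, (L.mem_lattice_scale hc).mpr l.2⟩
      invFun := fun l => ⟨c⁻¹ * l, (L.mem_lattice_scale hc).mp (by
        rw [mul_inv_cancel_left₀ hc]; exact l.2)⟩
      left_inv := fun l => by simp [hc]
      right_inv := fun l => by simp [hc] }
  rw [G, G, ← e.tsum_eq, ← tsum_mul_left]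
  refine tsum_congr fun l => ?_
  simp [e, mul_pow, mul_comm]

lemma G_conjugate (n : ℕ) : L.conjugate.G n = (starRingEnd ℂ) (L.G n) := by
  let e : L.lattice ≃ L.conjugate.lattice :=
    { toFun := fun l => ⟨(starRingEnd ℂ) l, L.mem_lattice_conjugate.mpr l.2⟩
      invFun := fun l => ⟨(starRingEnd ℂ) l, L.mem_lattice_conjugate.mp (by simp)⟩
      left_inv := fun l => by simp
      right_inv := fun l => by simp }
  rw [G, G, ← e.tsum_eq, Complex.conj_tsum]
  refine tsum_congr fun l => ?_
  simp [e]

variable {L}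

lemma G_eq_of_lattice_eq {L' : PeriodPair} (h : L.lattice = L'.lattice) (n : ℕ) :
    L.G n = L'.G n := by
  rw [G, G]
  exact (Equiv.tsum_eq (LinearEquiv.ofEq _ _ h).toEquiv fun l : L'.lattice => ((l : ℂ) ^ n)⁻¹)

/-- The lattice is stable under complex conjugation. -/
def ConjStable (L : PeriodPair) : Prop :=
  ∀ z ∈ L.lattice, (starRingEnd ℂ) z ∈ L.lattice

lemma conjStable_iff_lattice_conjugate : L.ConjStable ↔ L.conjugate.lattice = L.lattice := by
  have key : ∀ z, z ∈ L.conjugate.lattice ↔ (starRingEnd ℂ) z ∈ L.lattice := fun z => by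
    rw [← L.mem_lattice_conjugate, Complex.conj_conj]
  constructor
  · intro h
    ext z
    rw [key]
    exact ⟨fun hz => by simpa using h _ hz, h z⟩
  · intro h z hz
    rwa [← key, h]

lemma ConjStable.conj_G (h : L.ConjStable) (n : ℕ) : (starRingEnd ℂ) (L.G n) = L.G n := by
  rw [← G_conjugate, G_eq_of_lattice_eq (conjStable_iff_lattice_conjugate.mp h)]

/-- The conjugate lattice has the conjugate invariants, so here it has the same ones, and
`lattice_eq_of_invariants_eq` identifies the two lattices. -/
lemma conjStable_of_invariants_real {a b : ℝ} (h2 : L.g₂ = a) (h3 : L.g₃ = b) :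
    L.ConjStable := by
  refine conjStable_iff_lattice_conjugate.mpr (lattice_eq_of_invariants_eq ?_ ?_)
  · have := congrArg (starRingEnd ℂ) h2
    rw [Complex.conj_ofReal, ← h2] at this
    rw [← this, g₂, g₂, G_conjugate, map_mul, map_ofNat]
  · have := congrArg (starRingEnd ℂ) h3
    rw [Complex.conj_ofReal, ← h3] at this
    rw [← this, g₃, g₃, G_conjugate, map_mul, map_ofNat]

/-- Complex conjugation as a permutation of a stable lattice. -/
def ConjStable.equiv (h : L.ConjStable) : L.lattice ≃ L.lattice where
  toFun l := ⟨(starRingEnd ℂ) l, h _ l.2⟩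
  invFun l := ⟨(starRingEnd ℂ) l, h _ l.2⟩
  left_inv l := by simp
  right_inv l := by simp

lemma ConjStable.weierstrassP_conj (h : L.ConjStable) (z : ℂ) :
    L.weierstrassP ((starRingEnd ℂ) z) = (starRingEnd ℂ) (L.weierstrassP z) := by
  rw [weierstrassP, weierstrassP, Complex.conj_tsum, ← h.equiv.tsum_eq]
  refine tsum_congr fun l => ?_
  simp [ConjStable.equiv]

lemma ConjStable.derivWeierstrassP_conj (h : L.ConjStable) (z : ℂ) :
    L.derivWeierstrassP ((starRingEnd ℂ) z) = (starRingEnd ℂ) (L.derivWeierstrassP z) := by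
  rw [derivWeierstrassP, derivWeierstrassP, map_neg, Complex.conj_tsum, ← h.equiv.tsum_eq]
  congr 1
  refine tsum_congr fun l => ?_
  simp [ConjStable.equiv, map_ofNat]

lemma ConjStable.exists_G_eq (h : L.ConjStable) (n : ℕ) : ∃ r : ℝ, L.G n = r :=
  (Complex.conj_eq_iff_real.mp (h.conj_G n))

lemma ω₁_div_two_sub_ω₂_div_two_notMem : L.ω₁ / 2 - L.ω₂ / 2 ∉ L.lattice := by
  simpa [inv_mul_eq_div, sub_eq_add_neg, neg_div] using
    (L.mul_ω₁_add_mul_ω₂_mem_lattice (α := 1 / 2) (β := -1 / 2)).not.mpr (by norm_num)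

lemma weierstrassP_half_periods_ne :
    L.weierstrassP (L.ω₁ / 2) ≠ L.weierstrassP (L.ω₂ / 2) := by
  intro h
  refine ω₁_div_two_sub_ω₂_div_two_notMem (L := L) (sub_mem_lattice_of_half_periods
    L.ω₁_div_two_notMem_lattice L.ω₂_div_two_notMem_lattice ?_ ?_ h)
  · rw [mul_div_cancel₀ _ two_ne_zero]; exact L.ω₁_mem_lattice
  · rw [mul_div_cancel₀ _ two_ne_zero]; exact L.ω₂_mem_lattice

lemma cubic_eq_zero_of_half_period {a : ℂ} (ha : a ∉ L.lattice) (h2 : 2 * a ∈ L.lattice) :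
    4 * L.weierstrassP a ^ 3 - L.g₂ * L.weierstrassP a - L.g₃ = 0 := by
  rw [← L.derivWeierstrassP_sq a ha, derivWeierstrassP_eq_zero_of_two_mul_mem h2]
  simp

/-- The invariants of a lattice do not both vanish. -/
lemma g₂_ne_zero_or_g₃_ne_zero : L.g₂ ≠ 0 ∨ L.g₃ ≠ 0 := by
  by_contra! h
  -- With both invariants zero the cubic is 4s³, and ℘ would take the value 0 at two incongruent
  -- half periods.
  have h1 := cubic_eq_zero_of_half_period L.ω₁_div_two_notMem_lattice
    (by rw [mul_div_cancel₀ _ two_ne_zero]; exact L.ω₁_mem_lattice)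
  have h2 := cubic_eq_zero_of_half_period L.ω₂_div_two_notMem_lattice
    (by rw [mul_div_cancel₀ _ two_ne_zero]; exact L.ω₂_mem_lattice)
  rw [h.1, h.2] at h1 h2
  simp only [zero_mul, sub_zero, mul_eq_zero, OfNat.ofNat_ne_zero, false_or, ne_eq,
    not_false_eq_true, pow_eq_zero_iff] at h1 h2
  exact weierstrassP_half_periods_ne (h1.trans h2.symm)

/-- The lattice `ℤ + ℤ (c + i t)`. -/
def normalized (c t : ℝ) (ht : t ≠ 0) : PeriodPair where
  ω₁ := 1
  ω₂ := c + t * Complex.I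
  indep := by
    rw [LinearIndependent.pair_iff]
    intro r s h
    have h1 := congrArg Complex.re h
    have h2 := congrArg Complex.im h
    simp at h1 h2
    have : s = 0 := by tauto
    subst this
    simpa using h1

/-- The Eisenstein sum of `ℤ + ℤ (c + i t)`. -/
noncomputable def normalizedG (c : ℝ) (k : ℕ) (t : ℝ) : ℂ :=
  ∑' p : ℤ × ℤ, ((p.1 + p.2 * (c + t * Complex.I) : ℂ) ^ k)⁻¹

lemma G_normalized (c t : ℝ) (ht : t ≠ 0) (k : ℕ) :
    (normalized c t ht).G k = normalizedG c k t := by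
  rw [G, normalizedG, ← (normalized c t ht).latticeEquivProd.symm.toEquiv.tsum_eq]
  refine tsum_congr fun p => ?_
  have := (normalized c t ht).latticeEquiv_symm_apply p
  simp only [LinearEquiv.coe_toEquiv]
  rw [this]
  simp [normalized]

lemma summable_normalizedG (c : ℝ) {k : ℕ} (hk : 2 < k) {t : ℝ} (ht : t ≠ 0) :
    Summable fun p : ℤ × ℤ => ‖((p.1 + p.2 * (c + t * Complex.I) : ℂ) ^ k)⁻¹‖ := by
  have h := ((normalized c t ht).hasSum_sumInvPow 0 hk).summable
  rw [← (normalized c t ht).latticeEquivProd.symm.toEquiv.summable_iff] at h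
  refine h.norm.congr fun p => ?_
  have := (normalized c t ht).latticeEquiv_symm_apply p
  simp only [LinearEquiv.coe_toEquiv, Function.comp, sub_zero]
  rw [this]
  simp [normalized]

/-- Raising t leaves the real part of m + n(c + it) alone and enlarges its imaginary part. The sum
at the lowest height is therefore a majorant, used both for continuity and for the limit t → ∞. -/
lemma norm_normalizedG_summand_le (c : ℝ) (k : ℕ) {t₀ t : ℝ} (ht₀ : 0 < t₀) (ht : t₀ ≤ t)
    (p : ℤ × ℤ) :
    ‖((p.1 + p.2 * (c + t * Complex.I) : ℂ) ^ k)⁻¹‖ ≤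
      ‖((p.1 + p.2 * (c + t₀ * Complex.I) : ℂ) ^ k)⁻¹‖ := by
  by_cases hp : (p.1 + p.2 * (c + t₀ * Complex.I) : ℂ) = 0
  · have h1 := congrArg Complex.im hp
    have h2 := congrArg Complex.re hp
    simp at h1 h2
    have h3 : p.2 = 0 := by
      rcases h1 with h | h
      · exact h
      · exact absurd h ht₀.ne'
    have h4 : p.1 = 0 := by
      rw [h3] at h2; simpa using h2
    simp [h3, h4]
  · rw [norm_inv, norm_inv, norm_pow, norm_pow]
    refine inv_anti₀ (pow_pos (norm_pos_iff.mpr hp) k) (pow_le_pow_left₀ (norm_nonneg _) ?_ k)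
    rw [Complex.norm_eq_sqrt_sq_add_sq, Complex.norm_eq_sqrt_sq_add_sq]
    refine Real.sqrt_le_sqrt ?_
    simp only [Complex.add_re, Complex.intCast_re, Complex.mul_re, Complex.ofReal_re,
      Complex.I_re, mul_zero, Complex.ofReal_im, Complex.I_im, mul_one, sub_self, add_zero,
      Complex.intCast_im, Complex.add_im, Complex.mul_im, zero_add, zero_mul, sub_zero, mul_pow]
    gcongr

lemma continuousOn_normalizedG (c : ℝ) {k : ℕ} (hk : 2 < k) {t₀ : ℝ} (ht₀ : 0 < t₀) :
    ContinuousOn (normalizedG c k) (Set.Ici t₀) := by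
  refine continuousOn_tsum (fun p => ?_) (summable_normalizedG c hk ht₀.ne')
    (fun p t ht => norm_normalizedG_summand_le c k ht₀ ht p)
  by_cases hp : p.2 = 0
  · simp only [hp, Int.cast_zero, zero_mul, add_zero]
    exact continuousOn_const
  · refine ContinuousOn.inv₀ (by fun_prop) fun t ht => pow_ne_zero _ fun h => ?_
    have h1 := congrArg Complex.im h
    simp at h1
    rcases h1 with h | h
    · exact hp h
    · exact (lt_of_lt_of_le ht₀ ht).ne' h

/-- All rows n ≠ 0 of the lattice move off to infinity; the remaining row ℤ contributes 2ζ(k), its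
term at 0 being zero by convention. -/
lemma tendsto_normalizedG (c : ℝ) {k : ℕ} (hk : 2 < k) (hke : Even k) :
    Tendsto (normalizedG c k) atTop (𝓝 (2 * riemannZeta k)) := by
  have hg : ∑' p : ℤ × ℤ, (if p.2 = 0 then ((p.1 : ℂ) ^ k)⁻¹ else 0) = 2 * riemannZeta k := by
    rw [two_mul_riemannZeta_eq_tsum_int_inv_pow_of_even (by omega) hke]
    have hi : Function.Injective fun m : ℤ => (m, (0 : ℤ)) := fun a b h => by simpa using h
    rw [← hi.tsum_eq]
    · simp
    · intro p hp
      have : p.2 = 0 := by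
        by_contra h
        simp [h] at hp
      exact ⟨p.1, by ext <;> simp [this]⟩
  rw [← hg]
  refine tendsto_tsum_of_dominated_convergence (summable_normalizedG c hk one_ne_zero)
    (fun p => ?_) ?_
  · by_cases hp : p.2 = 0
    · simp [hp]
    · simp only [hp, if_false]
      rw [tendsto_zero_iff_norm_tendsto_zero]
      simp only [norm_inv, norm_pow]
      refine tendsto_inv_atTop_zero.comp ((tendsto_pow_atTop (by omega)).comp ?_)
      refine tendsto_atTop_mono (f := fun t : ℝ => t) (fun t => ?_) tendsto_id
      refine le_trans ?_ (Complex.abs_im_le_norm _)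
      simp only [Complex.add_im, Complex.intCast_im, Complex.mul_im, Complex.intCast_re,
        Complex.ofReal_im, Complex.ofReal_re, Complex.I_im, mul_one, Complex.I_re, mul_zero,
        add_zero, zero_add, zero_mul, abs_mul]
      have : (1 : ℝ) ≤ |(p.2 : ℝ)| := by exact_mod_cast Int.one_le_abs hp
      calc t ≤ |t| := le_abs_self t
        _ ≤ |(p.2 : ℝ)| * |t| := le_mul_of_one_le_left (abs_nonneg t) this
  · filter_upwards [eventually_ge_atTop 1] with t ht p
    exact norm_normalizedG_summand_le c k one_pos ht p

lemma conjStable_of_generators (h1 : (starRingEnd ℂ) L.ω₁ ∈ L.lattice)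
    (h2 : (starRingEnd ℂ) L.ω₂ ∈ L.lattice) : L.ConjStable := by
  intro z hz
  obtain ⟨m, n, rfl⟩ := mem_lattice.mp hz
  have := add_mem (L.lattice.smul_mem m h1) (L.lattice.smul_mem n h2)
  simpa using this

lemma conjStable_normalized_zero {t : ℝ} (ht : t ≠ 0) : (normalized 0 t ht).ConjStable := by
  refine conjStable_of_generators ?_ ?_
  · simpa [normalized] using (normalized 0 t ht).ω₁_mem_lattice
  · simpa [normalized] using neg_mem (normalized 0 t ht).ω₂_mem_lattice

lemma conjStable_normalized_half {t : ℝ} (ht : t ≠ 0) : (normalized (1 / 2) t ht).ConjStable := by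
  refine conjStable_of_generators ?_ ?_
  · simpa [normalized] using (normalized (1 / 2) t ht).ω₁_mem_lattice
  · have := sub_mem (normalized (1 / 2) t ht).ω₁_mem_lattice (normalized (1 / 2) t ht).ω₂_mem_lattice
    convert! this using 1
    simp only [normalized, map_add, map_mul, Complex.conj_ofReal, Complex.conj_I]
    push_cast
    ring

/-- The square lattice has `g₃ = 0`. -/
lemma G_six_square : (normalized 0 1 one_ne_zero).G 6 = 0 := by
  -- Multiplication by i preserves the square lattice but multiplies G₆ by i⁻⁶ = -1.
  have hl : ((normalized 0 1 one_ne_zero).scale Complex.I Complex.I_ne_zero).lattice =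
      (normalized 0 1 one_ne_zero).lattice := by
    ext z
    simp only [mem_lattice, scale, normalized]
    constructor
    · rintro ⟨m, n, rfl⟩
      refine ⟨-n, m, ?_⟩
      push_cast
      linear_combination -(n : ℂ) * Complex.I_mul_I
    · rintro ⟨m, n, rfl⟩
      refine ⟨n, -m, ?_⟩
      push_cast
      linear_combination -(m : ℂ) * Complex.I_mul_I
  have h := G_scale (normalized 0 1 one_ne_zero) Complex.I_ne_zero 6
  rw [G_eq_of_lattice_eq hl, show Complex.I ^ 6 = -1 by
    rw [show 6 = 2 * 3 by norm_num, pow_mul, Complex.I_sq]; norm_num] at h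
  have h' : (2 : ℂ) * (normalized 0 1 one_ne_zero).G 6 = 0 := by
    linear_combination h
  simpa using h'

/-- A half period of a conjugation stable lattice has a real value of `℘` if it is real or
imaginary. -/
lemma ConjStable.exists_weierstrassP_eq (h : L.ConjStable) {a : ℂ}
    (ha : (starRingEnd ℂ) a = a ∨ a - (starRingEnd ℂ) a ∈ L.lattice) :
    ∃ r : ℝ, L.weierstrassP a = r := by
  refine Complex.conj_eq_iff_real.mp ?_
  rw [← h.weierstrassP_conj]
  rcases ha with ha | ha
  · rw [ha]
  · rw [← weierstrassP_sub_mem ha a, sub_sub_cancel]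

/-- As G₆ = 0, the cubic is 4s³ - 60rs. The values x ≠ y of ℘ at the half periods 1/2 and i/2 are
real roots of it, and subtracting the two equations gives 60r = 4(x² + xy + y²) > 0. -/
lemma G_four_square_pos {r : ℝ} (hr : (normalized 0 1 one_ne_zero).G 4 = r) : 0 < r := by
  set S := normalized 0 1 one_ne_zero with hS
  have hc : S.ConjStable := conjStable_normalized_zero one_ne_zero
  obtain ⟨x, hx⟩ := hc.exists_weierstrassP_eq (a := S.ω₁ / 2) (Or.inl (by simp [hS, normalized, map_ofNat]))
  obtain ⟨y, hy⟩ := hc.exists_weierstrassP_eq (a := S.ω₂ / 2) (Or.inr (by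
    have := S.ω₂_mem_lattice
    convert! this using 1
    simp only [hS, normalized, map_div₀, map_ofNat, map_add, map_mul, Complex.conj_ofReal,
      Complex.conj_I]
    push_cast
    ring))
  have hne : x ≠ y := by
    rintro rfl
    exact weierstrassP_half_periods_ne (hx.trans hy.symm)
  have h1 := cubic_eq_zero_of_half_period S.ω₁_div_two_notMem_lattice
    (by rw [mul_div_cancel₀ _ two_ne_zero]; exact S.ω₁_mem_lattice)
  have h2 := cubic_eq_zero_of_half_period S.ω₂_div_two_notMem_lattice
    (by rw [mul_div_cancel₀ _ two_ne_zero]; exact S.ω₂_mem_lattice)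
  rw [hx, g₂, g₃, hr, G_six_square] at h1
  rw [hy, g₂, g₃, hr, G_six_square] at h2
  have h1' : 4 * x ^ 3 - 60 * r * x = 0 := by
    have : ((4 * x ^ 3 - 60 * r * x : ℝ) : ℂ) = 0 := by push_cast; linear_combination h1
    exact_mod_cast this
  have h2' : 4 * y ^ 3 - 60 * r * y = 0 := by
    have : ((4 * y ^ 3 - 60 * r * y : ℝ) : ℂ) = 0 := by push_cast; linear_combination h2
    exact_mod_cast this
  have h3 : 60 * r = 4 * (x ^ 2 + x * y + y ^ 2) :=
    mul_right_cancel₀ (sub_ne_zero.mpr hne) (by linear_combination h2' - h1')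
  have h4 : 0 < (x - y) ^ 2 := by positivity [sub_ne_zero.mpr hne]
  nlinarith [sq_nonneg (x + y)]

/-- The rhombic lattice ℤ + ℤ(1 + i)/2 is (1 + i)/2 times the square lattice, and ((1 + i)/2)⁴ =
-1/4. -/
lemma G_four_half : (normalized (1 / 2) (1 / 2) (by norm_num)).G 4 =
    -4 * (normalized 0 1 one_ne_zero).G 4 := by
  have hc : ((1 + Complex.I) / 2 : ℂ) ≠ 0 := by
    intro h
    have := congrArg Complex.re h
    simp at this
  have hl : ((normalized 0 1 one_ne_zero).scale _ hc).lattice =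
      (normalized (1 / 2) (1 / 2) (by norm_num)).lattice := by
    ext z
    simp only [mem_lattice, scale, normalized]
    constructor
    · rintro ⟨m, n, rfl⟩
      refine ⟨-n, m + n, ?_⟩
      push_cast
      linear_combination -(n : ℂ) / 2 * Complex.I_mul_I
    · rintro ⟨m, n, rfl⟩
      refine ⟨n + m, -m, ?_⟩
      push_cast
      linear_combination -(m : ℂ) / 2 * Complex.I_mul_I
  have h := G_scale (normalized 0 1 one_ne_zero) hc 4
  rw [G_eq_of_lattice_eq hl, show ((1 + Complex.I) / 2 : ℂ) ^ 4 = -(1 / 4) by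
    rw [show 4 = 2 * 2 by norm_num, pow_mul]
    ring_nf
    simp
    ring_nf] at h
  rw [h]
  norm_num

end PeriodPair

/-! ### Existence of a lattice with given real invariants -/

lemma riemannZeta_six : riemannZeta 6 = (Real.pi : ℂ) ^ 6 / 945 := by
  have h := riemannZeta_two_mul_nat (k := 3) (by norm_num)
  have hb : bernoulli 6 = 1 / 42 := by
    rw [bernoulli_eq_bernoulli'_of_ne_one (by norm_num), bernoulli'_def]
    have h5 : bernoulli' 5 = 0 := bernoulli'_eq_zero_of_odd (by decide) (by norm_num)
    simp only [Finset.sum_range_succ, Finset.sum_range_zero, bernoulli'_zero, bernoulli'_one,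
      bernoulli'_two, bernoulli'_three, bernoulli'_four, h5,
      show Nat.choose 6 0 = 1 by rfl, show Nat.choose 6 1 = 6 by rfl,
      show Nat.choose 6 2 = 15 by rfl, show Nat.choose 6 4 = 15 by rfl]
    norm_num
  rw [show (2 * 3 : ℕ) = 6 by norm_num, hb, show (2 : ℂ) * ((3 : ℕ) : ℂ) = 6 by norm_num] at h
  rw [h]
  norm_num [Nat.factorial]
  ring

/-- A continuous function with values of opposite sign at the left end and at infinity has a
zero. -/
lemma exists_zero_of_tendsto_atTop {f : ℝ → ℝ} {a l : ℝ} (hf : ContinuousOn f (Set.Ici a))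
    (hl : Tendsto f atTop (𝓝 l)) (ha : 0 ≤ f a) (hneg : l < 0) : ∃ t, a ≤ t ∧ f t = 0 := by
  obtain ⟨b, hb, hab⟩ := ((hl.eventually (gt_mem_nhds hneg)).and (eventually_ge_atTop a)).exists
  obtain ⟨t, ht, hft⟩ := intermediate_value_Icc' hab (hf.mono fun x hx => hx.1) ⟨hb.le, ha⟩
  exact ⟨t, ht.1, hft⟩

namespace PeriodPair

/-- The discriminant relation along the lattices `ℤ + ℤ (c + i t)`. -/
noncomputable def cubicRatio (a b c t : ℝ) : ℝ :=
  b ^ 2 * (60 * (normalizedG c 4 t).re) ^ 3 - a ^ 3 * (140 * (normalizedG c 6 t).re) ^ 2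

lemma continuousOn_cubicRatio (a b c : ℝ) {t₀ : ℝ} (ht₀ : 0 < t₀) :
    ContinuousOn (cubicRatio a b c) (Set.Ici t₀) := by
  have h4 : ContinuousOn (fun t => (normalizedG c 4 t).re) (Set.Ici t₀) :=
    Complex.continuous_re.comp_continuousOn (continuousOn_normalizedG c (by norm_num) ht₀)
  have h6 : ContinuousOn (fun t => (normalizedG c 6 t).re) (Set.Ici t₀) :=
    Complex.continuous_re.comp_continuousOn (continuousOn_normalizedG c (by norm_num) ht₀)
  unfold cubicRatio
  fun_prop

/-- In the limit g₂ = 4π⁴/3 and g₃ = 8π⁶/27, by the values of ζ(4) and ζ(6). These satisfy g₂³ =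
27g₃², so the limit has the sign of 27b² - a³. -/
lemma tendsto_cubicRatio (a b c : ℝ) : Tendsto (cubicRatio a b c) atTop
    (𝓝 (64 * Real.pi ^ 12 / 729 * (27 * b ^ 2 - a ^ 3))) := by
  have h4 : Tendsto (fun t => (normalizedG c 4 t).re) atTop (𝓝 (Real.pi ^ 4 / 45)) := by
    have h := (Complex.continuous_re.tendsto _).comp
      (tendsto_normalizedG c (k := 4) (by norm_num) (by decide))
    have e : (2 * riemannZeta ((4 : ℕ) : ℂ)).re = Real.pi ^ 4 / 45 := by
      rw [show ((4 : ℕ) : ℂ) = 4 by norm_num, riemannZeta_four,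
        show (2 : ℂ) * ((Real.pi : ℂ) ^ 4 / 90) = ((Real.pi ^ 4 / 45 : ℝ) : ℂ) by push_cast; ring,
        Complex.ofReal_re]
    rwa [e] at h
  have h6 : Tendsto (fun t => (normalizedG c 6 t).re) atTop (𝓝 (2 * Real.pi ^ 6 / 945)) := by
    have h := (Complex.continuous_re.tendsto _).comp
      (tendsto_normalizedG c (k := 6) (by norm_num) (by decide))
    have e : (2 * riemannZeta ((6 : ℕ) : ℂ)).re = 2 * Real.pi ^ 6 / 945 := by
      rw [show ((6 : ℕ) : ℂ) = 6 by norm_num, riemannZeta_six,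
        show (2 : ℂ) * ((Real.pi : ℂ) ^ 6 / 945) = ((2 * Real.pi ^ 6 / 945 : ℝ) : ℂ) by
          push_cast; ring,
        Complex.ofReal_re]
    rwa [e] at h
  have := (((h4.const_mul 60).pow 3).const_mul (b ^ 2)).sub
    (((h6.const_mul 140).pow 2).const_mul (a ^ 3))
  convert! this using 2
  ring

/-- Real invariants can be rescaled by a real or imaginary factor. -/
lemma exists_of_cubic_proportional (L : PeriodPair) {a b A B : ℝ} (hA : L.g₂ = A)
    (hB : L.g₃ = B) (ha : b = 0 → 0 < a ∧ 0 < A) (h : b ^ 2 * A ^ 3 = a ^ 3 * B ^ 2) :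
    ∃ L' : PeriodPair, L'.g₂ = a ∧ L'.g₃ = b := by
  have key : ∀ c : ℂ, c ≠ 0 → c ^ 4 * A = a → c ^ 6 * B = b →
      ∃ L' : PeriodPair, L'.g₂ = a ∧ L'.g₃ = b := by
    intro c hc h1 h2
    refine ⟨L.scale c⁻¹ (inv_ne_zero hc), ?_, ?_⟩
    · rw [g₂] at hA ⊢
      rw [G_scale, ← h1, ← hA]
      simp only [inv_pow, inv_inv]
      ring
    · rw [g₃] at hB ⊢
      rw [G_scale, ← h2, ← hB]
      simp only [inv_pow, inv_inv]
      ring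
  -- If b = 0 the scale must be read off g₂, which needs a and A of equal sign. Otherwise it is the
  -- sixth root of |b/B|, multiplied by i when b/B < 0, since i⁴ = 1 and i⁶ = -1.
  by_cases hb : b = 0
  · obtain ⟨ha0, hA0⟩ := ha hb
    have hB0 : B = 0 := by
      rw [hb] at h
      have : a ^ 3 * B ^ 2 = 0 := by rw [← h]; ring
      simpa [ha0.ne'] using this
    have h4 : ((a / A) ^ (1 / 4 : ℝ)) ^ 4 * A = a := by
      rw [← Real.rpow_natCast, ← Real.rpow_mul (by positivity)]
      norm_num
      field_simp
    have hpos : 0 < (a / A) ^ (1 / 4 : ℝ) := by positivity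
    exact key ((a / A) ^ (1 / 4 : ℝ) : ℝ) (by exact_mod_cast hpos.ne') (by exact_mod_cast h4)
      (by rw [hb, hB0]; simp)
  · have hB0 : B ≠ 0 := by
      intro hB0
      have hA0 : A = 0 := by
        rw [hB0] at h
        simpa [hb] using h
      rcases L.g₂_ne_zero_or_g₃_ne_zero with h' | h'
      · exact h' (by rw [hA, hA0]; simp)
      · exact h' (by rw [hB, hB0]; simp)
    have hq : b / B ≠ 0 := div_ne_zero hb hB0
    set c : ℝ := |b / B| ^ (1 / 6 : ℝ) with hc
    have hcpos : 0 < c := by positivity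
    have h6 : c ^ 6 = |b / B| := by
      rw [hc, ← Real.rpow_natCast, ← Real.rpow_mul (abs_nonneg _)]
      norm_num
    -- The proportionality h gives the equation only after cubing; real cubing is injective.
    have h4 : c ^ 4 * A = a := by
      refine (Odd.pow_injective (n := 3) (by decide)) ?_
      simp only
      calc (c ^ 4 * A) ^ 3 = (c ^ 6) ^ 2 * A ^ 3 := by ring
        _ = a ^ 3 := by
            rw [h6, sq_abs]
            field_simp
            linear_combination h
    rcases lt_or_gt_of_ne hq with hs | hs
    · rw [abs_of_neg hs] at h6
      refine key (Complex.I * c) (mul_ne_zero Complex.I_ne_zero (by exact_mod_cast hcpos.ne')) ?_ ?_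
      · rw [mul_pow, Complex.I_pow_four, one_mul]
        exact_mod_cast h4
      · have : c ^ 6 * B = -b := by rw [h6]; field_simp
        rw [mul_pow, show Complex.I ^ 6 = -1 by
          rw [show 6 = 2 * 3 by norm_num, pow_mul, Complex.I_sq]; norm_num]
        have h' : ((c ^ 6 * B : ℝ) : ℂ) = ((-b : ℝ) : ℂ) := by rw [this]
        push_cast at h'
        linear_combination -h'
    · rw [abs_of_pos hs] at h6
      have : c ^ 6 * B = b := by rw [h6]; field_simp
      exact key c (by exact_mod_cast hcpos.ne') (by exact_mod_cast h4) (by exact_mod_cast this)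

/-- Every real pair `(a, b)` with `a ≥ 0` and nonzero discriminant consists of the invariants of a
lattice. -/
theorem exists_of_invariants {a b : ℝ} (ha : 0 ≤ a) (hab : a ^ 3 ≠ 27 * b ^ 2) :
    ∃ L : PeriodPair, L.g₂ = a ∧ L.g₃ = b := by
  have fin : ∀ c t : ℝ, ∀ ht : t ≠ 0, (normalized c t ht).ConjStable →
      (b = 0 → 0 < a ∧ 0 < (normalizedG c 4 t).re) → cubicRatio a b c t = 0 →
      ∃ L : PeriodPair, L.g₂ = a ∧ L.g₃ = b := by
    intro c t ht hc hb h0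
    obtain ⟨r, hr⟩ := hc.exists_G_eq 4
    obtain ⟨s, hs⟩ := hc.exists_G_eq 6
    rw [cubicRatio, ← G_normalized c t ht, ← G_normalized c t ht, hr, hs, Complex.ofReal_re,
      Complex.ofReal_re] at h0
    rw [← G_normalized c t ht, hr, Complex.ofReal_re] at hb
    refine (normalized c t ht).exists_of_cubic_proportional (A := 60 * r) (B := 140 * s)
      (by rw [g₂, hr]; push_cast; ring) (by rw [g₃, hs]; push_cast; ring)
      (fun h => ⟨(hb h).1, by linarith [(hb h).2]⟩) (by linarith)
  obtain ⟨r, hr⟩ := (conjStable_normalized_zero one_ne_zero).exists_G_eq 4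
  have hrpos := G_four_square_pos hr
  -- Negative discriminant: rhombic lattices, starting at (1 + i)/2, where g₂ < 0 makes `cubicRatio`
  -- nonpositive while its limit is positive. Positive discriminant: rectangular lattices, starting
  -- at i, where g₃ = 0 and g₂ > 0 make it nonnegative while its limit is negative.
  rcases lt_or_gt_of_ne hab with hlt | hgt
  · have hb : b ≠ 0 := by
      rintro rfl
      have : 0 ≤ a ^ 3 := by positivity
      norm_num at hlt
      linarith
    have hhalf : normalizedG (1 / 2) 4 (1 / 2) = ((-4 * r : ℝ) : ℂ) := by
      rw [← G_normalized _ _ (by norm_num), G_four_half, hr]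
      push_cast
      ring
    have hlim := (tendsto_cubicRatio a b (1 / 2)).neg
    have hneg : -(64 * Real.pi ^ 12 / 729 * (27 * b ^ 2 - a ^ 3)) < 0 := by
      have : 0 < 64 * Real.pi ^ 12 / 729 := by positivity
      have := mul_pos this (sub_pos.mpr hlt)
      linarith
    have h0 : 0 ≤ -cubicRatio a b (1 / 2) (1 / 2) := by
      rw [cubicRatio, hhalf, Complex.ofReal_re]
      have h1 : 0 < b ^ 2 * r ^ 3 := by positivity
      have h2 : 0 ≤ a ^ 3 * (140 * (normalizedG (1 / 2) 6 (1 / 2)).re) ^ 2 := by positivity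
      nlinarith
    obtain ⟨t, ht, hzero⟩ := exists_zero_of_tendsto_atTop
      (continuousOn_cubicRatio a b (1 / 2) (by norm_num)).neg hlim h0 hneg
    have ht0 : t ≠ 0 := by
      intro h; rw [h] at ht; norm_num at ht
    exact fin (1 / 2) t ht0 (conjStable_normalized_half ht0) (fun h => absurd h hb)
      (neg_eq_zero.mp hzero)
  · have ha0 : 0 < a := by
      rcases ha.lt_or_eq with h | h
      · exact h
      · rw [← h] at hgt
        nlinarith [sq_nonneg b]
    have h4 : normalizedG 0 4 1 = (r : ℂ) := by
      rw [← G_normalized _ _ one_ne_zero, hr]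
    have h6 : normalizedG 0 6 1 = 0 := by
      rw [← G_normalized _ _ one_ne_zero, G_six_square]
    by_cases hb : b = 0
    · refine fin 0 1 one_ne_zero (conjStable_normalized_zero one_ne_zero)
        (fun _ => ⟨ha0, by rw [h4]; simpa using hrpos⟩) ?_
      rw [cubicRatio, hb, h6]
      simp
    · have hneg : 64 * Real.pi ^ 12 / 729 * (27 * b ^ 2 - a ^ 3) < 0 :=
        mul_neg_of_pos_of_neg (by positivity) (sub_neg.mpr hgt)
      have h0 : 0 ≤ cubicRatio a b 0 1 := by
        rw [cubicRatio, h4, h6, Complex.ofReal_re, Complex.zero_re]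
        have : 0 < b ^ 2 * (60 * r) ^ 3 := by positivity
        linarith
      obtain ⟨t, ht, hzero⟩ := exists_zero_of_tendsto_atTop
        (continuousOn_cubicRatio a b 0 one_pos) (tendsto_cubicRatio a b 0) h0 hneg
      have ht0 : t ≠ 0 := by linarith
      exact fin 0 t ht0 (conjStable_normalized_zero ht0) (fun h => absurd h hb) hzero

end PeriodPair

/-! ### Functions descending from +∞ to their first critical point -/

section profile

variable {φ φ' : ℝ → ℝ} {v : ℝ}

/-- A function that comes down from `+∞` at `0` and has no critical point before `v` decreases. -/
lemma strictAntiOn_of_tendsto_atTop (hv : 0 < v)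
    (hd : ∀ t ∈ Set.Ioc 0 v, HasDerivAt φ (φ' t) t) (hne : ∀ t ∈ Set.Ioo 0 v, φ' t ≠ 0)
    (hlim : Tendsto φ (𝓝[>] 0) atTop) :
    (∀ t ∈ Set.Ioo 0 v, φ' t < 0) ∧ StrictAntiOn φ (Set.Ioc 0 v) := by
  have hc : ContinuousOn φ (Set.Ioc 0 v) := fun t ht => (hd t ht).continuousAt.continuousWithinAt
  have hi : interior (Set.Ioc 0 v) = Set.Ioo 0 v := interior_Ioc
  have hd' : ∀ t ∈ Set.Ioo 0 v, deriv φ t = φ' t := fun t ht => (hd t ⟨ht.1, ht.2.le⟩).deriv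
  rcases hasDerivWithinAt_forall_lt_or_forall_gt_of_forall_ne (convex_Ioo 0 v)
    (fun t ht => (hd t ⟨ht.1, ht.2.le⟩).hasDerivWithinAt) hne with h | h
  · refine ⟨h, strictAntiOn_of_deriv_neg (convex_Ioc 0 v) hc fun t ht => ?_⟩
    rw [hi] at ht
    rw [hd' t ht]
    exact h t ht
  · exfalso
    have hm : StrictMonoOn φ (Set.Ioc 0 v) := strictMonoOn_of_deriv_pos (convex_Ioc 0 v) hc
      fun t ht => by
        rw [hi] at ht
        rw [hd' t ht]
        exact h t ht
    obtain ⟨t, ht1, ht2⟩ := ((hlim.eventually (eventually_gt_atTop (φ v))).and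
      (Ioc_mem_nhdsGT hv)).exists
    exact absurd (hm.monotoneOn ht2 ⟨hv, le_rfl⟩ ht2.2) (not_le.mpr ht1)

lemma image_Ioo_eq_Ioi_of_tendsto_atTop (hv : 0 < v)
    (hd : ∀ t ∈ Set.Ioc 0 v, HasDerivAt φ (φ' t) t) (hne : ∀ t ∈ Set.Ioo 0 v, φ' t ≠ 0)
    (hlim : Tendsto φ (𝓝[>] 0) atTop) : φ '' Set.Ioo 0 v = Set.Ioi (φ v) := by
  have ha := (strictAntiOn_of_tendsto_atTop hv hd hne hlim).2
  ext y
  constructor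
  · rintro ⟨t, ht, rfl⟩
    exact ha ⟨ht.1, ht.2.le⟩ ⟨hv, le_rfl⟩ ht.2
  · intro hy
    obtain ⟨s, hs1, hs2⟩ := ((hlim.eventually (eventually_gt_atTop y)).and
      (Ioc_mem_nhdsGT hv)).exists
    have hc : ContinuousOn φ (Set.Icc s v) := fun t ht =>
      (hd t ⟨hs2.1.trans_le ht.1, ht.2⟩).continuousAt.continuousWithinAt
    obtain ⟨t, ht, rfl⟩ := intermediate_value_Icc' hs2.2 hc ⟨(le_of_lt hy : φ v ≤ y), hs1.le⟩
    refine ⟨t, ⟨hs2.1.trans_le ht.1, lt_of_le_of_ne ht.2 ?_⟩, rfl⟩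
    intro h
    rw [h] at hy
    exact lt_irrefl _ (Set.mem_Ioi.mp hy)

/-- Substituting s = φ(t) turns the integrand into |φ'|/√(φ'²) = 1, so the integral is the time v of
descent. -/
lemma integral_one_div_sqrt_eq_of_profile (hv : 0 < v)
    (hd : ∀ t ∈ Set.Ioc 0 v, HasDerivAt φ (φ' t) t) (hne : ∀ t ∈ Set.Ioo 0 v, φ' t ≠ 0)
    (hlim : Tendsto φ (𝓝[>] 0) atTop) {q : ℝ → ℝ} (hq : ∀ t ∈ Set.Ioc 0 v, φ' t ^ 2 = q (φ t)) :
    ∫ s in Set.Ioi (φ v), 1 / √(q s) = v := by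
  have ha := (strictAntiOn_of_tendsto_atTop hv hd hne hlim).2
  rw [← image_Ioo_eq_Ioi_of_tendsto_atTop hv hd hne hlim,
    MeasureTheory.integral_image_eq_integral_abs_deriv_smul measurableSet_Ioo
      (fun t ht => (hd t ⟨ht.1, ht.2.le⟩).hasDerivWithinAt)
      (ha.injOn.mono Set.Ioo_subset_Ioc_self)]
  rw [MeasureTheory.setIntegral_congr_fun (g := fun _ => (1 : ℝ)) measurableSet_Ioo]
  · simp [hv.le]
  · intro t ht
    have h1 := hq t ⟨ht.1, ht.2.le⟩
    have h2 : |φ' t| ≠ 0 := abs_ne_zero.mpr (hne t ht)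
    simp only [smul_eq_mul]
    rw [← h1, Real.sqrt_sq_eq_abs]
    field_simp

/-- The function φ sweeps out everything from φ(v) upwards, and there q = φ'² ≥ 0. This locates the
root φ(v) on the correct side of a test point. -/
lemma lt_of_profile (hv : 0 < v)
    (hd : ∀ t ∈ Set.Ioc 0 v, HasDerivAt φ (φ' t) t) (hne : ∀ t ∈ Set.Ioo 0 v, φ' t ≠ 0)
    (hlim : Tendsto φ (𝓝[>] 0) atTop) {q : ℝ → ℝ} (hq : ∀ t ∈ Set.Ioc 0 v, φ' t ^ 2 = q (φ t))
    {c : ℝ} (hc : q c < 0) : c < φ v := by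
  by_contra! hle
  have : ∃ t ∈ Set.Ioc 0 v, φ t = c := by
    rcases hle.eq_or_lt with h | h
    · exact ⟨v, ⟨hv, le_rfl⟩, h⟩
    · have hm : c ∈ φ '' Set.Ioo 0 v := by
        rw [image_Ioo_eq_Ioi_of_tendsto_atTop hv hd hne hlim]; exact h
      obtain ⟨t, ht, rfl⟩ := hm
      exact ⟨t, ⟨ht.1, ht.2.le⟩, rfl⟩
  obtain ⟨t, ht, rfl⟩ := this
  rw [← hq t ht] at hc
  exact absurd (sq_nonneg _) (not_le.mpr hc)

end profile

/-! ### Real and imaginary periods of a conjugation stable lattice -/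

namespace PeriodPair

variable {L : PeriodPair}

/-- The parameters of the lattice points on the line `ℝ u`. -/
def linePeriods (L : PeriodPair) (u : ℂ) : AddSubgroup ℝ where
  carrier := {t | (t : ℂ) * u ∈ L.lattice}
  zero_mem' := by simp
  add_mem' := by
    intro a b ha hb
    have := L.lattice.add_mem ha hb
    simpa [add_mul] using this
  neg_mem' := by
    intro a ha
    have := L.lattice.neg_mem ha
    simpa using this

lemma mem_linePeriods {u : ℂ} {t : ℝ} : t ∈ L.linePeriods u ↔ (t : ℂ) * u ∈ L.lattice := Iff.rfl

/-- The lattice is discrete, so the parameters form a nontrivial subgroup of ℝ that misses an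
interval to the right of 0. -/
lemma exists_isLeast_linePeriods {u : ℂ} (hu : u ≠ 0) {s : ℝ} (hs : s ≠ 0)
    (hsu : (s : ℂ) * u ∈ L.lattice) : ∃ w, IsLeast {t | t ∈ L.linePeriods u ∧ 0 < t} w := by
  have h0 : Tendsto (fun t : ℝ => (t : ℂ) * u) (𝓝[>] 0) (𝓝[≠] 0) := by
    refine tendsto_nhdsWithin_iff.mpr ⟨?_, ?_⟩
    · have : Tendsto (fun t : ℝ => (t : ℂ) * u) (𝓝 0) (𝓝 (((0 : ℝ) : ℂ) * u)) :=
        Continuous.tendsto (by fun_prop) _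
      simp only [Complex.ofReal_zero, zero_mul] at this
      exact this.mono_left nhdsWithin_le_nhds
    · filter_upwards [self_mem_nhdsWithin] with t ht
      have : t ≠ 0 := ne_of_gt ht
      simp [this, hu]
  obtain ⟨a, ha, hsub⟩ := mem_nhdsGT_iff_exists_Ioo_subset.mp
    (h0 (eventually_notMem_lattice (L := L) 0))
  refine AddSubgroup.exists_isLeast_pos (H := L.linePeriods u) ?_ (a := a) ha ?_
  · intro hbot
    have : s ∈ L.linePeriods u := hsu
    rw [hbot] at this
    exact hs this
  · rw [Set.disjoint_left]
    intro t ht ht'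
    exact hsub ht' ht

lemma mem_linePeriods_iff_of_isLeast {u : ℂ} {w : ℝ}
    (hw : IsLeast {t | t ∈ L.linePeriods u ∧ 0 < t} w) (t : ℝ) :
    (t : ℂ) * u ∈ L.lattice ↔ ∃ n : ℤ, t = n * w := by
  rw [← mem_linePeriods, AddSubgroup.cyclic_of_min hw, AddSubgroup.mem_closure_singleton]
  simp only [zsmul_eq_mul, eq_comm]

/-- The sum of z and its conjugate is a real period. If it were always zero, both generators would
be imaginary and hence dependent over ℝ. -/
lemma ConjStable.exists_isLeast_real (h : L.ConjStable) :
    ∃ w, IsLeast {t | t ∈ L.linePeriods 1 ∧ 0 < t} w := by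
  have key : ∀ z ∈ L.lattice, z.re ≠ 0 → ∃ w, IsLeast {t | t ∈ L.linePeriods 1 ∧ 0 < t} w := by
    intro z hz hre
    refine exists_isLeast_linePeriods one_ne_zero (s := 2 * z.re) (by simpa using hre) ?_
    have := add_mem hz (h z hz)
    rw [Complex.add_conj] at this
    simpa using this
  by_contra hne
  have h1 : L.ω₁.re = 0 := by
    by_contra hh; exact hne (key _ L.ω₁_mem_lattice hh)
  have h2 : L.ω₂.re = 0 := by
    by_contra hh; exact hne (key _ L.ω₂_mem_lattice hh)
  have := LinearIndependent.pair_iff.mp L.indep L.ω₂.im (-L.ω₁.im)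
    (by apply Complex.ext <;> simp [h1, h2]; ring)
  have h3 : L.ω₁ = 0 := Complex.ext h1 (by simpa using this.2)
  exact L.ω₁_div_two_notMem_lattice (by simp [h3])

lemma ConjStable.exists_isLeast_imaginary (h : L.ConjStable) :
    ∃ w, IsLeast {t | t ∈ L.linePeriods Complex.I ∧ 0 < t} w := by
  have key : ∀ z ∈ L.lattice, z.im ≠ 0 →
      ∃ w, IsLeast {t | t ∈ L.linePeriods Complex.I ∧ 0 < t} w := by
    intro z hz him
    refine exists_isLeast_linePeriods Complex.I_ne_zero (s := 2 * z.im) (by simpa using him) ?_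
    have := sub_mem hz (h z hz)
    rw [Complex.sub_conj] at this
    simpa using this
  by_contra hne
  have h1 : L.ω₁.im = 0 := by
    by_contra hh; exact hne (key _ L.ω₁_mem_lattice hh)
  have h2 : L.ω₂.im = 0 := by
    by_contra hh; exact hne (key _ L.ω₂_mem_lattice hh)
  have := LinearIndependent.pair_iff.mp L.indep L.ω₂.re (-L.ω₁.re)
    (by apply Complex.ext <;> simp [h1, h2]; ring)
  have h3 : L.ω₁ = 0 := Complex.ext (by simpa using this.2) h1
  exact L.ω₁_div_two_notMem_lattice (by simp [h3])

lemma _root_.IsImaginaryPeriod.isLeast {ω : ℂ} (h : IsImaginaryPeriod L ω) :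
    ω = (ω.im : ℂ) * Complex.I ∧
      IsLeast {t | t ∈ L.linePeriods Complex.I ∧ 0 < t} ω.im := by
  obtain ⟨h1, h2, h3, h4⟩ := h
  have e : ω = (ω.im : ℂ) * Complex.I := by apply Complex.ext <;> simp [h2]
  refine ⟨e, ⟨?_, h3⟩, ?_⟩
  · rw [mem_linePeriods, ← e]; exact h1
  · rintro t ⟨ht, ht0⟩
    simpa using h4 _ (mem_linePeriods.mp ht) (by simp) (by simpa using ht0)

lemma ConjStable.exists_isImaginaryPeriod (h : L.ConjStable) : ∃ ω, IsImaginaryPeriod L ω := by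
  obtain ⟨w, hw⟩ := h.exists_isLeast_imaginary
  refine ⟨w * Complex.I, hw.1.1, by simp, by simpa using hw.1.2, fun z hz hre him => ?_⟩
  have : z = (z.im : ℂ) * Complex.I := by apply Complex.ext <;> simp [hre]
  rw [this] at hz
  simpa using hw.2 ⟨mem_linePeriods.mpr hz, him⟩

lemma half_notMem_of_isLeast {u : ℂ} {w : ℝ}
    (hw : IsLeast {t | t ∈ L.linePeriods u ∧ 0 < t} w) {t : ℝ} (ht : t ∈ Set.Ioo 0 w) :
    (t : ℂ) * u ∉ L.lattice := fun h => absurd (hw.2 ⟨h, ht.1⟩) (not_le.mpr ht.2)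

/-- The behaviour of `℘` along the real (`u = 1`) or imaginary (`u = i`) axis. -/
lemma ConjStable.exists_profile (h : L.ConjStable) {a b : ℝ} (h2 : L.g₂ = a) (h3 : L.g₃ = b)
    {u : ℂ} {σ : ℝ} (hu : u ^ 2 = σ) (hσ : σ ^ 2 = 1)
    (hconj : (starRingEnd ℂ) u = u ∨ (starRingEnd ℂ) u = -u) {w : ℝ}
    (hw : IsLeast {t | t ∈ L.linePeriods u ∧ 0 < t} w) :
    ∃ φ φ' : ℝ → ℝ, (∀ t : ℝ, L.weierstrassP (t * u) = σ * φ t) ∧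
      (∀ t ∈ Set.Ioc 0 (w / 2), HasDerivAt φ (φ' t) t) ∧
      (∀ t ∈ Set.Ioo 0 (w / 2), φ' t ≠ 0) ∧
      Tendsto φ (𝓝[>] 0) atTop ∧
      (∀ t ∈ Set.Ioc 0 (w / 2), φ' t ^ 2 = 4 * φ t ^ 3 - a * φ t - σ * b) := by
  have hσC : (σ : ℂ) ^ 2 = 1 := by exact_mod_cast hσ
  have hu0 : u ≠ 0 := by
    rintro rfl
    have : (σ : ℂ) = 0 := by rw [← hu]; simp
    rw [this] at hσC
    simp at hσC
  have hw0 : 0 < w := hw.1.2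
  have hnm : ∀ t ∈ Set.Ioc 0 (w / 2), (t : ℂ) * u ∉ L.lattice := fun t ht =>
    half_notMem_of_isLeast hw ⟨ht.1, by linarith [ht.2]⟩
  have hP : ∀ t : ℝ, L.weierstrassP (t * u) = ((L.weierstrassP (t * u)).re : ℂ) := by
    intro t
    refine (Complex.conj_eq_iff_re.mp ?_).symm
    rw [← h.weierstrassP_conj, map_mul, Complex.conj_ofReal]
    rcases hconj with e | e <;> rw [e]
    rw [mul_neg, L.weierstrassP_neg]
  have hP' : ∀ t : ℝ, L.derivWeierstrassP (t * u) * u =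
      ((L.derivWeierstrassP (t * u) * u).re : ℂ) := by
    intro t
    refine (Complex.conj_eq_iff_re.mp ?_).symm
    rw [map_mul, ← h.derivWeierstrassP_conj, map_mul, Complex.conj_ofReal]
    rcases hconj with e | e <;> rw [e]
    rw [mul_neg, mul_neg, L.derivWeierstrassP_neg]
    ring
  have hval : ∀ t : ℝ, L.weierstrassP (t * u) =
      σ * ((σ * (L.weierstrassP (t * u)).re : ℝ) : ℂ) := by
    intro t
    rw [Complex.ofReal_mul, ← mul_assoc, ← sq, hσC, one_mul]
    exact hP t
  -- The profile is φ(t) = σ℘(tu). On the imaginary axis it is -℘(it), which also descends from +∞;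
  -- the sign σ reappears in front of g₃.
  refine ⟨fun t => σ * (L.weierstrassP (t * u)).re,
    fun t => σ * (L.derivWeierstrassP (t * u) * u).re, hval, ?_, ?_, ?_, ?_⟩
  · intro t ht
    refine HasDerivAt.const_mul σ ?_
    have h1 : HasDerivAt (fun t : ℝ => L.weierstrassP (t * u))
        (L.derivWeierstrassP (t * u) * u) t := by
      have e : HasDerivAt (fun z : ℂ => z * u) u (t : ℂ) := by
        simpa using (hasDerivAt_id (t : ℂ)).mul_const u
      exact ((hasDerivAt_weierstrassP (hnm t ht)).comp (t : ℂ) e).comp_ofReal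
    exact Complex.reCLM.hasFDerivAt.comp_hasDerivAt t h1
  -- A critical point tu of ℘ puts 2tu in the lattice, although 0 < 2t < w and w is the least
  -- period.
  · intro t ht h0
    have hre : (L.derivWeierstrassP (t * u) * u).re = 0 := by
      rcases mul_eq_zero.mp h0 with e | e
      · rw [e] at hσ; norm_num at hσ
      · exact e
    have hz : L.derivWeierstrassP (t * u) = 0 := by
      have := hP' t
      rw [hre, Complex.ofReal_zero] at this
      exact (mul_eq_zero.mp this).resolve_right hu0
    have := two_mul_mem_lattice_of_derivWeierstrassP_eq_zero (hnm t ⟨ht.1, ht.2.le⟩) hz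
    refine half_notMem_of_isLeast hw (t := 2 * t) ⟨by linarith [ht.1], by linarith [ht.2]⟩ ?_
    convert! this using 1
    push_cast
    ring
  · have h0 : Tendsto (fun t : ℝ => (t : ℂ) * u) (𝓝[>] 0) (𝓝[≠] 0) := by
      refine tendsto_nhdsWithin_iff.mpr ⟨?_, ?_⟩
      · have : Tendsto (fun t : ℝ => (t : ℂ) * u) (𝓝 0) (𝓝 (((0 : ℝ) : ℂ) * u)) :=
          Continuous.tendsto (by fun_prop) _
        simp only [Complex.ofReal_zero, zero_mul] at this
        exact this.mono_left nhdsWithin_le_nhds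
      · filter_upwards [self_mem_nhdsWithin] with t ht
        have : t ≠ 0 := ne_of_gt ht
        simp [this, hu0]
    have h1 := (Complex.continuous_re.tendsto _).comp (L.tendsto_weierstrassP_mul_sq.comp h0)
    rw [Complex.one_re] at h1
    have h2 : Tendsto (fun t : ℝ => (t ^ 2)⁻¹) (𝓝[>] 0) atTop := by
      refine tendsto_inv_nhdsGT_zero.comp (tendsto_nhdsWithin_iff.mpr ⟨?_, ?_⟩)
      · have : Tendsto (fun t : ℝ => t ^ 2) (𝓝 0) (𝓝 (0 ^ 2)) := Continuous.tendsto (by fun_prop) _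
        rw [zero_pow two_ne_zero] at this
        exact this.mono_left nhdsWithin_le_nhds
      · filter_upwards [self_mem_nhdsWithin] with t ht
        exact pow_pos (Set.mem_Ioi.mp ht) 2
    refine (h2.atTop_mul_pos one_pos h1).congr' ?_
    filter_upwards [self_mem_nhdsWithin] with t ht
    have ht0 : t ≠ 0 := ne_of_gt ht
    simp only [Function.comp]
    rw [hP t, mul_pow, hu, ← Complex.ofReal_pow, ← Complex.ofReal_mul, ← Complex.ofReal_mul,
      Complex.ofReal_re]
    simp only [Complex.ofReal_re]
    field_simp
  · intro t ht
    have hsq := L.derivWeierstrassP_sq _ (hnm t ht)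
    have hv := hval t
    have hσ4 : (σ : ℂ) ^ 4 = 1 := by rw [show 4 = 2 * 2 by norm_num, pow_mul, hσC, one_pow]
    rw [h2, h3] at hsq
    have key : (((σ * (L.derivWeierstrassP (t * u) * u).re) ^ 2 : ℝ) : ℂ) =
        ((4 * (σ * (L.weierstrassP (t * u)).re) ^ 3 - a * (σ * (L.weierstrassP (t * u)).re)
          - σ * b : ℝ) : ℂ) := by
      push_cast
      push_cast at hv
      rw [mul_pow, ← hP' t, hσC, one_mul, mul_pow, hu, hsq]
      generalize ((L.weierstrassP (t * u)).re : ℂ) = r at hv ⊢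
      rw [hv]
      linear_combination (4 * σ ^ 3 * r ^ 3 * (σ ^ 2 + 1) - a * σ * r) * hσC
    exact_mod_cast key

end PeriodPair

/-! ### The cubic of the flow -/

/-- The cubic `4 s³ - g₂ s - g₃`. -/
noncomputable def flowCubic (h C₀ s : ℝ) : ℝ := 4 * s ^ 3 - flowG2 h * s - flowG3 h C₀

section cubic

variable {h C₀ : ℝ}

/-- This form shows the value -C₀²/4 at h/4, which keeps ℘ - h/4 from vanishing on the real curve.
-/
lemma flowCubic_eq (s : ℝ) :
    flowCubic h C₀ s = (s - h / 4) ^ 2 * (4 * s + 2 * h) - C₀ ^ 2 / 4 := by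
  unfold flowCubic flowG2 flowG3; ring

/-- This form compares with the critical energy, where -h/4 is a double root and h/2 the remaining
one. -/
lemma flowCubic_eq' (s : ℝ) :
    flowCubic h C₀ s = (s + h / 4) ^ 2 * (4 * s - 2 * h) + (h ^ 3 - C₀ ^ 2) / 4 := by
  unfold flowCubic flowG2 flowG3; ring

lemma flowCubic_quarter_neg (hC : C₀ ≠ 0) : flowCubic h C₀ (h / 4) < 0 := by
  rw [flowCubic_eq]
  have : 0 < C₀ ^ 2 := by positivity
  nlinarith

lemma quarter_lt_of_flowCubic_nonneg (hh : 0 ≤ h) (hlt : h ^ 3 < C₀ ^ 2) {s : ℝ}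
    (hs : 0 ≤ flowCubic h C₀ s) : h / 4 < s := by
  by_contra! hle
  rw [flowCubic_eq'] at hs
  have : (s + h / 4) ^ 2 * (4 * s - 2 * h) ≤ 0 :=
    mul_nonpos_of_nonneg_of_nonpos (sq_nonneg _) (by linarith)
  linarith

lemma flowCubic_sub (s t : ℝ) : flowCubic h C₀ s - flowCubic h C₀ t =
    (s - t) * (4 * (s ^ 2 + s * t + t ^ 2) - 3 / 4 * h ^ 2) := by
  unfold flowCubic flowG2 flowG3; ring

/-- Together with `quarter_lt_of_flowCubic_nonneg` this makes the real root unique above the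
critical energy. -/
lemma flowCubic_lt_of_lt (hh : 0 ≤ h) {s t : ℝ} (hs : h / 4 < s) (hst : s < t) :
    flowCubic h C₀ s < flowCubic h C₀ t := by
  have h1 := flowCubic_sub (h := h) (C₀ := C₀) t s
  have h2 : 0 < 4 * (t ^ 2 + t * s + s ^ 2) - 3 / 4 * h ^ 2 := by nlinarith
  have := mul_pos (sub_pos.mpr hst) h2
  linarith

/-- There is no quadratic term, so the three roots sum to zero. -/
lemma flowCubic_factor {e E : ℝ} (hne : e ≠ E) (he : flowCubic h C₀ e = 0)
    (hE : flowCubic h C₀ E = 0) (s : ℝ) :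
    flowCubic h C₀ s = 4 * (s - e) * (s - E) * (s - (-(e + E))) := by
  have h1 := flowCubic_sub (h := h) (C₀ := C₀) e E
  rw [he, hE, sub_zero] at h1
  have h2 : 4 * (e ^ 2 + e * E + E ^ 2) - 3 / 4 * h ^ 2 = 0 :=
    (mul_eq_zero.mp h1.symm).resolve_left (sub_ne_zero.mpr hne)
  unfold flowCubic flowG2 at *
  linear_combination he + (s - e) * h2

end cubic

/-! ### The lattice of the flow: real curve, half periods, admissible shifts -/

section flow

variable {h C₀ : ℝ} {L : PeriodPair} {ω₁ : ℂ}

lemma IsFlowLattice.conjStable (hL : IsFlowLattice h C₀ L ω₁) : L.ConjStable :=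
  PeriodPair.conjStable_of_invariants_real hL.1 hL.2.1

lemma exists_isFlowLattice (hne : C₀ ≠ 0) (hC : C₀ ^ 2 ≠ h ^ 3) :
    ∃ (L : PeriodPair) (ω₁ : ℂ), IsFlowLattice h C₀ L ω₁ := by
  obtain ⟨L, h2, h3⟩ := PeriodPair.exists_of_invariants (a := flowG2 h) (b := flowG3 h C₀)
    (by unfold flowG2; positivity) (by
      -- The discriminant g₂³ - 27g₃² equals (27/16) C₀² (h³ - C₀²).
      intro heq
      have : C₀ ^ 2 * (C₀ ^ 2 - h ^ 3) = 0 := by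
        unfold flowG2 flowG3 at heq
        linear_combination -16 / 27 * heq
      rcases mul_eq_zero.mp this with e | e
      · exact hne (by simpa using e)
      · exact hC (sub_eq_zero.mp e))
  obtain ⟨ω, hω⟩ := (PeriodPair.conjStable_of_invariants_real h2 h3).exists_isImaginaryPeriod
  exact ⟨L, ω, h2, h3, hω⟩

lemma IsFlowLattice.derivWeierstrassP_sq (hL : IsFlowLattice h C₀ L ω₁) {z : ℂ}
    (hz : z ∉ L.lattice) {p : ℝ} (hp : L.weierstrassP z = p) :
    L.derivWeierstrassP z ^ 2 = (flowCubic h C₀ p : ℂ) := by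
  rw [L.derivWeierstrassP_sq z hz, hL.1, hL.2.1, hp]
  unfold flowCubic
  push_cast
  ring

lemma IsFlowLattice.flowCubic_half_period (hL : IsFlowLattice h C₀ L ω₁) {z : ℂ}
    (hz : z ∉ L.lattice) (h2 : 2 * z ∈ L.lattice) {p : ℝ} (hp : L.weierstrassP z = p) :
    flowCubic h C₀ p = 0 := by
  have := hL.derivWeierstrassP_sq hz hp
  rw [PeriodPair.derivWeierstrassP_eq_zero_of_two_mul_mem h2] at this
  have h' : ((flowCubic h C₀ p : ℝ) : ℂ) = 0 := by rw [← this]; simp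
  exact_mod_cast h'

lemma IsFlowLattice.half_notMem (hL : IsFlowLattice h C₀ L ω₁) : ω₁ / 2 ∉ L.lattice := by
  obtain ⟨e, hw⟩ := IsImaginaryPeriod.isLeast hL.2.2
  have := PeriodPair.half_notMem_of_isLeast hw (t := ω₁.im / 2)
    ⟨half_pos hL.2.2.2.2.1, half_lt_self hL.2.2.2.2.1⟩
  intro hm
  refine this ?_
  rw [e] at hm
  push_cast
  convert! hm using 1
  ring

lemma IsFlowLattice.conj_period (hL : IsFlowLattice h C₀ L ω₁) : (starRingEnd ℂ) ω₁ = -ω₁ := by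
  apply Complex.ext <;> simp [hL.2.2.2.1]

/-- On ℝ and on ℝ + ω₁/2 conjugation changes a point by 0 or by the period ω₁. These are thus lines
on which ℘ and ℘' are real. -/
lemma IsFlowLattice.conj_shift (hL : IsFlowLattice h C₀ L ω₁) {t₀ : ℂ}
    (ht₀ : IsAdmissibleShift ω₁ t₀) (t : ℝ) :
    (t + t₀) - (starRingEnd ℂ) (t + t₀) ∈ L.lattice := by
  rcases ht₀ with ⟨s, rfl⟩ | ⟨s, rfl⟩
  · simp
  · have := hL.2.2.1
    convert! this using 1
    simp only [map_add, Complex.conj_ofReal, map_div₀, hL.conj_period, map_ofNat]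
    ring

lemma IsFlowLattice.weierstrassP_real (hL : IsFlowLattice h C₀ L ω₁) {t₀ : ℂ}
    (ht₀ : IsAdmissibleShift ω₁ t₀) (t : ℝ) :
    L.weierstrassP (t + t₀) = ((L.weierstrassP (t + t₀)).re : ℂ) := by
  refine (Complex.conj_eq_iff_re.mp ?_).symm
  rw [← hL.conjStable.weierstrassP_conj,
    ← PeriodPair.weierstrassP_sub_mem (hL.conj_shift ht₀ t) (t + t₀), sub_sub_cancel]

lemma IsFlowLattice.derivWeierstrassP_real (hL : IsFlowLattice h C₀ L ω₁) {t₀ : ℂ}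
    (ht₀ : IsAdmissibleShift ω₁ t₀) (t : ℝ) :
    L.derivWeierstrassP (t + t₀) = ((L.derivWeierstrassP (t + t₀)).re : ℂ) := by
  refine (Complex.conj_eq_iff_re.mp ?_).symm
  rw [← hL.conjStable.derivWeierstrassP_conj,
    ← PeriodPair.derivWeierstrassP_sub_mem (hL.conj_shift ht₀ t) (t + t₀), sub_sub_cancel]

/-- Along the real axis `℘` decreases from `+∞` to a root `E > h / 4` at the half period. -/
lemma IsFlowLattice.real_axis (hL : IsFlowLattice h C₀ L ω₁) (hC : C₀ ≠ 0) :
    ∃ w E : ℝ, IsLeast {t | t ∈ L.linePeriods 1 ∧ 0 < t} w ∧ h / 4 < E ∧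
      L.weierstrassP ((w / 2 : ℝ) : ℂ) = E ∧
      (∀ P, E ≤ P → ∃ t ∈ Set.Ioc 0 (w / 2), L.weierstrassP (t : ℂ) = P) ∧
      ∫ s in Set.Ioi E, 1 / √(flowCubic h C₀ s) = w / 2 := by
  obtain ⟨w, hw⟩ := hL.conjStable.exists_isLeast_real
  have hv : 0 < w / 2 := half_pos hw.1.2
  obtain ⟨φ, φ', h1, h2, h3, h4, h5⟩ := hL.conjStable.exists_profile hL.1 hL.2.1 (u := 1) (σ := 1)
    (by simp) (by simp) (Or.inl (by simp)) hw
  have h5' : ∀ t ∈ Set.Ioc 0 (w / 2), φ' t ^ 2 = flowCubic h C₀ (φ t) := fun t ht => by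
    rw [h5 t ht, flowCubic, one_mul]
  have h1' : ∀ t : ℝ, L.weierstrassP (t : ℂ) = φ t := fun t => by simpa using h1 t
  refine ⟨w, φ (w / 2), hw, lt_of_profile hv h2 h3 h4 h5' (flowCubic_quarter_neg hC),
    h1' _, fun P hP => ?_, integral_one_div_sqrt_eq_of_profile hv h2 h3 h4 h5'⟩
  rcases hP.eq_or_lt with e | e
  · exact ⟨w / 2, ⟨hv, le_rfl⟩, by rw [h1', e]⟩
  · have : P ∈ φ '' Set.Ioo 0 (w / 2) := by
      rw [image_Ioo_eq_Ioi_of_tendsto_atTop hv h2 h3 h4]; exact e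
    obtain ⟨t, ht, rfl⟩ := this
    exact ⟨t, ⟨ht.1, ht.2.le⟩, h1' t⟩

/-- Below the critical energy `℘` increases along the imaginary axis from `-∞` to a root
`e < -h / 4` at the half period. -/
lemma IsFlowLattice.imaginary_axis (hL : IsFlowLattice h C₀ L ω₁) (hlt : C₀ ^ 2 < h ^ 3) :
    ∃ e : ℝ, e < -(h / 4) ∧ L.weierstrassP (ω₁ / 2) = e ∧
      ∫ s in Set.Iio e, 1 / √(flowG3 h C₀ + flowG2 h * s - 4 * s ^ 3) = ω₁.im / 2 := by
  obtain ⟨hω, hw⟩ := IsImaginaryPeriod.isLeast hL.2.2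
  have hv : 0 < ω₁.im / 2 := half_pos hw.1.2
  obtain ⟨φ, φ', h1, h2, h3, h4, h5⟩ := hL.conjStable.exists_profile hL.1 hL.2.1
    (u := Complex.I) (σ := -1) (by simp) (by simp) (Or.inr (by simp)) hw
  have h5' : ∀ t ∈ Set.Ioc 0 (ω₁.im / 2), φ' t ^ 2 = -flowCubic h C₀ (-φ t) := fun t ht => by
    rw [h5 t ht, flowCubic]; ring
  refine ⟨-φ (ω₁.im / 2), ?_, ?_, ?_⟩
  -- The test point h/4 belongs to the reflected cubic, whose value there is (C₀² - h³)/4 < 0.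
  · have := lt_of_profile hv h2 h3 h4 (q := fun s => -flowCubic h C₀ (-s)) h5' (c := h / 4) (by
      rw [flowCubic_eq', neg_add_cancel]
      linarith)
    linarith
  · have := h1 (ω₁.im / 2)
    rw [show ((ω₁.im / 2 : ℝ) : ℂ) * Complex.I = ω₁ / 2 by
      conv_rhs => rw [hω]
      push_cast; ring] at this
    rw [this]; push_cast; ring
  · refine Eq.trans ?_ (integral_one_div_sqrt_eq_of_profile hv h2 h3 h4
      (q := fun s => -flowCubic h C₀ (-s)) h5')
    rw [← MeasureTheory.integral_Iic_eq_integral_Iio, ← integral_comp_neg_Ioi]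
    refine MeasureTheory.setIntegral_congr_fun measurableSet_Ioi fun s _ => ?_
    simp only [flowCubic]
    ring_nf

/-- Above the critical energy the shifted line meets the lattice. -/
lemma IsFlowLattice.exists_pole (hL : IsFlowLattice h C₀ L ω₁) (hh : 0 ≤ h) (hC : C₀ ≠ 0)
    (hlt : h ^ 3 < C₀ ^ 2) {t₀ : ℂ} (ht₀ : IsAdmissibleShift ω₁ t₀) :
    ∃ a : ℝ, (a : ℂ) + t₀ ∈ L.lattice := by
  rcases ht₀ with ⟨s, rfl⟩ | ⟨s, rfl⟩
  · exact ⟨-s, by simp⟩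
  · obtain ⟨w, E, hw, -, hE, -, -⟩ := hL.real_axis hC
    have hw2 : ((w / 2 : ℝ) : ℂ) ∉ L.lattice := by
      simpa using PeriodPair.half_notMem_of_isLeast hw ⟨half_pos hw.1.2, half_lt_self hw.1.2⟩
    have hw2' : 2 * ((w / 2 : ℝ) : ℂ) ∈ L.lattice := by
      have := PeriodPair.mem_linePeriods.mp hw.1.1
      convert! this using 1
      push_cast; ring
    have hω2 : 2 * (ω₁ / 2) ∈ L.lattice := by
      rw [mul_div_cancel₀ _ two_ne_zero]; exact hL.2.2.1
    have hE0 := hL.flowCubic_half_period hw2 hw2' hE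
    have he := hL.weierstrassP_real (t₀ := ω₁ / 2) (Or.inr ⟨0, by simp⟩) 0
    rw [Complex.ofReal_zero, zero_add] at he
    set e := (L.weierstrassP (ω₁ / 2)).re
    have he0 := hL.flowCubic_half_period hL.half_notMem hω2 he
    -- The cubic has only one real root here, so ℘ agrees at ω₁/2 and at w/2, and these half periods
    -- are congruent modulo the lattice.
    have heE : e = E := by
      have h1 := quarter_lt_of_flowCubic_nonneg hh hlt he0.ge
      have h2 := quarter_lt_of_flowCubic_nonneg hh hlt hE0.ge
      rcases lt_trichotomy e E with hlt' | heq | hgt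
      · have := flowCubic_lt_of_lt (C₀ := C₀) hh h1 hlt'
        linarith
      · exact heq
      · have := flowCubic_lt_of_lt (C₀ := C₀) hh h2 hgt
        linarith
    have hm := PeriodPair.sub_mem_lattice_of_half_periods hL.half_notMem hw2 hω2 hw2'
      (by rw [he, hE, heE])
    refine ⟨-s - w / 2, ?_⟩
    convert! hm using 1
    push_cast; ring

/-- The real data of a flow lattice below the critical energy. -/
structure IsFlowLattice.Subcritical (h C₀ : ℝ) (L : PeriodPair) (ω₁ : ℂ) (w e₁ e₂ e₃ : ℝ) :
    Prop where
  isLeast : IsLeast {t | t ∈ L.linePeriods 1 ∧ 0 < t} w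
  lt₁₃ : e₁ < e₃
  lt₃₂ : e₃ < e₂
  factor : ∀ s, flowCubic h C₀ s = 4 * (s - e₁) * (s - e₂) * (s - e₃)
  notMem : ∀ s : ℝ, (s : ℂ) + ω₁ / 2 ∉ L.lattice
  imaginary_half : L.weierstrassP (ω₁ / 2) = e₁
  sum_half : L.weierstrassP ((w / 2 : ℝ) + ω₁ / 2) = e₃
  surj : ∀ P, e₂ ≤ P → ∃ t ∈ Set.Ioc 0 (w / 2), L.weierstrassP (t : ℂ) = P
  integral_real : ∫ s in Set.Ioi e₂, 1 / √(flowCubic h C₀ s) = w / 2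
  integral_imaginary :
    ∫ s in Set.Iio e₁, 1 / √(flowG3 h C₀ + flowG2 h * s - 4 * s ^ 3) = ω₁.im / 2

/-- The roots interlace with ±h/4 as e < -h/4 < e₃ < h/4 < E, because the cubic is positive at -h/4
and negative at h/4. Since ℘ takes different values at ω₁/2 and w/2, these half periods are
incongruent. -/
lemma IsFlowLattice.exists_subcritical (hL : IsFlowLattice h C₀ L ω₁) (hC : C₀ ≠ 0)
    (hlt : C₀ ^ 2 < h ^ 3) :
    ∃ w e₁ e₂ e₃ : ℝ, IsFlowLattice.Subcritical h C₀ L ω₁ w e₁ e₂ e₃ := by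
  obtain ⟨w, E, hw, hE4, hE, hsurj, hint⟩ := hL.real_axis hC
  obtain ⟨e, he4, he, hint'⟩ := hL.imaginary_axis hlt
  have hw2 : ((w / 2 : ℝ) : ℂ) ∉ L.lattice := by
    simpa using PeriodPair.half_notMem_of_isLeast hw ⟨half_pos hw.1.2, half_lt_self hw.1.2⟩
  have hwm : (w : ℂ) ∈ L.lattice := by simpa using PeriodPair.mem_linePeriods.mp hw.1.1
  have hw2' : 2 * ((w / 2 : ℝ) : ℂ) ∈ L.lattice := by
    convert! hwm using 1
    push_cast; ring
  have hω2 : 2 * (ω₁ / 2) ∈ L.lattice := by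
    rw [mul_div_cancel₀ _ two_ne_zero]; exact hL.2.2.1
  have hE0 := hL.flowCubic_half_period hw2 hw2' hE
  have he0 := hL.flowCubic_half_period hL.half_notMem hω2 he
  have hh : 0 < h := by
    have : 0 < h ^ 3 := lt_of_le_of_lt (sq_nonneg _) hlt
    exact (Odd.pow_pos_iff (by decide)).mp this
  have hne : e ≠ E := by
    intro h'
    linarith
  have hfac := flowCubic_factor hne he0 hE0
  set e₃ := -(e + E) with he₃
  have hq1 : e₃ < h / 4 := by
    have h1 := flowCubic_quarter_neg (h := h) hC
    rw [hfac] at h1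
    by_contra! hle
    have := mul_nonneg (mul_pos (by linarith : 0 < 4 * (h / 4 - e)) (sub_pos.mpr hE4)).le
      (sub_nonneg.mpr hle)
    nlinarith
  have hq2 : -(h / 4) < e₃ := by
    have h1 : 0 < flowCubic h C₀ (-(h / 4)) := by
      rw [flowCubic_eq', neg_add_cancel]
      linarith
    rw [hfac] at h1
    by_contra! hle
    have := mul_nonneg (mul_pos (by linarith : 0 < 4 * (-(h / 4) - e))
      (by linarith : 0 < E - -(h / 4))).le (sub_nonneg.mpr hle)
    nlinarith
  have hsum : ((w / 2 : ℝ) : ℂ) + ω₁ / 2 ∉ L.lattice := by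
    intro hm
    have h1 := PeriodPair.weierstrassP_sub_mem hm (ω₁ / 2)
    rw [show ω₁ / 2 - (((w / 2 : ℝ) : ℂ) + ω₁ / 2) = -((w / 2 : ℝ) : ℂ) by ring,
      L.weierstrassP_neg, hE, he] at h1
    exact hne (by exact_mod_cast h1.symm)
  -- A lattice point s + ω₁/2 yields the real period 2s = nw. For even n the half period ω₁/2 would
  -- lie in the lattice, for odd n the sum w/2 + ω₁/2.
  have hnm : ∀ s : ℝ, (s : ℂ) + ω₁ / 2 ∉ L.lattice := by
    intro s hs
    have h2s : ((2 * s : ℝ) : ℂ) * 1 ∈ L.lattice := by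
      have := sub_mem (add_mem hs hs) hL.2.2.1
      convert! this using 1
      push_cast; ring
    obtain ⟨n, hn⟩ := (PeriodPair.mem_linePeriods_iff_of_isLeast hw (2 * s)).mp h2s
    obtain ⟨k, hk | hk⟩ := Int.even_or_odd' n
    · refine hL.half_notMem ?_
      have := sub_mem hs (L.lattice.smul_mem k hwm)
      convert! this using 1
      have : s = k * w := by rw [hk] at hn; push_cast at hn; linarith
      rw [this, zsmul_eq_mul]; push_cast; ring
    · refine hsum ?_
      have := sub_mem hs (L.lattice.smul_mem k hwm)
      convert! this using 1
      have : s = k * w + w / 2 := by rw [hk] at hn; push_cast at hn; linarith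
      rw [this, zsmul_eq_mul]; push_cast; ring
  have hsum2 : 2 * (((w / 2 : ℝ) : ℂ) + ω₁ / 2) ∈ L.lattice := by
    rw [mul_add]; exact add_mem hw2' hω2
  have hreal := hL.weierstrassP_real (t₀ := ω₁ / 2) (Or.inr ⟨0, by simp⟩) (w / 2)
  -- The values e and E belong to the other two half periods, so injectivity leaves only the third
  -- root.
  have hval : L.weierstrassP ((w / 2 : ℝ) + ω₁ / 2) = e₃ := by
    have h0 := hL.flowCubic_half_period hsum hsum2 hreal
    set r := (L.weierstrassP ((w / 2 : ℝ) + ω₁ / 2)).re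
    rw [hfac] at h0
    rcases mul_eq_zero.mp h0 with h0 | h0
    · rcases mul_eq_zero.mp h0 with h0 | h0
      · exfalso
        have h1 : r = e := by linarith
        have := PeriodPair.sub_mem_lattice_of_half_periods hsum hL.half_notMem hsum2 hω2
          (by rw [hreal, he, h1])
        rw [add_sub_cancel_right] at this
        exact hw2 this
      · exfalso
        have h1 : r = E := by linarith
        have := PeriodPair.sub_mem_lattice_of_half_periods hsum hw2 hsum2 hw2'
          (by rw [hreal, hE, h1])
        rw [add_sub_cancel_left] at this
        exact hL.half_notMem this
    · rw [hreal, sub_eq_zero.mp h0]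
  exact ⟨w, e, E, e₃, hw, by linarith, by linarith, hfac, hnm, he, hval, hsurj, hint,
    hint'⟩

/-- Below the critical energy the lattice is rectangular. -/
lemma IsFlowLattice.Subcritical.lattice_eq {w e₁ e₂ e₃ : ℝ}
    (hS : IsFlowLattice.Subcritical h C₀ L ω₁ w e₁ e₂ e₃) (hL : IsFlowLattice h C₀ L ω₁) :
    L.lattice = Submodule.span ℤ {ω₁, (w : ℂ)} := by
  have hwm : (w : ℂ) ∈ L.lattice := by
    simpa using PeriodPair.mem_linePeriods.mp hS.isLeast.1.1
  obtain ⟨hω, hi⟩ := IsImaginaryPeriod.isLeast hL.2.2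
  apply le_antisymm
  · intro z hz
    have hzc := hL.conjStable z hz
    have h1 : ((2 * z.re : ℝ) : ℂ) * 1 ∈ L.lattice := by
      have := add_mem hz hzc
      rw [Complex.add_conj] at this
      simpa using this
    have h2 : ((2 * z.im : ℝ) : ℂ) * Complex.I ∈ L.lattice := by
      have := sub_mem hz hzc
      rwa [Complex.sub_conj] at this
    obtain ⟨m, hm⟩ := (PeriodPair.mem_linePeriods_iff_of_isLeast hS.isLeast _).mp h1
    obtain ⟨n, hn⟩ := (PeriodPair.mem_linePeriods_iff_of_isLeast hi _).mp h2
    have hz' : z = (m : ℂ) * w / 2 + n * ω₁ / 2 := by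
      apply Complex.ext
      · simp [hL.2.2.2.1]; linarith
      · simp; linarith
    have hω1 := hL.2.2.1
    rw [Submodule.mem_span_pair]
    simp only [zsmul_eq_mul]
    -- An odd n puts a lattice point on the shifted line; an even n with odd m puts w/2 in the
    -- lattice.
    obtain ⟨k, hk | hk⟩ := Int.even_or_odd' n
    · obtain ⟨j, hj | hj⟩ := Int.even_or_odd' m
      · exact ⟨k, j, by rw [hz', hk, hj]; push_cast; ring⟩
      · exfalso
        refine PeriodPair.half_notMem_of_isLeast hS.isLeast (t := w / 2)
          ⟨half_pos hS.isLeast.1.2, half_lt_self hS.isLeast.1.2⟩ ?_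
        have := sub_mem (sub_mem hz (L.lattice.smul_mem k hω1)) (L.lattice.smul_mem j hwm)
        convert! this using 1
        rw [hz', hk, hj, zsmul_eq_mul, zsmul_eq_mul]; push_cast; ring
    · exfalso
      refine hS.notMem (m * w / 2) ?_
      have := sub_mem hz (L.lattice.smul_mem k hω1)
      convert! this using 1
      rw [hz', hk, zsmul_eq_mul]; push_cast; ring
  · rw [Submodule.span_le]
    rintro z (rfl | rfl)
    · exact hL.2.2.1
    · exact hwm

/-- Every real point of the curve `Q² = 4 P³ - g₂ P - g₃` is `(℘, ℘')` at an admissible shift. -/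
lemma IsFlowLattice.exists_shift (hL : IsFlowLattice h C₀ L ω₁) (hh : 0 ≤ h) (hC : C₀ ≠ 0)
    (hne : C₀ ^ 2 ≠ h ^ 3) {P Q : ℝ} (hPQ : Q ^ 2 = flowCubic h C₀ P) :
    ∃ t₀ : ℂ, IsAdmissibleShift ω₁ t₀ ∧ t₀ ∉ L.lattice ∧ L.weierstrassP t₀ = P ∧
      L.derivWeierstrassP t₀ = Q := by
  have hq : 0 ≤ flowCubic h C₀ P := hPQ ▸ sq_nonneg Q
  have hreal : ∀ w : ℝ, IsLeast {t | t ∈ L.linePeriods 1 ∧ 0 < t} w →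
      (∃ t ∈ Set.Ioc 0 (w / 2), L.weierstrassP (t : ℂ) = P) →
      ∃ t₀ : ℂ, IsAdmissibleShift ω₁ t₀ ∧ t₀ ∉ L.lattice ∧ L.weierstrassP t₀ = P := by
    rintro w hw ⟨t, ht, htP⟩
    refine ⟨t, Or.inl ⟨t, rfl⟩, ?_, htP⟩
    simpa using PeriodPair.half_notMem_of_isLeast hw (t := t)
      ⟨ht.1, by linarith [ht.2, hw.1.2]⟩
  -- First P is matched: values from e₂ upwards occur on the real axis, and those in [e₁, e₃]
  -- between the half periods of the shifted line. Positivity of the cubic excludes all others.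
  have step : ∃ t₀ : ℂ, IsAdmissibleShift ω₁ t₀ ∧ t₀ ∉ L.lattice ∧ L.weierstrassP t₀ = P := by
    rcases lt_or_gt_of_ne hne with hlt | hgt
    · obtain ⟨w, e₁, e₂, e₃, hS⟩ := hL.exists_subcritical hC hlt
      by_cases hP : e₂ ≤ P
      · exact hreal w hS.isLeast (hS.surj P hP)
      · push Not at hP
        have hfac := hS.factor P
        have h13 := hS.lt₁₃
        have h32 := hS.lt₃₂
        have hle3 : P ≤ e₃ := by
          by_contra! hc
          have h1 : 0 < 4 * (P - e₁) * (e₂ - P) * (P - e₃) :=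
            mul_pos (mul_pos (by linarith) (by linarith)) (by linarith)
          linarith
        have hle1 : e₁ ≤ P := by
          by_contra! hc
          have h1 : 0 < 4 * (e₁ - P) * (e₂ - P) * (e₃ - P) :=
            mul_pos (mul_pos (by linarith) (by linarith)) (by linarith)
          linarith
        have hcont : ContinuousOn (fun s : ℝ => (L.weierstrassP (s + ω₁ / 2)).re)
            (Set.Icc 0 (w / 2)) := by
          intro s _
          have h1 : ContinuousAt (fun s : ℝ => (s : ℂ) + ω₁ / 2) s := by fun_prop
          exact (Complex.continuous_re.continuousAt.comp
            ((PeriodPair.hasDerivAt_weierstrassP (hS.notMem s)).continuousAt.comp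
              (f := fun s : ℝ => (s : ℂ) + ω₁ / 2) h1)).continuousWithinAt
        have hw2 : 0 ≤ w / 2 := (half_pos hS.isLeast.1.2).le
        have hPm : P ∈ Set.Icc (L.weierstrassP ((0 : ℝ) + ω₁ / 2)).re
            (L.weierstrassP ((w / 2 : ℝ) + ω₁ / 2)).re := ⟨by
          simpa [hS.imaginary_half] using hle1, by
          simpa only [hS.sum_half, Complex.ofReal_re] using hle3⟩
        obtain ⟨s, -, hs⟩ := intermediate_value_Icc hw2 hcont hPm
        refine ⟨s + ω₁ / 2, Or.inr ⟨s, rfl⟩, hS.notMem s, ?_⟩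
        rw [hL.weierstrassP_real (t₀ := ω₁ / 2) (Or.inr ⟨0, by simp⟩) s]
        exact_mod_cast hs
    · obtain ⟨w, E, hw, hE4, hE, hsurj, -⟩ := hL.real_axis hC
      refine hreal w hw (hsurj P ?_)
      by_contra! hc
      have hw2 : ((w / 2 : ℝ) : ℂ) ∉ L.lattice := by
        simpa using PeriodPair.half_notMem_of_isLeast hw ⟨half_pos hw.1.2, half_lt_self hw.1.2⟩
      have hw2' : 2 * ((w / 2 : ℝ) : ℂ) ∈ L.lattice := by
        have := PeriodPair.mem_linePeriods.mp hw.1.1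
        convert! this using 1
        push_cast; ring
      have hE0 := hL.flowCubic_half_period hw2 hw2' hE
      have := flowCubic_lt_of_lt (C₀ := C₀) hh (quarter_lt_of_flowCubic_nonneg hh hgt hq) hc
      linarith
  obtain ⟨t₀, hadm, hnm, hP⟩ := step
  have hsq := hL.derivWeierstrassP_sq hnm hP
  -- Now ℘' is known up to sign, and t₀ ↦ -t₀ corrects it. On the shifted line the reflected point
  -- is brought back by adding ω₁.
  rw [← hPQ, Complex.ofReal_pow, sq_eq_sq_iff_eq_or_eq_neg] at hsq
  rcases hsq with hsq | hsq
  · exact ⟨t₀, hadm, hnm, hP, hsq⟩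
  · rcases hadm with ⟨s, hs⟩ | ⟨s, hs⟩
    · refine ⟨-t₀, Or.inl ⟨-s, by rw [hs]; push_cast; ring⟩, by simpa using hnm,
        by rw [L.weierstrassP_neg, hP], by rw [L.derivWeierstrassP_neg, hsq, neg_neg]⟩
    · have hω : -t₀ - (-ω₁) = ((-s : ℝ) : ℂ) + ω₁ / 2 := by rw [hs]; push_cast; ring
      have hm := neg_mem hL.2.2.1
      refine ⟨-t₀ - (-ω₁), Or.inr ⟨-s, hω⟩, ?_, ?_, ?_⟩
      · intro hc
        have := neg_mem (add_mem hc hm)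
        simp only [sub_add_cancel, neg_neg] at this
        exact hnm this
      · rw [PeriodPair.weierstrassP_sub_mem hm, L.weierstrassP_neg, hP]
      · rw [PeriodPair.derivWeierstrassP_sub_mem hm, L.derivWeierstrassP_neg, hsq, neg_neg]

end flow

/-! ### Hamilton's equations: energy, uniqueness, continuation -/

section hamilton

variable {h : ℝ}

lemma deriv_p0_snd (h a b : ℝ) : deriv (fun η => p0 h a η) b = a * b := by
  have : HasDerivAt (fun η => p0 h a η) (a * b) b := by
    unfold p0
    convert! ((((hasDerivAt_id b).pow 2).const_add (a ^ 2)).const_mul (1 / 2 * a)).sub_const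
      (3 / 2 * h * a) using 1
    simp
    ring
  exact this.deriv

lemma deriv_p0_fst (h a b : ℝ) :
    deriv (fun y => p0 h y b) a = 3 / 2 * a ^ 2 + 1 / 2 * b ^ 2 - 3 / 2 * h := by
  have : HasDerivAt (fun y => p0 h y b) (3 / 2 * a ^ 2 + 1 / 2 * b ^ 2 - 3 / 2 * h) a := by
    unfold p0
    convert! (((hasDerivAt_id a).const_mul (1 / 2)).mul
      (((hasDerivAt_id a).pow 2).add_const (b ^ 2))).sub
      ((hasDerivAt_id a).const_mul (3 / 2 * h)) using 1
    simp
    ring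
  exact this.deriv

lemma isHamiltonTrajectory_iff {I : Set ℝ} {x ξ : ℝ → ℝ} :
    IsHamiltonTrajectory (p0 h) I x ξ ↔ ∀ t ∈ I, HasDerivAt x (x t * ξ t) t ∧
      HasDerivAt ξ (-(3 / 2 * x t ^ 2 + 1 / 2 * ξ t ^ 2 - 3 / 2 * h)) t := by
  simp only [IsHamiltonTrajectory, deriv_p0_snd, deriv_p0_fst]

lemma isStationaryPoint_iff (hh : 0 ≤ h) (a b : ℝ) : IsStationaryPoint (p0 h) a b ↔
    (a = 0 ∧ (b = √(3 * h) ∨ b = -√(3 * h))) ∨ ((a = √h ∨ a = -√h) ∧ b = 0) := by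
  have h1 : √(3 * h) ^ 2 = 3 * h := Real.sq_sqrt (by linarith)
  have h2 : √h ^ 2 = h := Real.sq_sqrt hh
  rw [IsStationaryPoint, deriv_p0_snd, deriv_p0_fst, mul_eq_zero]
  constructor
  · rintro ⟨rfl | rfl, h3⟩
    · exact Or.inl ⟨rfl, sq_eq_sq_iff_eq_or_eq_neg.mp (by linarith)⟩
    · exact Or.inr ⟨sq_eq_sq_iff_eq_or_eq_neg.mp (by linarith), rfl⟩
  · rintro (⟨rfl, rfl | rfl⟩ | ⟨rfl | rfl, rfl⟩)
    · exact ⟨Or.inl rfl, by linarith⟩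
    · exact ⟨Or.inl rfl, by rw [neg_sq]; linarith⟩
    · exact ⟨Or.inr rfl, by linarith⟩
    · exact ⟨Or.inr rfl, by rw [neg_sq]; linarith⟩

/-- Conservation of energy. -/
lemma IsHamiltonTrajectory.isEnergyTrajectory {I : Set ℝ} {x ξ : ℝ → ℝ} {C₀ : ℝ} (hI : IsOpen I)
    (hc : I.OrdConnected) (hx : IsHamiltonTrajectory (p0 h) I x ξ)
    (hτ : ∃ τ ∈ I, p0 h (x τ) (ξ τ) = C₀) : IsEnergyTrajectory h C₀ I x ξ := by
  refine ⟨hx, fun t ht => ?_⟩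
  obtain ⟨τ, hτI, rfl⟩ := hτ
  rw [isHamiltonTrajectory_iff] at hx
  have hd : ∀ t ∈ I, HasDerivAt (fun t => p0 h (x t) (ξ t)) 0 t := by
    intro t ht
    obtain ⟨h1, h2⟩ := hx t ht
    unfold p0
    convert! ((h1.const_mul (1 / 2)).mul ((h1.pow 2).add (h2.pow 2))).sub
      (h1.const_mul (3 / 2 * h)) using 1
    simp
    ring
  exact hI.is_const_of_deriv_eq_zero hc.isPreconnected
    (fun t ht => (hd t ht).differentiableAt.differentiableWithinAt)
    (fun t ht => (hd t ht).deriv) ht hτI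

/-- The Hamilton vector field. -/
noncomputable def hamiltonField (h : ℝ) (p : ℝ × ℝ) : ℝ × ℝ :=
  (p.1 * p.2, -(3 / 2 * p.1 ^ 2 + 1 / 2 * p.2 ^ 2 - 3 / 2 * h))

/-- The field is quadratic and so only locally Lipschitz; uniqueness is obtained near one time and
spread by connectedness in `eqOn_of_blowup`. -/
lemma IsHamiltonTrajectory.eventually_eq {I J : Set ℝ} {x ξ X Ξ : ℝ → ℝ} (hI : IsOpen I)
    (hJ : IsOpen J) (hx : IsHamiltonTrajectory (p0 h) I x ξ)
    (hX : IsHamiltonTrajectory (p0 h) J X Ξ) {τ : ℝ} (hτI : τ ∈ I) (hτJ : τ ∈ J)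
    (h1 : x τ = X τ) (h2 : ξ τ = Ξ τ) : ∀ᶠ t in 𝓝 τ, x t = X t ∧ ξ t = Ξ t := by
  have hsm : ContDiff ℝ 1 (hamiltonField h) := by
    unfold hamiltonField
    fun_prop
  obtain ⟨K, s, hs, hK⟩ := hsm.contDiffAt.exists_lipschitzOnWith (x := (x τ, ξ τ))
  rw [isHamiltonTrajectory_iff] at hx hX
  have key : ∀ {I : Set ℝ} {y η : ℝ → ℝ}, IsOpen I → τ ∈ I → (y τ, η τ) = (x τ, ξ τ) →
      (∀ t ∈ I, HasDerivAt y (y t * η t) t ∧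
        HasDerivAt η (-(3 / 2 * y t ^ 2 + 1 / 2 * η t ^ 2 - 3 / 2 * h)) t) →
      ∀ᶠ t in 𝓝 τ, HasDerivAt (fun t => (y t, η t)) (hamiltonField h (y t, η t)) t ∧
        (y t, η t) ∈ s := by
    intro I y η hI hτ he hy
    have hcont : ContinuousAt (fun t => (y t, η t)) τ :=
      (hy τ hτ).1.continuousAt.prodMk (hy τ hτ).2.continuousAt
    filter_upwards [hI.mem_nhds hτ, hcont.preimage_mem_nhds (he ▸ hs)] with t ht hts
    exact ⟨(hy t ht).1.prodMk (hy t ht).2, hts⟩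
  have := ODE_solution_unique_of_eventually (v := fun _ => hamiltonField h) (s := fun _ => s)
    (Eventually.of_forall fun _ => hK) (key hI hτI rfl hx) (key hJ hτJ (by rw [h1, h2]) hX)
    (by rw [h1, h2])
  filter_upwards [this] with t ht
  exact ⟨congrArg Prod.fst ht, congrArg Prod.snd ht⟩

/-- A trajectory that meets an explicit one, which blows up at the ends of its domain, is a part
of it. -/
lemma IsHamiltonTrajectory.eqOn_of_blowup {I R : Set ℝ} {x ξ X Ξ : ℝ → ℝ} (hI : IsOpen I)
    (hc : I.OrdConnected) (hR : IsOpen R) (hx : IsHamiltonTrajectory (p0 h) I x ξ)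
    (hX : IsHamiltonTrajectory (p0 h) R X Ξ)
    (hblow : ∀ a ∉ R, Tendsto (fun t => |Ξ t|) (𝓝[≠] a) atTop) {τ : ℝ} (hτI : τ ∈ I)
    (hτR : τ ∈ R) (h1 : x τ = X τ) (h2 : ξ τ = Ξ τ) :
    ∀ t ∈ I, t ∈ R ∧ x t = X t ∧ ξ t = Ξ t := by
  set u : Set ℝ := {t | t ∈ I ∧ t ∈ R ∧ x t = X t ∧ ξ t = Ξ t} with hu
  have huo : IsOpen u := by
    rw [isOpen_iff_mem_nhds]
    rintro t ⟨htI, htR, e1, e2⟩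
    filter_upwards [hI.mem_nhds htI, hR.mem_nhds htR,
      hx.eventually_eq hI hR hX htI htR e1 e2] with s hsI hsR hs using ⟨hsI, hsR, hs⟩
  have hx' := isHamiltonTrajectory_iff.mp hx
  have hX' := isHamiltonTrajectory_iff.mp hX
  -- The coincidence set is open, and it is closed in I: at a limit point outside R the explicit
  -- momentum is unbounded, whereas ξ is continuous there.
  have hsub : I ⊆ u := by
    refine hc.isPreconnected.subset_of_closure_inter_subset huo ⟨τ, hτI, hτI, hτR, h1, h2⟩ ?_
    rintro t ⟨htu, htI⟩
    have : (𝓝[u] t).NeBot := mem_closure_iff_nhdsWithin_neBot.mp htu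
    have hcx : Tendsto x (𝓝[u] t) (𝓝 (x t)) :=
      (hx' t htI).1.continuousAt.tendsto.mono_left nhdsWithin_le_nhds
    have hcξ : Tendsto ξ (𝓝[u] t) (𝓝 (ξ t)) :=
      (hx' t htI).2.continuousAt.tendsto.mono_left nhdsWithin_le_nhds
    have htR : t ∈ R := by
      by_contra htR
      have hle : 𝓝[u] t ≤ 𝓝[≠] t := nhdsWithin_mono t fun s hs hst => by
        rw [Set.mem_singleton_iff] at hst
        rw [hst] at hs
        exact htR hs.2.1
      refine not_tendsto_nhds_of_tendsto_atTop ((hblow t htR).mono_left hle) _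
        (hcξ.abs.congr' ?_)
      filter_upwards [self_mem_nhdsWithin] with s hs
      rw [hs.2.2.2]
    refine ⟨htI, htR, ?_, ?_⟩
    · refine tendsto_nhds_unique (hcx.congr' ?_)
        ((hX' t htR).1.continuousAt.tendsto.mono_left nhdsWithin_le_nhds)
      filter_upwards [self_mem_nhdsWithin] with s hs using hs.2.2.1
    · refine tendsto_nhds_unique (hcξ.congr' ?_)
        ((hX' t htR).2.continuousAt.tendsto.mono_left nhdsWithin_le_nhds)
      filter_upwards [self_mem_nhdsWithin] with s hs using hs.2.2.2
  exact fun t ht => (hsub ht).2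

end hamilton

/-! ### The formula on a line where ℘ is real -/

section formula

variable {P : ℂ → ℂ} {S : Set ℂ} {h C₀ : ℝ} {t₀ : ℂ}

/-- On the line `ℝ + t₀` the function `P` is real, satisfies the Weierstrass equations off `S`,
and has double poles in `S`. -/
structure IsRealWeierstrassLine (P : ℂ → ℂ) (S : Set ℂ) (h C₀ : ℝ) (t₀ : ℂ) : Prop where
  isClosed : IsClosed S
  hasDerivAt : ∀ t : ℝ, (t : ℂ) + t₀ ∉ S → HasDerivAt P (deriv P (t + t₀)) (t + t₀)
  hasDerivAt_deriv : ∀ t : ℝ, (t : ℂ) + t₀ ∉ S →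
    HasDerivAt (deriv P) (6 * P (t + t₀) ^ 2 - flowG2 h / 2) (t + t₀)
  cubic : ∀ t : ℝ, (t : ℂ) + t₀ ∉ S →
    deriv P (t + t₀) ^ 2 = 4 * P (t + t₀) ^ 3 - flowG2 h * P (t + t₀) - flowG3 h C₀
  real : ∀ t : ℝ, P (t + t₀) = ((P (t + t₀)).re : ℂ)
  deriv_real : ∀ t : ℝ, deriv P (t + t₀) = ((deriv P (t + t₀)).re : ℂ)
  tendsto : ∀ l ∈ S, Tendsto (fun z => P z * (z - l) ^ 2) (𝓝[≠] l) (𝓝 1)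
  tendsto_deriv : ∀ l ∈ S, Tendsto (fun z => deriv P z * (z - l) ^ 3) (𝓝[≠] l) (𝓝 (-2))

/-- The position given by the formula. -/
noncomputable def formulaX (P : ℂ → ℂ) (h C₀ : ℝ) (t₀ : ℂ) (t : ℝ) : ℝ :=
  1 / 2 * C₀ * ((P (t + t₀)).re - h / 4)⁻¹

/-- The momentum given by the formula. -/
noncomputable def formulaXi (P : ℂ → ℂ) (h : ℝ) (t₀ : ℂ) (t : ℝ) : ℝ :=
  -(deriv P (t + t₀)).re / ((P (t + t₀)).re - h / 4)

lemma formula_mul {t : ℝ} (hD : (P (t + t₀)).re - h / 4 ≠ 0) :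
    formulaX P h C₀ t₀ t * ((P (t + t₀)).re - h / 4) = C₀ / 2 ∧
      formulaXi P h t₀ t * ((P (t + t₀)).re - h / 4) = -(deriv P (t + t₀)).re := by
  constructor
  · rw [formulaX, inv_mul_cancel_right₀ hD]
    ring
  · rw [formulaXi, div_mul_cancel₀ _ hD]

lemma hasDerivAt_re_comp_line {f : ℂ → ℂ} {f' : ℂ} {t : ℝ} (hf : HasDerivAt f f' (t + t₀)) :
    HasDerivAt (fun t : ℝ => (f (t + t₀)).re) f'.re t :=
  Complex.reCLM.hasFDerivAt.comp_hasDerivAt t (hf.comp_add_const (t : ℂ) t₀).comp_ofReal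

namespace IsRealWeierstrassLine

lemma re_cubic (hP : IsRealWeierstrassLine P S h C₀ t₀) {t : ℝ} (ht : (t : ℂ) + t₀ ∉ S) :
    (deriv P (t + t₀)).re ^ 2 = flowCubic h C₀ (P (t + t₀)).re := by
  have := hP.cubic t ht
  rw [hP.real t, hP.deriv_real t] at this
  unfold flowCubic
  exact_mod_cast this

lemma ne_quarter (hP : IsRealWeierstrassLine P S h C₀ t₀) (hC : C₀ ≠ 0) {t : ℝ}
    (ht : (t : ℂ) + t₀ ∉ S) : (P (t + t₀)).re - h / 4 ≠ 0 := by
  intro h0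
  have h1 := hP.re_cubic ht
  rw [sub_eq_zero.mp h0] at h1
  have := flowCubic_quarter_neg (h := h) hC
  rw [← h1] at this
  exact absurd (sq_nonneg _) (not_le.mpr this)

/-- With D = ℘ - h/4 the formula reads XD = C₀/2, ΞD = -℘'. The equation for x is then a logarithmic
derivative, and the one for ξ combines ℘'' = 6℘² - g₂/2 with the cubic. -/
lemma isEnergyTrajectory (hP : IsRealWeierstrassLine P S h C₀ t₀) (hC : C₀ ≠ 0) :
    IsEnergyTrajectory h C₀ (regularTimes S t₀) (formulaX P h C₀ t₀) (formulaXi P h t₀) := by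
  constructor
  · rw [isHamiltonTrajectory_iff]
    intro t ht
    have hD := hP.ne_quarter hC ht
    have h1 : HasDerivAt (fun t : ℝ => (P (t + t₀)).re - h / 4) (deriv P (t + t₀)).re t :=
      (hasDerivAt_re_comp_line (hP.hasDerivAt t ht)).sub_const _
    have h2 := hasDerivAt_re_comp_line (hP.hasDerivAt_deriv t ht)
    have e : (6 * P (t + t₀) ^ 2 - (flowG2 h : ℂ) / 2).re =
        6 * (P (t + t₀)).re ^ 2 - flowG2 h / 2 := by
      rw [hP.real t]
      have : (6 * (((P (t + t₀)).re : ℝ) : ℂ) ^ 2 - (flowG2 h : ℂ) / 2) =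
        ((6 * (P (t + t₀)).re ^ 2 - flowG2 h / 2 : ℝ) : ℂ) := by push_cast; ring
      rw [this, Complex.ofReal_re, Complex.ofReal_re]
    rw [e] at h2
    have hq := hP.re_cubic ht
    rw [flowCubic_eq] at hq
    constructor
    · have := (h1.inv hD).const_mul (1 / 2 * C₀)
      convert! this using 1
      simp only [formulaX, formulaXi]
      field_simp
    · have := h2.neg.div h1 hD
      convert! this using 1
      obtain ⟨hX, hΞ⟩ := formula_mul (C₀ := C₀) hD
      simp only [flowG2, Pi.neg_apply]
      rw [eq_div_iff (pow_ne_zero 2 hD)]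
      linear_combination -3 / 2 * (formulaX P h C₀ t₀ t * ((P (t + t₀)).re - h / 4) + C₀ / 2) * hX
        - 1 / 2 * (formulaXi P h t₀ t * ((P (t + t₀)).re - h / 4) - (deriv P (t + t₀)).re) * hΞ
        - 3 / 2 * hq
  · intro t ht
    have hD := hP.ne_quarter hC ht
    have hq := hP.re_cubic ht
    rw [flowCubic_eq] at hq
    obtain ⟨hX, hΞ⟩ := formula_mul (C₀ := C₀) hD
    -- This is the cubic divided by D². Multiplied by X/2 it gives the energy as 2XD = C₀.
    have h4 : formulaX P h C₀ t₀ t ^ 2 + formulaXi P h t₀ t ^ 2 - 3 * h =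
        4 * ((P (t + t₀)).re - h / 4) := mul_right_cancel₀ (pow_ne_zero 2 hD) (by
      linear_combination (formulaX P h C₀ t₀ t * ((P (t + t₀)).re - h / 4) + C₀ / 2) * hX
        + (formulaXi P h t₀ t * ((P (t + t₀)).re - h / 4) - (deriv P (t + t₀)).re) * hΞ + hq)
    rw [p0]
    linear_combination formulaX P h C₀ t₀ t / 2 * h4 + 2 * hX

lemma followsFormula (hP : IsRealWeierstrassLine P S h C₀ t₀) (hC : C₀ ≠ 0) {I : Set ℝ}
    {x ξ : ℝ → ℝ} (hx : IsHamiltonTrajectory (p0 h) I x ξ)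
    (he : ∀ t ∈ I, t ∈ regularTimes S t₀ ∧ x t = formulaX P h C₀ t₀ t ∧
      ξ t = formulaXi P h t₀ t) : FollowsFormula P S h C₀ t₀ I x ξ := by
  intro t ht
  obtain ⟨hS, h1, h2⟩ := he t ht
  have hD := hP.ne_quarter hC hS
  have hx0 : x t ≠ 0 := by
    rw [h1, formulaX]
    exact mul_ne_zero (mul_ne_zero (by norm_num) hC) (inv_ne_zero hD)
  refine ⟨hS, ?_, ?_, ?_, hx0, ?_⟩
  · rw [hP.real t]
    exact_mod_cast hD
  · rw [h1, hP.real t, formulaX]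
    push_cast
    rfl
  · rw [h2, hP.real t, hP.deriv_real t, formulaXi]
    push_cast
    rfl
  · rw [((isHamiltonTrajectory_iff.mp hx) t ht).1.deriv]
    field_simp

/-- At a double pole of ℘ the quotient -℘'/(℘ - h/4) has a simple pole of residue 2. The positive
residue decides both one-sided limits. -/
lemma tendsto_mul_formulaXi (hP : IsRealWeierstrassLine P S h C₀ t₀) {a : ℝ}
    (ha : (a : ℂ) + t₀ ∈ S) :
    Tendsto (fun t => (t - a) * formulaXi P h t₀ t) (𝓝[≠] a) (𝓝 2) := by
  set l := (a : ℂ) + t₀ with hl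
  have h1 := hP.tendsto l ha
  have h2 := hP.tendsto_deriv l ha
  have h0 : Tendsto (fun z : ℂ => (h : ℂ) / 4 * (z - l) ^ 2) (𝓝[≠] l) (𝓝 0) := by
    have : Tendsto (fun z : ℂ => (h : ℂ) / 4 * (z - l) ^ 2) (𝓝 l) (𝓝 ((h : ℂ) / 4 * (l - l) ^ 2)) :=
      Continuous.tendsto (by fun_prop) _
    rw [sub_self, zero_pow two_ne_zero, mul_zero] at this
    exact this.mono_left nhdsWithin_le_nhds
  have h3 := h2.neg.div (h1.sub h0) (by simp)
  rw [neg_neg, sub_zero, div_one] at h3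
  have hline : Tendsto (fun t : ℝ => (t : ℂ) + t₀) (𝓝[≠] a) (𝓝[≠] l) := by
    refine ContinuousWithinAt.tendsto_nhdsWithin
      (Continuous.continuousWithinAt (by fun_prop)) fun t ht => ?_
    simpa [hl] using ht
  have h4 := (Complex.continuous_re.tendsto _).comp (h3.comp hline)
  rw [Complex.re_ofNat] at h4
  refine h4.congr' ?_
  filter_upwards [self_mem_nhdsWithin] with t ht
  have hta : t - a ≠ 0 := sub_ne_zero.mpr ht
  have hta' : ((t - a : ℝ) : ℂ) ≠ 0 := by exact_mod_cast hta
  have hz : (t : ℂ) + t₀ - l = ((t - a : ℝ) : ℂ) := by rw [hl]; push_cast; ring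
  simp only [Function.comp, Pi.div_apply]
  rw [hz, hP.real t, hP.deriv_real t, formulaXi]
  norm_cast
  by_cases hD : (P (t + t₀)).re - h / 4 = 0
  · rw [hD, div_zero, mul_zero]
    have : (P (t + t₀)).re * (t - a) ^ 2 - h / 4 * (t - a) ^ 2 = 0 := by
      rw [← sub_mul, hD, zero_mul]
    rw [this, div_zero]
  · rw [← sub_mul]
    field_simp

lemma blowsUpAtPoles (hP : IsRealWeierstrassLine P S h C₀ t₀) :
    BlowsUpAtPoles S t₀ (formulaXi P h t₀) := by
  intro a ha
  have h1 := hP.tendsto_mul_formulaXi ha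
  have hsub : Tendsto (fun t : ℝ => t - a) (𝓝 a) (𝓝 0) := by
    have : Tendsto (fun t : ℝ => t - a) (𝓝 a) (𝓝 (a - a)) := Continuous.tendsto (by fun_prop) _
    rwa [sub_self] at this
  constructor
  · have h2 : Tendsto (fun t : ℝ => (t - a)⁻¹) (𝓝[>] a) atTop := by
      refine tendsto_inv_nhdsGT_zero.comp (tendsto_nhdsWithin_iff.mpr
        ⟨hsub.mono_left nhdsWithin_le_nhds, ?_⟩)
      filter_upwards [self_mem_nhdsWithin] with t ht
      exact sub_pos.mpr (Set.mem_Ioi.mp ht)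
    refine (h2.atTop_mul_pos two_pos (h1.mono_left
      (nhdsWithin_mono _ fun t ht => ne_of_gt ht))).congr' ?_
    filter_upwards [self_mem_nhdsWithin] with t ht
    have : t - a ≠ 0 := (sub_pos.mpr (Set.mem_Ioi.mp ht)).ne'
    field_simp
  · have h2 : Tendsto (fun t : ℝ => (t - a)⁻¹) (𝓝[<] a) atBot := by
      refine tendsto_inv_nhdsLT_zero.comp (tendsto_nhdsWithin_iff.mpr
        ⟨hsub.mono_left nhdsWithin_le_nhds, ?_⟩)
      filter_upwards [self_mem_nhdsWithin] with t ht
      exact sub_neg.mpr (Set.mem_Iio.mp ht)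
    refine (h2.atBot_mul_pos two_pos (h1.mono_left
      (nhdsWithin_mono _ fun t ht => ne_of_lt ht))).congr' ?_
    filter_upwards [self_mem_nhdsWithin] with t ht
    have : t - a ≠ 0 := (sub_neg.mpr (Set.mem_Iio.mp ht)).ne
    field_simp

lemma isOpen_regularTimes (hP : IsRealWeierstrassLine P S h C₀ t₀) :
    IsOpen (regularTimes S t₀) :=
  hP.isClosed.isOpen_compl.preimage (f := fun t : ℝ => (t : ℂ) + t₀) (by fun_prop)

/-- The formula defines a trajectory, which blows up at the poles. -/
lemma exists_trajectory (hP : IsRealWeierstrassLine P S h C₀ t₀) (hC : C₀ ≠ 0) :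
    FollowsFormula P S h C₀ t₀ (regularTimes S t₀) (formulaX P h C₀ t₀) (formulaXi P h t₀) ∧
      IsEnergyTrajectory h C₀ (regularTimes S t₀) (formulaX P h C₀ t₀) (formulaXi P h t₀) ∧
      BlowsUpAtPoles S t₀ (formulaXi P h t₀) :=
  ⟨hP.followsFormula hC (hP.isEnergyTrajectory hC).1 fun _ ht => ⟨ht, rfl, rfl⟩,
    hP.isEnergyTrajectory hC, hP.blowsUpAtPoles⟩

/-- A trajectory that agrees with the formula at one time follows it. -/
lemma followsFormula_of_eq (hP : IsRealWeierstrassLine P S h C₀ t₀) (hC : C₀ ≠ 0) {I : Set ℝ}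
    {x ξ : ℝ → ℝ} (hI : IsOpen I) (hc : I.OrdConnected)
    (hx : IsHamiltonTrajectory (p0 h) I x ξ) {τ : ℝ} (hτ : τ ∈ I)
    (hτS : (τ : ℂ) + t₀ ∉ S) (h1 : x τ = formulaX P h C₀ t₀ τ)
    (h2 : ξ τ = formulaXi P h t₀ τ) : FollowsFormula P S h C₀ t₀ I x ξ := by
  refine hP.followsFormula hC hx (hx.eqOn_of_blowup hI hc hP.isOpen_regularTimes
    (hP.isEnergyTrajectory hC).1 (fun a ha => ?_) hτ hτS h1 h2)
  have ha' : (a : ℂ) + t₀ ∈ S := by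
    by_contra hn
    exact ha hn
  obtain ⟨hr, hl⟩ := hP.blowsUpAtPoles a ha'
  rw [← nhdsLT_sup_nhdsGT, tendsto_sup]
  exact ⟨tendsto_abs_atBot_atTop.comp hl, tendsto_abs_atTop_atTop.comp hr⟩

end IsRealWeierstrassLine

/-- A point of nonzero energy corresponds to a point of the curve `Q² = 4 P³ - g₂ P - g₃`. -/
lemma exists_curve_point (hC : C₀ ≠ 0) {a b : ℝ} (hab : p0 h a b = C₀) :
    ∃ p q : ℝ, q ^ 2 = flowCubic h C₀ p ∧ p - h / 4 ≠ 0 ∧ a = 1 / 2 * C₀ * (p - h / 4)⁻¹ ∧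
      b = -q / (p - h / 4) := by
  have ha : a ≠ 0 := by
    rintro rfl
    apply hC
    rw [← hab, p0]
    ring
  -- The formulas for a and b are solved for p, then q.
  refine ⟨C₀ / (2 * a) + h / 4, -b * C₀ / (2 * a), ?_, ?_, ?_, ?_⟩
  · rw [flowCubic_eq]
    have h1 : C₀ / (2 * a) = (a ^ 2 + b ^ 2 - 3 * h) / 4 := by
      rw [← hab, p0]
      field_simp
      ring
    have h2 : 4 * (C₀ / (2 * a) + h / 4) + 2 * h = a ^ 2 + b ^ 2 := by rw [h1]; ring
    rw [h2]
    field_simp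
    ring
  · rw [add_sub_cancel_right]
    positivity
  · rw [add_sub_cancel_right]
    field_simp
  · rw [add_sub_cancel_right]
    field_simp

end formula

/-! ### Flow lattices as instances of the formula -/

section weierstrass

variable {h C₀ : ℝ} {L : PeriodPair} {ω₁ : ℂ}

lemma IsFlowLattice.isRealWeierstrassLine (hL : IsFlowLattice h C₀ L ω₁) {t₀ : ℂ}
    (ht₀ : IsAdmissibleShift ω₁ t₀) :
    IsRealWeierstrassLine L.weierstrassP L.lattice h C₀ t₀ where
  isClosed := L.isClosed_lattice
  hasDerivAt t ht := by
    rw [L.deriv_weierstrassP]; exact PeriodPair.hasDerivAt_weierstrassP ht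
  hasDerivAt_deriv t ht := by
    rw [L.deriv_weierstrassP, ← hL.1]; exact PeriodPair.hasDerivAt_derivWeierstrassP ht
  cubic t ht := by
    rw [L.deriv_weierstrassP, ← hL.1, ← hL.2.1]; exact L.derivWeierstrassP_sq _ ht
  real t := hL.weierstrassP_real ht₀ t
  deriv_real t := by rw [L.deriv_weierstrassP]; exact hL.derivWeierstrassP_real ht₀ t
  tendsto l hl := (L.tendsto_weierstrassP_mul_sq.comp (PeriodPair.tendsto_sub_punctured l)).congr
    fun z => by simp only [Function.comp, PeriodPair.weierstrassP_sub_mem hl]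
  tendsto_deriv l hl := by
    rw [L.deriv_weierstrassP]
    exact (L.tendsto_derivWeierstrassP_mul_cube.comp (PeriodPair.tendsto_sub_punctured l)).congr
      fun z => by simp only [Function.comp, PeriodPair.derivWeierstrassP_sub_mem hl]

/-- The discriminant of a flow lattice does not vanish. -/
lemma IsFlowLattice.sq_ne (hL : IsFlowLattice h C₀ L ω₁) : C₀ ^ 2 ≠ h ^ 3 := by
  intro hC
  have h1 : 2 * (L.ω₁ / 2) ∈ L.lattice := by
    rw [mul_div_cancel₀ _ two_ne_zero]; exact L.ω₁_mem_lattice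
  have h2 : 2 * (L.ω₂ / 2) ∈ L.lattice := by
    rw [mul_div_cancel₀ _ two_ne_zero]; exact L.ω₂_mem_lattice
  have n1 := L.ω₁_div_two_notMem_lattice
  have n2 := L.ω₂_div_two_notMem_lattice
  have n3 := PeriodPair.ω₁_div_two_sub_ω₂_div_two_notMem (L := L)
  have h3 : 2 * (L.ω₁ / 2 - L.ω₂ / 2) ∈ L.lattice := by
    rw [mul_sub]; exact sub_mem h1 h2
  have d12 : L.weierstrassP (L.ω₁ / 2) ≠ L.weierstrassP (L.ω₂ / 2) :=
    PeriodPair.weierstrassP_half_periods_ne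
  have d13 : L.weierstrassP (L.ω₁ / 2 - L.ω₂ / 2) ≠ L.weierstrassP (L.ω₁ / 2) := fun e => by
    have := PeriodPair.sub_mem_lattice_of_half_periods n3 n1 h3 h1 e
    rw [sub_sub_cancel_left] at this
    exact n2 (by simpa using neg_mem this)
  have d23 : L.weierstrassP (L.ω₁ / 2 - L.ω₂ / 2) ≠ L.weierstrassP (L.ω₂ / 2) := fun e => by
    have := PeriodPair.sub_mem_lattice_of_half_periods n3 n2 h3 h2 e
    refine n1 ?_
    have := add_mem this L.ω₂_mem_lattice
    convert! this using 1
    ring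
  -- At the critical energy the cubic is 4(s + h/4)²(s - h/2). Its two root values cannot serve
  -- three half periods with pairwise distinct ℘.
  have root : ∀ a : ℂ, a ∉ L.lattice → 2 * a ∈ L.lattice →
      L.weierstrassP a = -(h / 4) ∨ L.weierstrassP a = h / 2 := by
    intro a ha ha2
    have := PeriodPair.cubic_eq_zero_of_half_period ha ha2
    rw [hL.1, hL.2.1] at this
    have hC' : (C₀ : ℂ) ^ 2 = (h : ℂ) ^ 3 := by exact_mod_cast hC
    have e : (L.weierstrassP a - -(h / 4)) ^ 2 * (L.weierstrassP a - h / 2) = 0 := by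
      simp only [flowG2, flowG3] at this
      push_cast at this
      linear_combination this / 4 + 1 / 16 * hC'
    rcases mul_eq_zero.mp e with e | e
    · exact Or.inl (sub_eq_zero.mp (pow_eq_zero_iff two_ne_zero |>.mp e))
    · exact Or.inr (sub_eq_zero.mp e)
  rcases root _ n1 h1 with r1 | r1 <;> rcases root _ n2 h2 with r2 | r2 <;>
    rcases root _ n3 h3 with r3 | r3
  all_goals first
    | exact d12 (r1.trans r2.symm)
    | exact d13 (r3.trans r1.symm)
    | exact d23 (r3.trans r2.symm)

end weierstrass

/-! ### The critical energy: the trigonometric degeneration -/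

section degenerate

variable {h : ℝ}

/-- With k = √(3h)/2 one has h = 4k²/3 and `degenerateP` is -k²/3 + k²/sin²(kz), so its differential
equations become identities in k, sin and cos. -/
lemma degenerate_rate_sq (hh : 0 < h) :
    ((Real.sqrt (3 * h) / 2 : ℝ) : ℂ) ^ 2 = 3 * h / 4 := by
  have : (Real.sqrt (3 * h) / 2) ^ 2 = 3 * h / 4 := by
    rw [div_pow, Real.sq_sqrt (by linarith)]; norm_num
  rw [← Complex.ofReal_pow, this]
  push_cast
  ring

lemma degenerate_rate_pos (hh : 0 < h) : 0 < Real.sqrt (3 * h) / 2 := by positivity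

lemma hasDerivAt_sin_mul (k z : ℂ) :
    HasDerivAt (fun z => Complex.sin (k * z)) (k * Complex.cos (k * z)) z := by
  have := (Complex.hasDerivAt_sin (k * z)).comp z ((hasDerivAt_id z).const_mul k)
  simpa [mul_comm] using! this

lemma hasDerivAt_cos_mul (k z : ℂ) :
    HasDerivAt (fun z => Complex.cos (k * z)) (-k * Complex.sin (k * z)) z := by
  have := (Complex.hasDerivAt_cos (k * z)).comp z ((hasDerivAt_id z).const_mul k)
  simpa [mul_comm] using! this

lemma hasDerivAt_degenerateP (hh : 0 < h) {z : ℂ} (hz : z ∉ degeneratePoles h) :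
    HasDerivAt (degenerateP h) (-2 * ((Real.sqrt (3 * h) / 2 : ℝ) : ℂ) ^ 3 *
      Complex.cos ((Real.sqrt (3 * h) / 2 : ℝ) * z) /
        Complex.sin ((Real.sqrt (3 * h) / 2 : ℝ) * z) ^ 3) z := by
  have hk := degenerate_rate_sq hh
  unfold degenerateP
  simp only [degeneratePoles, Set.mem_ofPred_eq] at hz
  set k : ℂ := ((Real.sqrt (3 * h) / 2 : ℝ) : ℂ)
  have := (((hasDerivAt_const z (3 * (h : ℂ) / 4)).div ((hasDerivAt_sin_mul k z).pow 2)
    (pow_ne_zero 2 hz))).const_add (-(h : ℂ) / 4)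
  convert! this using 1
  rw [← hk]
  simp only [Pi.pow_apply, Nat.cast_ofNat]
  field_simp
  ring

lemma isClosed_degeneratePoles : IsClosed (degeneratePoles h) :=
  isClosed_eq (by fun_prop) continuous_const

lemma deriv_degenerateP (hh : 0 < h) {z : ℂ} (hz : z ∉ degeneratePoles h) :
    deriv (degenerateP h) z = -2 * ((Real.sqrt (3 * h) / 2 : ℝ) : ℂ) ^ 3 *
      Complex.cos ((Real.sqrt (3 * h) / 2 : ℝ) * z) /
        Complex.sin ((Real.sqrt (3 * h) / 2 : ℝ) * z) ^ 3 := (hasDerivAt_degenerateP hh hz).deriv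

lemma hasDerivAt_deriv_degenerateP (hh : 0 < h) {z : ℂ} (hz : z ∉ degeneratePoles h) :
    HasDerivAt (deriv (degenerateP h)) (6 * degenerateP h z ^ 2 - flowG2 h / 2) z := by
  have hev : deriv (degenerateP h) =ᶠ[𝓝 z] fun z => -2 * ((Real.sqrt (3 * h) / 2 : ℝ) : ℂ) ^ 3 *
      Complex.cos ((Real.sqrt (3 * h) / 2 : ℝ) * z) /
        Complex.sin ((Real.sqrt (3 * h) / 2 : ℝ) * z) ^ 3 := by
    filter_upwards [isClosed_degeneratePoles.isOpen_compl.mem_nhds hz] with w hw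
    exact deriv_degenerateP hh hw
  refine HasDerivAt.congr_of_eventuallyEq ?_ hev
  have hk := degenerate_rate_sq hh
  simp only [degeneratePoles, Set.mem_ofPred_eq] at hz
  unfold degenerateP flowG2
  set k : ℂ := ((Real.sqrt (3 * h) / 2 : ℝ) : ℂ)
  have := (((hasDerivAt_cos_mul k z).const_mul (-2 * k ^ 3)).div ((hasDerivAt_sin_mul k z).pow 3)
    (pow_ne_zero 3 hz))
  convert! this using 1
  have hh' : (h : ℂ) = 4 * k ^ 2 / 3 := by rw [hk]; ring
  have hcs := Complex.sin_sq_add_cos_sq (k * z)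
  push_cast
  rw [hh']
  simp only [Pi.pow_apply]
  generalize Complex.sin (k * z) = s at *
  generalize Complex.cos (k * z) = c at *
  have hc : c ^ 2 = 1 - s ^ 2 := by linear_combination hcs
  field_simp
  ring_nf
  rw [hc]
  ring

lemma degenerateP_cubic (hh : 0 < h) {C₀ : ℝ} (hC : C₀ ^ 2 = h ^ 3) {z : ℂ}
    (hz : z ∉ degeneratePoles h) : deriv (degenerateP h) z ^ 2 =
      4 * degenerateP h z ^ 3 - flowG2 h * degenerateP h z - flowG3 h C₀ := by
  rw [deriv_degenerateP hh hz]
  have hk := degenerate_rate_sq hh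
  simp only [degeneratePoles, Set.mem_ofPred_eq] at hz
  unfold degenerateP flowG2 flowG3
  rw [hC]
  set k : ℂ := ((Real.sqrt (3 * h) / 2 : ℝ) : ℂ)
  have hh' : (h : ℂ) = 4 * k ^ 2 / 3 := by rw [hk]; ring
  have hcs := Complex.sin_sq_add_cos_sq (k * z)
  push_cast
  rw [hh']
  generalize Complex.sin (k * z) = s at *
  generalize Complex.cos (k * z) = c at *
  have hc : c ^ 2 = 1 - s ^ 2 := by linear_combination hcs
  field_simp
  ring_nf
  rw [hc]
  ring

lemma tendsto_sin_mul_div {k l : ℂ} (hl : Complex.sin (k * l) = 0) :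
    Tendsto (fun z => Complex.sin (k * z) / (z - l)) (𝓝[≠] l) (𝓝 (k * Complex.cos (k * l))) := by
  have := hasDerivAt_iff_tendsto_slope.mp (hasDerivAt_sin_mul k l)
  refine this.congr fun z => ?_
  rw [slope_def_field, hl, sub_zero]

/-- At a zero l of sin(kz) the quotient sin(kz)/(z - l) tends to k cos(kl), and cos²(kl) = 1, so
every pole has the same leading coefficient. -/
lemma tendsto_degenerateP_mul_sq (hh : 0 < h) {l : ℂ} (hl : l ∈ degeneratePoles h) :
    Tendsto (fun z => degenerateP h z * (z - l) ^ 2) (𝓝[≠] l) (𝓝 1) := by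
  have hk := degenerate_rate_sq hh
  have hk0 : ((Real.sqrt (3 * h) / 2 : ℝ) : ℂ) ≠ 0 := by
    exact_mod_cast (degenerate_rate_pos hh).ne'
  simp only [degeneratePoles, Set.mem_ofPred_eq] at hl
  unfold degenerateP
  set k : ℂ := ((Real.sqrt (3 * h) / 2 : ℝ) : ℂ)
  have hc2 : Complex.cos (k * l) ^ 2 = 1 := by
    have := Complex.sin_sq_add_cos_sq (k * l)
    rw [hl] at this
    simpa using this
  have hc0 : Complex.cos (k * l) ≠ 0 := by
    intro h0; rw [h0] at hc2; norm_num at hc2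
  have h0 : Tendsto (fun z : ℂ => -(h : ℂ) / 4 * (z - l) ^ 2) (𝓝[≠] l) (𝓝 0) := by
    have : Tendsto (fun z : ℂ => -(h : ℂ) / 4 * (z - l) ^ 2) (𝓝 l)
        (𝓝 (-(h : ℂ) / 4 * (l - l) ^ 2)) := Continuous.tendsto (by fun_prop) _
    rw [sub_self, zero_pow two_ne_zero, mul_zero] at this
    exact this.mono_left nhdsWithin_le_nhds
  have h1 := h0.add ((tendsto_const_nhds (x := k ^ 2)).div ((tendsto_sin_mul_div hl).pow 2)
    (pow_ne_zero 2 (mul_ne_zero hk0 hc0)))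
  have e : 0 + k ^ 2 / (k * Complex.cos (k * l)) ^ 2 = 1 := by
    rw [mul_pow, hc2]; field_simp; simp
  rw [e] at h1
  refine h1.congr' ?_
  filter_upwards [self_mem_nhdsWithin] with z hz
  have : z - l ≠ 0 := sub_ne_zero.mpr hz
  simp only [Pi.div_apply, ← hk, div_pow]
  rw [add_mul]
  congr 1
  rw [div_div_eq_mul_div, div_mul_eq_mul_div]

lemma tendsto_deriv_degenerateP_mul_cube (hh : 0 < h) {l : ℂ} (hl : l ∈ degeneratePoles h) :
    Tendsto (fun z => deriv (degenerateP h) z * (z - l) ^ 3) (𝓝[≠] l) (𝓝 (-2)) := by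
  have hk0 : ((Real.sqrt (3 * h) / 2 : ℝ) : ℂ) ≠ 0 := by
    exact_mod_cast (degenerate_rate_pos hh).ne'
  simp only [degeneratePoles, Set.mem_ofPred_eq] at hl
  have hd : ∀ z : ℂ, Complex.sin ((Real.sqrt (3 * h) / 2 : ℝ) * z) ≠ 0 →
      deriv (degenerateP h) z = -2 * ((Real.sqrt (3 * h) / 2 : ℝ) : ℂ) ^ 3 *
        Complex.cos ((Real.sqrt (3 * h) / 2 : ℝ) * z) /
        Complex.sin ((Real.sqrt (3 * h) / 2 : ℝ) * z) ^ 3 := fun z hz => deriv_degenerateP hh hz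
  set k : ℂ := ((Real.sqrt (3 * h) / 2 : ℝ) : ℂ)
  have hc2 : Complex.cos (k * l) ^ 2 = 1 := by
    have := Complex.sin_sq_add_cos_sq (k * l)
    rw [hl] at this
    simpa using this
  have hc0 : Complex.cos (k * l) ≠ 0 := by
    intro h0; rw [h0] at hc2; norm_num at hc2
  have hcos : Tendsto (fun z : ℂ => -2 * k ^ 3 * Complex.cos (k * z)) (𝓝[≠] l)
      (𝓝 (-2 * k ^ 3 * Complex.cos (k * l))) :=
    (Continuous.tendsto (by fun_prop) _).mono_left nhdsWithin_le_nhds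
  have hs := tendsto_sin_mul_div hl
  have h1 := hcos.div (hs.pow 3) (pow_ne_zero 3 (mul_ne_zero hk0 hc0))
  have e : -2 * k ^ 3 * Complex.cos (k * l) / (k * Complex.cos (k * l)) ^ 3 = -2 := by
    rw [mul_pow, pow_succ (Complex.cos (k * l)) 2, hc2]; field_simp
  rw [e] at h1
  refine h1.congr' ?_
  filter_upwards [self_mem_nhdsWithin, hs.eventually_ne (mul_ne_zero hk0 hc0)] with z hz hz2
  have hzl : z - l ≠ 0 := sub_ne_zero.mpr hz
  have hsz : Complex.sin (k * z) ≠ 0 := fun h0 => hz2 (by rw [h0, zero_div])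
  rw [hd z hsz]
  simp only [Pi.div_apply, div_pow]
  field_simp

lemma degenerateP_conj (h : ℝ) (z : ℂ) :
    (starRingEnd ℂ) (degenerateP h z) = degenerateP h ((starRingEnd ℂ) z) := by
  simp only [degenerateP, map_add, map_div₀, map_neg, map_mul, map_pow, Complex.conj_ofReal,
    ← Complex.sin_conj, map_ofNat]

lemma deriv_degenerateP_conj (h : ℝ) (z : ℂ) :
    (starRingEnd ℂ) (deriv (degenerateP h) z) = deriv (degenerateP h) ((starRingEnd ℂ) z) := by
  have h1 : (starRingEnd ℂ) ∘ degenerateP h ∘ (starRingEnd ℂ) = degenerateP h := by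
    ext z
    simp [degenerateP_conj]
  have h2 := congrFun (deriv_conj_conj (f := degenerateP h)) ((starRingEnd ℂ) z)
  rw [h1] at h2
  rw [h2]
  simp

lemma isRealWeierstrassLine_degenerateP (hh : 0 < h) {C₀ : ℝ} (hC : C₀ ^ 2 = h ^ 3) (s : ℝ) :
    IsRealWeierstrassLine (degenerateP h) (degeneratePoles h) h C₀ s where
  isClosed := isClosed_degeneratePoles
  hasDerivAt t ht := (hasDerivAt_degenerateP hh ht).differentiableAt.hasDerivAt
  hasDerivAt_deriv t ht := hasDerivAt_deriv_degenerateP hh ht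
  cubic t ht := degenerateP_cubic hh hC ht
  real t := by
    refine (Complex.conj_eq_iff_re.mp ?_).symm
    rw [degenerateP_conj, map_add, Complex.conj_ofReal, Complex.conj_ofReal]
  deriv_real t := by
    refine (Complex.conj_eq_iff_re.mp ?_).symm
    rw [deriv_degenerateP_conj, map_add, Complex.conj_ofReal, Complex.conj_ofReal]
  tendsto l hl := tendsto_degenerateP_mul_sq hh hl
  tendsto_deriv l hl := tendsto_deriv_degenerateP_mul_cube hh hl

/-- The points of the nodal curve other than the node are `(P, P')` at real arguments. -/
lemma exists_degenerateP_eq (hh : 0 < h) {C₀ : ℝ} (hC : C₀ ^ 2 = h ^ 3) {p q : ℝ}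
    (hpq : q ^ 2 = flowCubic h C₀ p) (hp : p ≠ -(h / 4)) :
    ∃ s : ℝ, (s : ℂ) ∉ degeneratePoles h ∧ degenerateP h s = p ∧
      deriv (degenerateP h) s = q := by
  have hk2 : (Real.sqrt (3 * h) / 2) ^ 2 = 3 * h / 4 := by
    rw [div_pow, Real.sq_sqrt (by linarith)]; norm_num
  have hkpos := degenerate_rate_pos hh
  have hp2 : h / 2 ≤ p := by
    have h1 : 0 ≤ flowCubic h C₀ p := hpq ▸ sq_nonneg q
    rw [flowCubic_eq', hC, sub_self, zero_div, add_zero] at h1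
    have h2 : 0 < (p + h / 4) ^ 2 := by
      have : p + h / 4 ≠ 0 := fun h0 => hp (by linarith)
      positivity
    have := nonneg_of_mul_nonneg_right h1 h2
    linarith
  have hP4 : 0 < p + h / 4 := by linarith
  set y := √(3 * h / 4 / (p + h / 4)) with hy
  have hy2 : y ^ 2 = 3 * h / 4 / (p + h / 4) := Real.sq_sqrt (by positivity)
  have hy0 : 0 < y := by positivity
  have hy1 : y ≤ 1 := by
    rw [hy, Real.sqrt_le_iff, one_pow, div_le_one hP4]
    exact ⟨one_pos.le, by linarith⟩
  set s := Real.arcsin y / (Real.sqrt (3 * h) / 2) with hs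
  have hsin : Complex.sin ((Real.sqrt (3 * h) / 2 : ℝ) * (s : ℂ)) = (y : ℂ) := by
    rw [← Complex.ofReal_mul, ← Complex.ofReal_sin, hs, mul_div_cancel₀ _ hkpos.ne',
      Real.sin_arcsin (by linarith) hy1]
  have hsS : (s : ℂ) ∉ degeneratePoles h := by
    rw [degeneratePoles, Set.mem_ofPred_eq, hsin]
    exact_mod_cast hy0.ne'
  have hsS' : -(s : ℂ) ∉ degeneratePoles h := by
    rw [degeneratePoles, Set.mem_ofPred_eq, mul_neg, Complex.sin_neg, hsin, neg_eq_zero]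
    exact_mod_cast hy0.ne'
  have hval : degenerateP h s = p := by
    rw [degenerateP, hsin]
    have : -h / 4 + 3 * h / 4 / y ^ 2 = p := by
      rw [hy2]; field_simp; ring
    exact_mod_cast this
  have hsq := degenerateP_cubic hh hC hsS
  rw [hval] at hsq
  have hsq' : deriv (degenerateP h) s ^ 2 = (q : ℂ) ^ 2 := by
    rw [hsq, ← Complex.ofReal_pow q, hpq, flowCubic]
    push_cast
    ring
  -- The sign of the derivative is adjusted by s ↦ -s, as `degenerateP` is even.
  rcases sq_eq_sq_iff_eq_or_eq_neg.mp hsq' with e | e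
  · exact ⟨s, hsS, hval, e⟩
  · refine ⟨-s, by simpa using hsS', ?_, ?_⟩
    · rw [← hval]
      simp [degenerateP]
    · rw [deriv_degenerateP hh hsS] at e
      rw [Complex.ofReal_neg, deriv_degenerateP hh hsS', mul_neg, Complex.sin_neg, Complex.cos_neg,
        Odd.neg_pow (by decide), div_neg, e, neg_neg]

end degenerate

/-! ### Zero energy: the axis and the circle -/

section zero_energy

variable {h : ℝ}

lemma isEnergyTrajectory_of_eqOn {C₀ : ℝ} {I : Set ℝ} {x ξ X Ξ : ℝ → ℝ} (hI : IsOpen I)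
    (hX : IsEnergyTrajectory h C₀ I X Ξ) (he : ∀ t ∈ I, x t = X t ∧ ξ t = Ξ t) :
    IsEnergyTrajectory h C₀ I x ξ := by
  refine ⟨?_, fun t ht => by rw [(he t ht).1, (he t ht).2]; exact hX.2 t ht⟩
  have h1 := isHamiltonTrajectory_iff.mp hX.1
  rw [isHamiltonTrajectory_iff]
  intro t ht
  have hx : x =ᶠ[𝓝 t] X := by filter_upwards [hI.mem_nhds ht] with s hs using (he s hs).1
  have hξ : ξ =ᶠ[𝓝 t] Ξ := by filter_upwards [hI.mem_nhds ht] with s hs using (he s hs).2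
  rw [(he t ht).1, (he t ht).2]
  exact ⟨(h1 t ht).1.congr_of_eventuallyEq hx, (h1 t ht).2.congr_of_eventuallyEq hξ⟩

lemma hasDerivAt_cosh_line (r c t : ℝ) :
    HasDerivAt (fun t => Real.cosh (r * (t + c))) (r * Real.sinh (r * (t + c))) t := by
  have := (Real.hasDerivAt_cosh (r * (t + c))).comp t
    (((hasDerivAt_id t).add_const c).const_mul r)
  simpa [mul_comm] using! this

lemma hasDerivAt_sinh_line (r c t : ℝ) :
    HasDerivAt (fun t => Real.sinh (r * (t + c))) (r * Real.cosh (r * (t + c))) t := by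
  have := (Real.hasDerivAt_sinh (r * (t + c))).comp t
    (((hasDerivAt_id t).add_const c).const_mul r)
  simpa [mul_comm] using! this

/-- The momentum of the unbounded trajectory on the axis `x = 0`. -/
noncomputable def cothXi (h t₀ t : ℝ) : ℝ := √(3 * h) *
  (Real.cosh (√(3 * h) / 2 * (t + t₀)) / Real.sinh (√(3 * h) / 2 * (t + t₀)))

/-- The momentum of the bounded trajectory on the axis `x = 0`. -/
noncomputable def tanhXi (h t₀ t : ℝ) : ℝ := √(3 * h) * Real.tanh (√(3 * h) / 2 * (t + t₀))

/-- The position on the circle `x² + ξ² = 3 h`. -/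
noncomputable def sechX (h ε t₀ t : ℝ) : ℝ :=
  ε * √(3 * h) * (1 / Real.cosh (√(3 * h) * (t + t₀)))

/-- The momentum on the circle `x² + ξ² = 3 h`. -/
noncomputable def sechXi (h t₀ t : ℝ) : ℝ := -√(3 * h) * Real.tanh (√(3 * h) * (t + t₀))

lemma isOpen_coth_domain (t₀ : ℝ) : IsOpen {t : ℝ | t + t₀ ≠ 0} :=
  isOpen_ne_fun (by fun_prop) continuous_const

lemma isEnergyTrajectory_coth (hh : 0 < h) (t₀ : ℝ) :
    IsEnergyTrajectory h 0 {t | t + t₀ ≠ 0} (fun _ => 0) (cothXi h t₀) := by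
  have hr : √(3 * h) ^ 2 = 3 * h := Real.sq_sqrt (by linarith)
  have hr0 : 0 < √(3 * h) := by positivity
  refine ⟨?_, fun t _ => by simp [p0]⟩
  rw [isHamiltonTrajectory_iff]
  intro t ht
  have hs0 : Real.sinh (√(3 * h) / 2 * (t + t₀)) ≠ 0 := by
    rw [ne_eq, Real.sinh_eq_zero]
    exact mul_ne_zero (by positivity) ht
  refine ⟨by simpa using hasDerivAt_const t (0 : ℝ), ?_⟩
  have := ((hasDerivAt_cosh_line (√(3 * h) / 2) t₀ t).div
    (hasDerivAt_sinh_line (√(3 * h) / 2) t₀ t) hs0).const_mul √(3 * h)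
  unfold cothXi
  convert! this using 1
  have hcs := Real.cosh_sq (√(3 * h) / 2 * (t + t₀))
  have hh' : h = √(3 * h) ^ 2 / 3 := by rw [hr]; ring
  generalize Real.cosh (√(3 * h) / 2 * (t + t₀)) = c at *
  generalize Real.sinh (√(3 * h) / 2 * (t + t₀)) = s at *
  generalize √(3 * h) = r at *
  rw [hh']
  field_simp
  ring_nf

lemma isEnergyTrajectory_tanh (hh : 0 < h) (t₀ : ℝ) :
    IsEnergyTrajectory h 0 Set.univ (fun _ => 0) (tanhXi h t₀) := by
  have hr : √(3 * h) ^ 2 = 3 * h := Real.sq_sqrt (by linarith)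
  refine ⟨?_, fun t _ => by simp [p0]⟩
  rw [isHamiltonTrajectory_iff]
  intro t _
  have hc0 : Real.cosh (√(3 * h) / 2 * (t + t₀)) ≠ 0 := (Real.cosh_pos _).ne'
  refine ⟨by simpa using hasDerivAt_const t (0 : ℝ), ?_⟩
  have := ((hasDerivAt_sinh_line (√(3 * h) / 2) t₀ t).div
    (hasDerivAt_cosh_line (√(3 * h) / 2) t₀ t) hc0).const_mul √(3 * h)
  unfold tanhXi
  simp only [Real.tanh_eq_sinh_div_cosh]
  convert! this using 1
  have hh' : h = √(3 * h) ^ 2 / 3 := by rw [hr]; ring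
  generalize Real.cosh (√(3 * h) / 2 * (t + t₀)) = c at *
  generalize Real.sinh (√(3 * h) / 2 * (t + t₀)) = s at *
  generalize √(3 * h) = r at *
  rw [hh']
  field_simp
  ring_nf

lemma isEnergyTrajectory_sech (hh : 0 < h) {ε : ℝ} (hε : ε = 1 ∨ ε = -1) (t₀ : ℝ) :
    IsEnergyTrajectory h 0 Set.univ (sechX h ε t₀) (sechXi h t₀) := by
  have hr : √(3 * h) ^ 2 = 3 * h := Real.sq_sqrt (by linarith)
  have hε2 : ε ^ 2 = 1 := by rcases hε with rfl | rfl <;> norm_num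
  have hh' : h = √(3 * h) ^ 2 / 3 := by rw [hr]; ring
  refine ⟨?_, fun t _ => ?_⟩
  · rw [isHamiltonTrajectory_iff]
    intro t _
    have hc0 : Real.cosh (√(3 * h) * (t + t₀)) ≠ 0 := (Real.cosh_pos _).ne'
    have hcs := Real.cosh_sq (√(3 * h) * (t + t₀))
    constructor
    · have := ((hasDerivAt_const t (1 : ℝ)).div
        (hasDerivAt_cosh_line √(3 * h) t₀ t) hc0).const_mul (ε * √(3 * h))
      unfold sechX sechXi
      simp only [Real.tanh_eq_sinh_div_cosh]
      convert! this using 1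
      field_simp
      ring
    · have := ((hasDerivAt_sinh_line √(3 * h) t₀ t).div
        (hasDerivAt_cosh_line √(3 * h) t₀ t) hc0).const_mul (-√(3 * h))
      unfold sechX sechXi
      simp only [Real.tanh_eq_sinh_div_cosh]
      convert! this using 1
      generalize Real.cosh (√(3 * h) * (t + t₀)) = c at *
      generalize Real.sinh (√(3 * h) * (t + t₀)) = s at *
      generalize √(3 * h) = r at *
      have hs : s ^ 2 = c ^ 2 - 1 := by linarith
      rw [hh']
      field_simp
      rw [hε2, hs]
      ring
  · have hc0 : Real.cosh (√(3 * h) * (t + t₀)) ≠ 0 := (Real.cosh_pos _).ne'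
    have hcs := Real.cosh_sq (√(3 * h) * (t + t₀))
    unfold p0 sechX sechXi
    simp only [Real.tanh_eq_sinh_div_cosh]
    generalize Real.cosh (√(3 * h) * (t + t₀)) = c at *
    generalize Real.sinh (√(3 * h) * (t + t₀)) = s at *
    generalize √(3 * h) = r at *
    have hs : s ^ 2 = c ^ 2 - 1 := by linarith
    rw [hh']
    field_simp
    rw [hε2, hs]
    ring

/-- Since cosh ≥ 1, |coth| dominates 1/|sinh|. -/
lemma tendsto_abs_cothXi (hh : 0 < h) {t₀ a : ℝ} (ha : a + t₀ = 0) :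
    Tendsto (fun t => |cothXi h t₀ t|) (𝓝[≠] a) atTop := by
  have hr0 : 0 < √(3 * h) := by positivity
  have hs : Tendsto (fun t => Real.sinh (√(3 * h) / 2 * (t + t₀))) (𝓝[≠] a) (𝓝[≠] 0) := by
    refine tendsto_nhdsWithin_iff.mpr ⟨?_, ?_⟩
    · have : Tendsto (fun t => Real.sinh (√(3 * h) / 2 * (t + t₀))) (𝓝 a)
          (𝓝 (Real.sinh (√(3 * h) / 2 * (a + t₀)))) := Continuous.tendsto (by fun_prop) _
      rw [ha, mul_zero, Real.sinh_zero] at this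
      exact this.mono_left nhdsWithin_le_nhds
    · filter_upwards [self_mem_nhdsWithin] with t ht
      rw [Set.mem_compl_singleton_iff, ne_eq, Real.sinh_eq_zero]
      refine mul_ne_zero (by positivity) fun h0 => ht ?_
      rw [Set.mem_singleton_iff]
      linarith
  have h1 := (tendsto_norm_inv_nhdsNE_zero_atTop (α := ℝ)).comp hs
  refine tendsto_atTop_mono (fun t => ?_) (h1.const_mul_atTop hr0)
  simp only [Function.comp, norm_inv, Real.norm_eq_abs, cothXi, abs_mul, abs_div, abs_of_pos hr0]
  rw [div_eq_mul_inv]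
  gcongr
  exact le_mul_of_one_le_left (by positivity) ((Real.one_le_cosh _).trans (le_abs_self _))

lemma isEnergyTrajectory_const {C₀ a b : ℝ} (hs : IsStationaryPoint (p0 h) a b)
    (he : p0 h a b = C₀) : IsEnergyTrajectory h C₀ Set.univ (fun _ => a) (fun _ => b) := by
  refine ⟨fun t _ => ?_, fun t _ => he⟩
  rw [hs.1, hs.2, neg_zero]
  exact ⟨hasDerivAt_const t a, hasDerivAt_const t b⟩

lemma IsHamiltonTrajectory.eqOn_univ {I : Set ℝ} {x ξ X Ξ : ℝ → ℝ} (hI : IsOpen I)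
    (hc : I.OrdConnected) (hx : IsHamiltonTrajectory (p0 h) I x ξ)
    (hX : IsHamiltonTrajectory (p0 h) Set.univ X Ξ) {τ : ℝ} (hτI : τ ∈ I)
    (h1 : x τ = X τ) (h2 : ξ τ = Ξ τ) : ∀ t ∈ I, x t = X t ∧ ξ t = Ξ t := fun t ht =>
  (hx.eqOn_of_blowup hI hc isOpen_univ hX (fun a ha => absurd (Set.mem_univ a) ha) hτI
    (Set.mem_univ τ) h1 h2 t ht).2

/-- The trajectories of energy zero. -/
lemma zero_energy_classification (hh : 0 < h) {I : Set ℝ} {x ξ : ℝ → ℝ} (hI : IsOpen I)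
    (hc : I.OrdConnected) (hx : IsHamiltonTrajectory (p0 h) I x ξ) {τ : ℝ} (hτ : τ ∈ I)
    (he : p0 h (x τ) (ξ τ) = 0) :
    (∃ t₀ : ℝ, IsCothOrbit h t₀ I x ξ) ∨ (∃ t₀ : ℝ, IsTanhOrbit h t₀ I x ξ) ∨
      (∃ ε t₀ : ℝ, (ε = 1 ∨ ε = -1) ∧ IsSechOrbit h ε t₀ I x ξ) ∨
      IsConstOrbit 0 (√(3 * h)) I x ξ ∨ IsConstOrbit 0 (-√(3 * h)) I x ξ := by
  have hr : √(3 * h) ^ 2 = 3 * h := Real.sq_sqrt (by linarith)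
  have hr0 : 0 < √(3 * h) := by positivity
  have he' : x τ * (x τ ^ 2 + ξ τ ^ 2 - 3 * h) = 0 := by
    rw [p0] at he; linear_combination 2 * he
  by_cases hx0 : x τ = 0
  -- On the axis ξ̇ = (3h - ξ²)/2, so ξ² below, at or above 3h separates tanh, rest and coth. The
  -- inverse hyperbolic tangent supplies the shift, applied to √(3h)/ξ in the coth case.
  · rcases lt_trichotomy (ξ τ ^ 2) (√(3 * h) ^ 2) with hlt | heq | hgt
    · right; left
      have hy : ξ τ / √(3 * h) ∈ Set.Ioo (-1 : ℝ) 1 := by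
        have := abs_lt_of_sq_lt_sq hlt hr0.le
        rw [abs_lt] at this
        constructor
        · rw [lt_div_iff₀ hr0]; linarith
        · rw [div_lt_iff₀ hr0]; linarith
      refine ⟨Real.artanh (ξ τ / √(3 * h)) / (√(3 * h) / 2) - τ, ?_⟩
      refine hx.eqOn_univ hI hc (isEnergyTrajectory_tanh hh _).1 hτ hx0 ?_
      change ξ τ = tanhXi h _ τ
      rw [tanhXi, add_sub_cancel, mul_div_cancel₀ _ (by positivity), Real.tanh_artanh hy]
      field_simp
    · right; right; right
      rcases sq_eq_sq_iff_eq_or_eq_neg.mp heq with e | e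
      · left
        exact hx.eqOn_univ hI hc (isEnergyTrajectory_const (C₀ := 0)
          ((isStationaryPoint_iff hh.le _ _).mpr (Or.inl ⟨rfl, Or.inl rfl⟩)) (by simp [p0])).1
          hτ hx0 e
      · right
        exact hx.eqOn_univ hI hc (isEnergyTrajectory_const (C₀ := 0)
          ((isStationaryPoint_iff hh.le _ _).mpr (Or.inl ⟨rfl, Or.inr rfl⟩)) (by simp [p0])).1
          hτ hx0 e
    · left
      have hξ0 : ξ τ ≠ 0 := by
        intro h0
        rw [h0] at hgt
        have : 0 < √(3 * h) ^ 2 := by positivity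
        linarith
      have hy : √(3 * h) / ξ τ ∈ Set.Ioo (-1 : ℝ) 1 := by
        rw [Set.mem_Ioo, ← abs_lt, abs_div, div_lt_one (abs_pos.mpr hξ0)]
        exact sq_lt_sq.mp hgt
      have hu0 : Real.artanh (√(3 * h) / ξ τ) ≠ 0 := by
        intro h0
        have := Real.tanh_artanh hy
        rw [h0, Real.tanh_zero] at this
        exact div_ne_zero hr0.ne' hξ0 this.symm
      set t₀ := Real.artanh (√(3 * h) / ξ τ) / (√(3 * h) / 2) - τ with ht₀
      have hτR : τ + t₀ ≠ 0 := by
        rw [ht₀, add_sub_cancel]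
        exact div_ne_zero hu0 (by positivity)
      refine ⟨t₀, hx.eqOn_of_blowup hI hc (isOpen_coth_domain t₀)
        (isEnergyTrajectory_coth hh t₀).1 (fun a ha => tendsto_abs_cothXi hh (not_not.mp ha))
        hτ hτR hx0 ?_⟩
      change ξ τ = cothXi h _ τ
      rw [cothXi, ht₀, add_sub_cancel, mul_div_cancel₀ _ (by positivity), ← inv_div,
        ← Real.tanh_eq_sinh_div_cosh, Real.tanh_artanh hy]
      field_simp
  · right; right; left
    -- Off the axis the point lies on the circle with |ξ| < √(3h); ξ determines t₀, and ε is the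
    -- sign of x.
    have hcirc : x τ ^ 2 + ξ τ ^ 2 = √(3 * h) ^ 2 := by
      rw [hr]
      have := (mul_eq_zero.mp he').resolve_left hx0
      linarith
    have hx2 : 0 < x τ ^ 2 := by positivity
    have hy : -ξ τ / √(3 * h) ∈ Set.Ioo (-1 : ℝ) 1 := by
      rw [Set.mem_Ioo, ← abs_lt, abs_div, div_lt_one (abs_pos.mpr hr0.ne'), abs_neg]
      exact sq_lt_sq.mp (by linarith)
    have hpos : 0 ≤ 1 - (-ξ τ / √(3 * h)) ^ 2 := by
      have : (-ξ τ / √(3 * h)) ^ 2 < 1 := by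
        rw [sq_lt_one_iff_abs_lt_one, abs_lt]; exact hy
      linarith
    have hcosh : √(3 * h) * (1 / Real.cosh (Real.artanh (-ξ τ / √(3 * h)))) = |x τ| := by
      rw [Real.cosh_artanh hy, one_div_one_div, ← sq_eq_sq₀ (by positivity) (abs_nonneg _),
        mul_pow, Real.sq_sqrt hpos, sq_abs]
      field_simp
      linarith
    obtain ⟨ε, hε, hεx⟩ : ∃ ε : ℝ, (ε = 1 ∨ ε = -1) ∧ x τ = ε * |x τ| := by
      rcases abs_choice (x τ) with e | e
      · exact ⟨1, Or.inl rfl, by rw [e, one_mul]⟩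
      · exact ⟨-1, Or.inr rfl, by rw [e]; ring⟩
    refine ⟨ε, Real.artanh (-ξ τ / √(3 * h)) / √(3 * h) - τ, hε, ?_⟩
    refine hx.eqOn_univ hI hc (isEnergyTrajectory_sech hh hε _).1 hτ ?_ ?_
    · change x τ = sechX h ε _ τ
      rw [sechX, add_sub_cancel, mul_div_cancel₀ _ hr0.ne', mul_assoc, hcosh]
      exact hεx
    · change ξ τ = sechXi h _ τ
      rw [sechXi, add_sub_cancel, mul_div_cancel₀ _ hr0.ne', Real.tanh_artanh hy]
      field_simp

end zero_energy

/-! ### Classification of trajectories and loops -/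

section main

variable {h C₀ : ℝ} {L : PeriodPair} {ω₁ : ℂ}

lemma IsAdmissibleShift.sub_real {t₀ : ℂ} (h : IsAdmissibleShift ω₁ t₀) (τ : ℝ) :
    IsAdmissibleShift ω₁ (t₀ - τ) := by
  rcases h with ⟨s, rfl⟩ | ⟨s, rfl⟩
  · exact Or.inl ⟨s - τ, by push_cast; ring⟩
  · exact Or.inr ⟨s - τ, by push_cast; ring⟩

lemma formula_eq_of_curve_point {P : ℂ → ℂ} {a b p q : ℝ} {t₀ : ℂ} {τ : ℝ}
    (ha : a = 1 / 2 * C₀ * (p - h / 4)⁻¹) (hb : b = -q / (p - h / 4))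
    (hp : P (τ + t₀) = p) (hq : deriv P (τ + t₀) = q) :
    a = formulaX P h C₀ t₀ τ ∧ b = formulaXi P h t₀ τ := by
  rw [formulaX, formulaXi, hp, hq, Complex.ofReal_re, Complex.ofReal_re]
  exact ⟨ha, hb⟩

/-- Every trajectory of nonzero energy follows the formula. -/
lemma IsFlowLattice.exists_followsFormula (hL : IsFlowLattice h C₀ L ω₁) (hh : 0 ≤ h)
    (hC : C₀ ≠ 0) {I : Set ℝ} {x ξ : ℝ → ℝ} (hI : IsOpen I) (hc : I.OrdConnected)
    (hx : IsHamiltonTrajectory (p0 h) I x ξ) {τ : ℝ} (hτ : τ ∈ I)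
    (he : p0 h (x τ) (ξ τ) = C₀) :
    ∃ t₀ : ℂ, IsAdmissibleShift ω₁ t₀ ∧
      FollowsFormula L.weierstrassP L.lattice h C₀ t₀ I x ξ := by
  obtain ⟨p, q, hpq, -, ha, hb⟩ := exists_curve_point hC he
  obtain ⟨t₀, hadm, hnm, hp, hq⟩ := hL.exists_shift hh hC hL.sq_ne hpq
  have e : (τ : ℂ) + (t₀ - τ) = t₀ := by ring
  have hadm' := hadm.sub_real τ
  obtain ⟨h1, h2⟩ := formula_eq_of_curve_point (P := L.weierstrassP) (t₀ := t₀ - τ) (τ := τ) ha hb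
    (by rw [e, hp]) (by rw [e, L.deriv_weierstrassP, hq])
  exact ⟨t₀ - τ, hadm', (hL.isRealWeierstrassLine hadm').followsFormula_of_eq hC hI hc hx hτ
    (by rw [e]; exact hnm) h1 h2⟩

lemma IsFlowLattice.exists_trajectory_through (hL : IsFlowLattice h C₀ L ω₁) (hh : 0 ≤ h)
    (hC : C₀ ≠ 0) {a b : ℝ} (he : p0 h a b = C₀) :
    ∃ (t₀ : ℂ) (x ξ : ℝ → ℝ), IsAdmissibleShift ω₁ t₀ ∧
      t₀ ∉ L.lattice ∧ x 0 = a ∧ ξ 0 = b ∧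
      FollowsFormula L.weierstrassP L.lattice h C₀ t₀ (regularTimes L.lattice t₀) x ξ ∧
      IsEnergyTrajectory h C₀ (regularTimes L.lattice t₀) x ξ := by
  obtain ⟨p, q, hpq, -, ha, hb⟩ := exists_curve_point hC he
  obtain ⟨t₀, hadm, hnm, hp, hq⟩ := hL.exists_shift hh hC hL.sq_ne hpq
  obtain ⟨h1, h2⟩ := formula_eq_of_curve_point (P := L.weierstrassP) (t₀ := t₀) (τ := 0) ha hb
    (by simpa using hp) (by simpa using hq)
  obtain ⟨h3, h4, -⟩ := (hL.isRealWeierstrassLine hadm).exists_trajectory hC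
  exact ⟨t₀, _, _, hadm, hnm, h1.symm, h2.symm, h3, h4⟩

/-- Below the critical energy the trajectories on the shifted line are loops. -/
lemma IsFlowLattice.Subcritical.isFlowLoop {w e₁ e₂ e₃ : ℝ}
    (hS : IsFlowLattice.Subcritical h C₀ L ω₁ w e₁ e₂ e₃) (hL : IsFlowLattice h C₀ L ω₁)
    (hC : C₀ ≠ 0) (s : ℝ) :
    IsFlowLoop h C₀ (formulaX L.weierstrassP h C₀ (s + ω₁ / 2))
        (formulaXi L.weierstrassP h (s + ω₁ / 2)) ∧
      FollowsFormula L.weierstrassP L.lattice h C₀ (s + ω₁ / 2) Set.univ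
        (formulaX L.weierstrassP h C₀ (s + ω₁ / 2))
        (formulaXi L.weierstrassP h (s + ω₁ / 2)) := by
  have hline := hL.isRealWeierstrassLine (t₀ := s + ω₁ / 2) (Or.inr ⟨s, rfl⟩)
  obtain ⟨h1, h2, -⟩ := hline.exists_trajectory hC
  have huniv : regularTimes L.lattice (s + ω₁ / 2) = Set.univ := by
    rw [Set.eq_univ_iff_forall]
    intro t ht
    have := hS.notMem (t + s)
    rw [Complex.ofReal_add, add_assoc] at this
    exact this ht
  rw [huniv] at h1 h2
  have hwm : (w : ℂ) ∈ L.lattice := by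
    simpa using PeriodPair.mem_linePeriods.mp hS.isLeast.1.1
  have hper : ∀ t : ℝ, formulaX L.weierstrassP h C₀ (s + ω₁ / 2) (t + w) =
        formulaX L.weierstrassP h C₀ (s + ω₁ / 2) t ∧
      formulaXi L.weierstrassP h (s + ω₁ / 2) (t + w) =
        formulaXi L.weierstrassP h (s + ω₁ / 2) t := by
    intro t
    have e : (t : ℂ) + (s + ω₁ / 2) = ((t + w : ℝ) : ℂ) + (s + ω₁ / 2) - w := by
      push_cast; ring
    have e1 := PeriodPair.weierstrassP_sub_mem hwm (((t + w : ℝ) : ℂ) + (s + ω₁ / 2))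
    have e2 := PeriodPair.derivWeierstrassP_sub_mem hwm (((t + w : ℝ) : ℂ) + (s + ω₁ / 2))
    rw [← e] at e1 e2
    simp only [formulaX, formulaXi, L.deriv_weierstrassP, e1, e2, and_self]
  -- The times -s and w/2 - s correspond to the half periods ω₁/2 and w/2 + ω₁/2, where ℘ takes the
  -- distinct values e₁ and e₃.
  refine ⟨⟨h2, ⟨w, hS.isLeast.1.2, hper⟩, ⟨-s, w / 2 - s, ?_⟩, ?_⟩, h1⟩
  · intro heq
    have hX := congrArg Prod.fst heq
    simp only [formulaX] at hX
    rw [show ((-s : ℝ) : ℂ) + (s + ω₁ / 2) = ω₁ / 2 by push_cast; ring,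
      show ((w / 2 - s : ℝ) : ℂ) + (s + ω₁ / 2) = (w / 2 : ℝ) + ω₁ / 2 by push_cast; ring,
      hS.imaginary_half, hS.sum_half, Complex.ofReal_re, Complex.ofReal_re] at hX
    have := inv_injective (mul_left_cancel₀ (mul_ne_zero (by norm_num) hC) hX)
    linarith [hS.lt₁₃]
  · have hd := isHamiltonTrajectory_iff.mp h2.1
    have hcont : Continuous fun t => (formulaX L.weierstrassP h C₀ (s + ω₁ / 2) t,
        formulaXi L.weierstrassP h (s + ω₁ / 2) t) :=
      continuous_iff_continuousAt.mpr fun t => (hd t (Set.mem_univ t)).1.continuousAt.prodMk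
        (hd t (Set.mem_univ t)).2.continuousAt
    have hp : Function.Periodic (fun t => (formulaX L.weierstrassP h C₀ (s + ω₁ / 2) t,
        formulaXi L.weierstrassP h (s + ω₁ / 2) t)) w := fun t =>
      Prod.ext (hper t).1 (hper t).2
    exact (hp.compact_of_continuous hS.isLeast.1.2.ne' hcont).isBounded

/-- A trajectory defined for all times does not follow the formula along the real axis. -/
lemma not_followsFormula_univ_of_pole {P : ℂ → ℂ} {S : Set ℂ} {t₀ : ℂ} {x ξ : ℝ → ℝ} {a : ℝ}
    (ha : (a : ℂ) + t₀ ∈ S) : ¬ FollowsFormula P S h C₀ t₀ Set.univ x ξ := fun hf =>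
  (hf a (Set.mem_univ a)).1 ha

/-- A loop exists for all times, whereas the line ℝ contains the pole 0; only the shifted line
remains. -/
lemma IsFlowLattice.exists_followsFormula_of_loop (hL : IsFlowLattice h C₀ L ω₁) (hh : 0 ≤ h)
    (hC : C₀ ≠ 0) {x ξ : ℝ → ℝ} (hloop : IsFlowLoop h C₀ x ξ) :
    ∃ s : ℝ, FollowsFormula L.weierstrassP L.lattice h C₀ (s + ω₁ / 2) Set.univ x ξ := by
  obtain ⟨t₀, ⟨s, rfl⟩ | ⟨s, rfl⟩, hf⟩ := hL.exists_followsFormula hh hC isOpen_univ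
    Set.ordConnected_univ hloop.1.1 (Set.mem_univ 0) (hloop.1.2 0 (Set.mem_univ 0))
  · exact absurd hf (not_followsFormula_univ_of_pole (a := -s) (by simp))
  · exact ⟨s, hf⟩

lemma critical_pos (hh : 0 ≤ h) (hC : C₀ ≠ 0) (hcrit : C₀ ^ 2 = h ^ 3) : 0 < h := by
  rcases hh.lt_or_eq with h0 | h0
  · exact h0
  · exfalso
    rw [← h0] at hcrit
    exact hC (by simpa using hcrit)

lemma critical_energy (hh : 0 < h) (hcrit : C₀ ^ 2 = h ^ 3) :
    IsStationaryPoint (p0 h) (-C₀ / h) 0 ∧ p0 h (-C₀ / h) 0 = C₀ := by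
  have h1 : (-C₀ / h) ^ 2 = h := by
    rw [div_pow, neg_sq, hcrit]
    field_simp
  constructor
  · rw [IsStationaryPoint, deriv_p0_snd, deriv_p0_fst, h1]
    constructor <;> ring
  · have : p0 h (-C₀ / h) 0 = 1 / 2 * (-C₀ / h) * (-C₀ / h) ^ 2 - 3 / 2 * h * (-C₀ / h) := by
      unfold p0; ring
    rw [this, h1]
    field_simp
    ring

/-- The trajectories of critical energy. -/
lemma critical_classification (hh : 0 < h) (hC : C₀ ≠ 0) (hcrit : C₀ ^ 2 = h ^ 3) {I : Set ℝ}
    {x ξ : ℝ → ℝ} (hI : IsOpen I) (hc : I.OrdConnected)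
    (hx : IsHamiltonTrajectory (p0 h) I x ξ) {τ : ℝ} (hτ : τ ∈ I)
    (he : p0 h (x τ) (ξ τ) = C₀) :
    IsConstOrbit (-C₀ / h) 0 I x ξ ∨
      ∃ s : ℝ, FollowsFormula (degenerateP h) (degeneratePoles h) h C₀ s I x ξ := by
  obtain ⟨p, q, hpq, -, ha, hb⟩ := exists_curve_point hC he
  -- The node P = -h/4, Q = 0 of the curve corresponds to the stationary point.
  by_cases hp : p = -(h / 4)
  · left
    have hq : q = 0 := by
      rw [hp, flowCubic_eq', hcrit] at hpq
      simpa using hpq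
    obtain ⟨hs, hE⟩ := critical_energy hh hcrit
    refine hx.eqOn_univ hI hc (isEnergyTrajectory_const hs hE).1 hτ ?_ ?_
    · rw [ha, hp]
      field_simp
      ring
    · rw [hb, hq]
      simp
  · right
    obtain ⟨s, hsS, hsp, hsq⟩ := exists_degenerateP_eq hh hcrit hpq hp
    have e : (τ : ℂ) + ((s - τ : ℝ) : ℂ) = s := by push_cast; ring
    obtain ⟨h1, h2⟩ := formula_eq_of_curve_point (P := degenerateP h) (t₀ := ((s - τ : ℝ) : ℂ))
      (τ := τ) ha hb (by rw [e, hsp]) (by rw [e, hsq])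
    exact ⟨s - τ, (isRealWeierstrassLine_degenerateP hh hcrit (s - τ)).followsFormula_of_eq hC
      hI hc hx hτ (by rw [e]; exact hsS) h1 h2⟩

/-- Loops of energy `C₀` exist exactly below the critical energy. -/
lemma exists_isFlowLoop_iff (hh : 0 ≤ h) (hC : C₀ ≠ 0) :
    (∃ x ξ : ℝ → ℝ, IsFlowLoop h C₀ x ξ) ↔ C₀ ^ 2 < h ^ 3 := by
  constructor
  · rintro ⟨x, ξ, hloop⟩
    rcases lt_trichotomy (C₀ ^ 2) (h ^ 3) with hlt | heq | hgt
    · exact hlt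
    · exfalso
      have hpos := critical_pos hh hC heq
      rcases critical_classification hpos hC heq isOpen_univ Set.ordConnected_univ hloop.1.1
        (Set.mem_univ 0) (hloop.1.2 0 (Set.mem_univ 0)) with hconst | ⟨s, hf⟩
      · obtain ⟨t, t', hne⟩ := hloop.2.2.1
        obtain ⟨h1, h2⟩ := hconst t (Set.mem_univ t)
        obtain ⟨h3, h4⟩ := hconst t' (Set.mem_univ t')
        exact hne (by rw [h1, h2, h3, h4])
      · exact not_followsFormula_univ_of_pole (a := -s) (by simp [degeneratePoles]) hf
    · exfalso
      obtain ⟨L, ω₁, hL⟩ := exists_isFlowLattice hC hgt.ne'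
      obtain ⟨s, hf⟩ := hL.exists_followsFormula_of_loop hh hC hloop
      obtain ⟨a, ha⟩ := hL.exists_pole hh hC hgt (t₀ := s + ω₁ / 2) (Or.inr ⟨s, rfl⟩)
      exact not_followsFormula_univ_of_pole ha hf
  · intro hlt
    obtain ⟨L, ω₁, hL⟩ := exists_isFlowLattice hC hlt.ne
    obtain ⟨w, e₁, e₂, e₃, hS⟩ := hL.exists_subcritical hC hlt
    exact ⟨_, _, (hS.isFlowLoop hL hC 0).1⟩

end main

theorem mainTheorem4 (h : ℝ) (hh : 0 ≤ h) :
    -- stationary points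
    (∀ a b : ℝ, IsStationaryPoint (p0 h) a b ↔
      (a = 0 ∧ (b = √(3 * h) ∨ b = -√(3 * h))) ∨ ((a = √h ∨ a = -√h) ∧ b = 0)) ∧
    -- nonzero energy
    (∀ C₀ : ℝ, C₀ ≠ 0 →
      -- existence of the Weierstrass function with the given invariants
      (C₀ ^ 2 ≠ h ^ 3 → ∃ (L : PeriodPair) (ω₁ : ℂ), IsFlowLattice h C₀ L ω₁) ∧
      (∀ (L : PeriodPair) (ω₁ : ℂ), IsFlowLattice h C₀ L ω₁ →
        -- the formula defines a trajectory, which blows up exactly at the poles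
        (∀ t₀ : ℂ, IsAdmissibleShift ω₁ t₀ → ∃ x ξ : ℝ → ℝ,
          FollowsFormula L.weierstrassP L.lattice h C₀ t₀ (regularTimes L.lattice t₀) x ξ ∧
          IsEnergyTrajectory h C₀ (regularTimes L.lattice t₀) x ξ ∧
          BlowsUpAtPoles L.lattice t₀ ξ) ∧
        -- every trajectory is of this form
        (∀ (I : Set ℝ) (x ξ : ℝ → ℝ), IsOpen I → I.OrdConnected →
          IsHamiltonTrajectory (p0 h) I x ξ → (∃ τ ∈ I, p0 h (x τ) (ξ τ) = C₀) →
          IsEnergyTrajectory h C₀ I x ξ ∧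
          ∃ t₀ : ℂ, IsAdmissibleShift ω₁ t₀ ∧
            FollowsFormula L.weierstrassP L.lattice h C₀ t₀ I x ξ) ∧
        -- every point of the energy level is met
        (∀ a b : ℝ, p0 h a b = C₀ → ∃ (t₀ : ℂ) (x ξ : ℝ → ℝ), IsAdmissibleShift ω₁ t₀ ∧
          t₀ ∉ L.lattice ∧ x 0 = a ∧ ξ 0 = b ∧
          FollowsFormula L.weierstrassP L.lattice h C₀ t₀ (regularTimes L.lattice t₀) x ξ ∧
          IsEnergyTrajectory h C₀ (regularTimes L.lattice t₀) x ξ) ∧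
        -- the periods, and the loops, which are exactly the orbits with the shift `ω₁ / 2`
        (C₀ ^ 2 < h ^ 3 →
          (∃ e₁ e₂ e₃ : ℝ, e₁ < e₃ ∧ e₃ < e₂ ∧
            (∀ s : ℝ, 4 * s ^ 3 - flowG2 h * s - flowG3 h C₀ =
              4 * (s - e₁) * (s - e₂) * (s - e₃)) ∧
            ω₁ / 2 = Complex.I *
              (∫ s in Set.Iio e₁, 1 / √(flowG3 h C₀ + flowG2 h * s - 4 * s ^ 3) : ℝ) ∧
            ∃ ω₂ : ℝ,
              ω₂ / 2 = ∫ s in Set.Ioi e₂, 1 / √(4 * s ^ 3 - flowG2 h * s - flowG3 h C₀) ∧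
              0 < ω₂ ∧ L.lattice = Submodule.span ℤ {ω₁, (ω₂ : ℂ)}) ∧
          (∀ s : ℝ, ∃ x ξ : ℝ → ℝ, IsFlowLoop h C₀ x ξ ∧
            FollowsFormula L.weierstrassP L.lattice h C₀ (s + ω₁ / 2) Set.univ x ξ) ∧
          (∀ x ξ : ℝ → ℝ, IsFlowLoop h C₀ x ξ → ∃ s : ℝ,
            FollowsFormula L.weierstrassP L.lattice h C₀ (s + ω₁ / 2) Set.univ x ξ)) ∧
        -- above the critical energy every orbit of the formula has poles
        (h ^ 3 < C₀ ^ 2 → ∀ t₀ : ℂ, IsAdmissibleShift ω₁ t₀ →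
          ∃ a : ℝ, (a : ℂ) + t₀ ∈ L.lattice)) ∧
      -- existence of loops
      ((∃ x ξ : ℝ → ℝ, IsFlowLoop h C₀ x ξ) ↔ C₀ ^ 2 < h ^ 3) ∧
      -- critical energy: the loop is a point, and there is an unbounded orbit
      (C₀ ^ 2 = h ^ 3 →
        Tendsto (fun z : ℂ => z ^ 2 * degenerateP h z) (𝓝[≠] 0) (𝓝 1) ∧
        (∀ z : ℂ, z ∉ degeneratePoles h → DifferentiableAt ℂ (degenerateP h) z ∧
          deriv (degenerateP h) z ^ 2 =
            4 * degenerateP h z ^ 3 - flowG2 h * degenerateP h z - flowG3 h C₀) ∧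
        IsStationaryPoint (p0 h) (-C₀ / h) 0 ∧ p0 h (-C₀ / h) 0 = C₀ ∧
        (∀ s : ℝ, ∃ x ξ : ℝ → ℝ,
          FollowsFormula (degenerateP h) (degeneratePoles h) h C₀ s
            (regularTimes (degeneratePoles h) s) x ξ ∧
          IsEnergyTrajectory h C₀ (regularTimes (degeneratePoles h) s) x ξ ∧
          BlowsUpAtPoles (degeneratePoles h) s ξ) ∧
        (∀ (I : Set ℝ) (x ξ : ℝ → ℝ), IsOpen I → I.OrdConnected →
          IsHamiltonTrajectory (p0 h) I x ξ → (∃ τ ∈ I, p0 h (x τ) (ξ τ) = C₀) →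
          IsEnergyTrajectory h C₀ I x ξ ∧
          (IsConstOrbit (-C₀ / h) 0 I x ξ ∨
            ∃ s : ℝ, FollowsFormula (degenerateP h) (degeneratePoles h) h C₀ s I x ξ)))) ∧
    -- zero energy
    (0 < h →
      (∀ (t₀ : ℝ) (x ξ : ℝ → ℝ), IsCothOrbit h t₀ {t | t + t₀ ≠ 0} x ξ →
        IsEnergyTrajectory h 0 {t | t + t₀ ≠ 0} x ξ) ∧
      (∀ (t₀ : ℝ) (x ξ : ℝ → ℝ), IsTanhOrbit h t₀ Set.univ x ξ →
        IsEnergyTrajectory h 0 Set.univ x ξ) ∧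
      (∀ (ε t₀ : ℝ) (x ξ : ℝ → ℝ), (ε = 1 ∨ ε = -1) → IsSechOrbit h ε t₀ Set.univ x ξ →
        IsEnergyTrajectory h 0 Set.univ x ξ) ∧
      (∀ (I : Set ℝ) (x ξ : ℝ → ℝ), IsOpen I → I.OrdConnected →
        IsHamiltonTrajectory (p0 h) I x ξ → (∃ τ ∈ I, p0 h (x τ) (ξ τ) = 0) →
        IsEnergyTrajectory h 0 I x ξ ∧
        ((∃ t₀ : ℝ, IsCothOrbit h t₀ I x ξ) ∨ (∃ t₀ : ℝ, IsTanhOrbit h t₀ I x ξ) ∨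
          (∃ ε t₀ : ℝ, (ε = 1 ∨ ε = -1) ∧ IsSechOrbit h ε t₀ I x ξ) ∨
          IsConstOrbit 0 (√(3 * h)) I x ξ ∨ IsConstOrbit 0 (-√(3 * h)) I x ξ))) := by
  refine ⟨isStationaryPoint_iff hh, fun C₀ hC => ⟨exists_isFlowLattice hC, ?_,
    exists_isFlowLoop_iff hh hC, ?_⟩, ?_⟩
  · intro L ω₁ hL
    refine ⟨fun t₀ ht₀ => ⟨_, _, (hL.isRealWeierstrassLine ht₀).exists_trajectory hC⟩, ?_,
      fun a b hab => hL.exists_trajectory_through hh hC hab, ?_,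
      fun hlt t₀ ht₀ => hL.exists_pole hh hC hlt ht₀⟩
    · rintro I x ξ hI hc hx ⟨τ, hτ, he⟩
      exact ⟨hx.isEnergyTrajectory hI hc ⟨τ, hτ, he⟩,
        hL.exists_followsFormula hh hC hI hc hx hτ he⟩
    · intro hlt
      obtain ⟨w, e₁, e₂, e₃, hS⟩ := hL.exists_subcritical hC hlt
      refine ⟨⟨e₁, e₂, e₃, hS.lt₁₃, hS.lt₃₂, hS.factor, ?_, w, ?_, hS.isLeast.1.2,
        hS.lattice_eq hL⟩, fun s => ⟨_, _, hS.isFlowLoop hL hC s⟩,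
        fun x ξ hloop => hL.exists_followsFormula_of_loop hh hC hloop⟩
      · rw [hS.integral_imaginary]
        conv_lhs => rw [(IsImaginaryPeriod.isLeast hL.2.2).1]
        push_cast
        ring
      · exact hS.integral_real.symm
  · intro hcrit
    have hpos := critical_pos hh hC hcrit
    obtain ⟨hs, he⟩ := critical_energy hpos hcrit
    refine ⟨?_, fun z hz => ⟨(hasDerivAt_degenerateP hpos hz).differentiableAt,
      degenerateP_cubic hpos hcrit hz⟩, hs, he,
      fun s => ⟨_, _, (isRealWeierstrassLine_degenerateP hpos hcrit s).exists_trajectory hC⟩, ?_⟩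
    · refine (tendsto_degenerateP_mul_sq hpos (l := 0) (by simp [degeneratePoles])).congr
        fun z => ?_
      rw [sub_zero, mul_comm]
    · rintro I x ξ hI hc hx ⟨τ, hτ, he⟩
      exact ⟨hx.isEnergyTrajectory hI hc ⟨τ, hτ, he⟩,
        critical_classification hpos hC hcrit hI hc hx hτ he⟩
  · intro hpos
    refine ⟨fun t₀ x ξ ho => isEnergyTrajectory_of_eqOn (isOpen_coth_domain t₀)
        (isEnergyTrajectory_coth hpos t₀) fun t ht => (ho t ht).2,
      fun t₀ x ξ ho => isEnergyTrajectory_of_eqOn isOpen_univ (isEnergyTrajectory_tanh hpos t₀) ho,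
      fun ε t₀ x ξ hε ho => isEnergyTrajectory_of_eqOn isOpen_univ
        (isEnergyTrajectory_sech hpos hε t₀) ho, ?_⟩
    rintro I x ξ hI hc hx ⟨τ, hτ, he⟩
    exact ⟨hx.isEnergyTrajectory hI hc ⟨τ, hτ, he⟩,
      zero_energy_classification hpos hI hc hx hτ he⟩
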